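/- **Setting.** Let $\mathcal K$ be a triangulated category with translation $T$ and with a symmetric monoidal structure $\otimes$ with unit $1$ which is exact in each variable, the two resulting isomorphisms $T(a)\otimes T(b)\cong T^2(a\otimes b)$ being opposite to each other. Assume that $\mathcal K$ is strongly closed (there is an internal hom, exact in both variables, and $\underline{\hom}(a,1)\otimes b\to\underline{\hom}(a,b)$ is an isomorphism for all $a,b$) and idempotent complete. Let $\operatorname{Spc}(\mathcal K)$ be the set of prime ideals of $\mathcal K$ (proper thick triangulated $\otimes$-ideals $\mathcal P$ such that $a\otimes b\in\mathcal P$ implies $a\in\mathcal P$ or $b\in\mathcal P$), with the topology that has the sets $\{\mathcal P\mid a\in\mathcal P\}$, $a\in\mathcal K$, as a basis, and let $\operatorname{supp}(a)=\{\mathcal P\mid a\notin\mathcal P\}$. For a quasi-compact open $U\subset\operatorname{Spc}(\mathcal K)$ let $\mathcal K(U)$ be the idempotent completion of the Verdier quotient of $\mathcal K$ by the objects with support contained in $\operatorname{Spc}(\mathcal K)\smallsetminus U$, let $\operatorname{Mor}_U(a,b)$ be the group of morphisms in $\mathcal K(U)$ between the images of $a,b\in\mathcal K$, and let $\mathbb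 G_{\rm m}(\mathcal K(U))=\operatorname{Mor}_U(1,1)^\times$, which is an abelian group and a presheaf in $U$ under restriction. Let $\operatorname{Pic}(\mathcal K)$ be the group of isomorphism classes of $\otimes$-invertible objects of $\mathcal K$, and let $\check{\rm H}^1$ be first Čech cohomology, that is, the direct limit over all open covers, ordered by refinement, of the groups of $1$-cocycles modulo coboundaries. **Theorem.** Assume that $\operatorname{Mor}_U(T1,1)=0$ for every quasi-compact open $U\subset\operatorname{Spc}(\mathcal K)$. 1. There is a sheaf of abelian groups $\mathbb G_{\rm m}$ on $\operatorname{Spc}(\mathcal K)$ with isomorphisms $\mathbb G_{\rm m}(U)\cong\mathbb G_{\rm m}(\mathcal K(U))$ for the quasi-compact open subsets $U$, compatible with restriction. It is unique: for any two such sheaves there is exactly one isomorphism between them which is compatible with these identifications. 2. There is an injective group homomorphism $$\alpha:\check{\rm H}^1(\operatorname{Spc}(\mathcal K),\mathbb G_{\rm m})\hookrightarrow\operatorname{Pic}(\mathcal K)$$ with the following property. Let $(U_i)_{i\in I}$ be a finite cover of $\operatorname{Spc}(\mathcal K)$ by quasi-compact open subsets, and let $\sigma=(\sigma_{ji})$,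 $\sigma_{ji}\in\mathbb G_{\rm m}(U_j\cap U_i)$, be a $1$-cocycle ($\sigma_{kj}\sigma_{ji}=\sigma_{ki}$ over $U_i\cap U_j\cap U_k$). Then there is a gluing of copies of $1$ along $\sigma$, that is, an object $a\in\mathcal K$ with isomorphisms $f_i:a\to1$ in $\mathcal K(U_i)$ such that $\sigma_{ji}f_i=f_j$ over $U_i\cap U_j$ for all $i,j\in I$; between any two gluings $(a,(f_i))$ and $(a',(f_i'))$ there is exactly one isomorphism $g:a\to a'$ in $\mathcal K$ such that $f_i'g=f_i$ over $U_i$ for all $i$; and $\alpha$ sends the class of $\sigma$ to the isomorphism class of the gluing. -/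

import Mathlib

open CategoryTheory CategoryTheory.Limits MonoidalCategory Opposite TopologicalSpace
open scoped Pretriangulated.Opposite ZeroObject ZeroObject

universe w u v

/-! ### Čech cohomology in degree one of a presheaf of abelian groups -/

namespace Cech

variable {X : TopCat.{u}} (F : TopCat.Presheaf CommGrpCat.{w} X)

/-- Restriction of sections. -/
def res {U V : Opens X} (h : U ≤ V) : F.obj (op V) →* F.obj (op U) :=
  (F.map (homOfLE h).op).hom

@[simp]
lemma res_res {U V W : Opens X} (h : U ≤ V) (h' : V ≤ W) (x : F.obj (op W)) :
    res F h (res F h' x) = res F (h.trans h') x := by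
  have : F.map (homOfLE (h.trans h')).op = F.map (homOfLE h').op ≫ F.map (homOfLE h).op := by
    rw [← F.map_comp]; rfl
  simp [res, this]

@[simp]
lemma res_self {U : Opens X} (h : U ≤ U) (x : F.obj (op U)) : res F h x = x := by
  have : F.map (homOfLE h).op = 𝟙 _ := by rw [← F.map_id]; rfl
  simp [res]

section Family

variable {ι κ : Type*} (U : ι → Opens X) (V : κ → Opens X)

/-- The group of `0`-cochains of the family `U`. -/
abbrev Cochain₀ : Type _ := ∀ i : ι, F.obj (op (U i))

/-- The group of `1`-cochains of the family `U`. -/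
abbrev Cochain₁ : Type _ := ∀ i j : ι, F.obj (op (U i ⊓ U j))

/-- The group of `1`-cocycles: `σ i j * σ j k = σ i k` over `U i ∩ U j ∩ U k`. -/
def cocycles : Subgroup (Cochain₁ F U) where
  carrier := {σ | ∀ i j k : ι,
    res F (inf_le_left : U i ⊓ U j ⊓ U k ≤ U i ⊓ U j) (σ i j) *
      res F (le_inf (inf_le_left.trans inf_le_right) inf_le_right :
        U i ⊓ U j ⊓ U k ≤ U j ⊓ U k) (σ j k) =
    res F (le_inf (inf_le_left.trans inf_le_left) inf_le_right :
        U i ⊓ U j ⊓ U k ≤ U i ⊓ U k) (σ i k)}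
  mul_mem' {σ τ} hσ hτ i j k := by
    have h₁ := hσ i j k
    have h₂ := hτ i j k
    simp only [Pi.mul_apply, map_mul]
    rw [mul_mul_mul_comm, h₁, h₂]
  one_mem' i j k := by simp
  inv_mem' {σ} hσ i j k := by
    have h₁ := hσ i j k
    simp only [Pi.inv_apply, map_inv]
    rw [← mul_inv, h₁]

/-- The coboundary `(d f) i j = f i / f j` over `U i ∩ U j`. -/
def coboundary : Cochain₀ F U →* Cochain₁ F U where
  toFun f i j := res F inf_le_left (f i) / res F inf_le_right (f j)
  map_one' := by ext; simp
  map_mul' f g := by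
    ext i j
    simp [mul_div_mul_comm]

/-- `Ȟ¹(U, F)`: the `1`-cocycles of the family `U` modulo the coboundaries of `0`-cochains. -/
abbrev H1 : Type _ := cocycles F U ⧸ (coboundary F U).range.subgroupOf (cocycles F U)

lemma cocycle_res {σ : Cochain₁ F U} (hσ : σ ∈ cocycles F U) {W : Opens X} (i j k : ι)
    (hi : W ≤ U i) (hj : W ≤ U j) (hk : W ≤ U k) :
    res F (le_inf hi hj) (σ i j) * res F (le_inf hj hk) (σ j k) =
      res F (le_inf hi hk) (σ i k) := by
  have := congrArg (res F (le_inf (le_inf hi hj) hk)) (hσ i j k)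
  simpa using this

variable {U V}

/-- Pullback of `1`-cocycles along a refinement `r` of `U` by `V`. -/
def refineCocycle (r : κ → ι) (hr : ∀ k, V k ≤ U (r k)) : cocycles F U →* cocycles F V where
  toFun σ := ⟨fun k l => res F (inf_le_inf (hr k) (hr l)) (σ.1 (r k) (r l)), fun i j k => by
    simp only [res_res]
    exact cocycle_res F U σ.2 (W := V i ⊓ V j ⊓ V k) _ _ _
      ((inf_le_left.trans inf_le_left).trans (hr i))
      ((inf_le_left.trans inf_le_right).trans (hr j)) (inf_le_right.trans (hr k))⟩
  map_one' := by ext; simp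
  map_mul' σ τ := by ext; simp

lemma refineCocycle_mem (r : κ → ι) (hr : ∀ k, V k ≤ U (r k)) :
    (coboundary F U).range.subgroupOf (cocycles F U) ≤
      ((coboundary F V).range.subgroupOf (cocycles F V)).comap (refineCocycle F r hr) := by
  rintro ⟨σ, hσ⟩ ⟨f, hf⟩
  refine ⟨fun k => res F (hr k) (f (r k)), ?_⟩
  simp only [Subgroup.coe_subtype] at hf
  subst hf
  ext k l
  simp [coboundary, refineCocycle]

/-- The map on `Ȟ¹` induced by a refinement `r` of `U` by `V`. -/
def refine (r : κ → ι) (hr : ∀ k, V k ≤ U (r k)) : H1 F U →* H1 F V :=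
  QuotientGroup.map _ _ (refineCocycle F r hr) (refineCocycle_mem F r hr)

lemma refine_eq (r s : κ → ι) (hr : ∀ k, V k ≤ U (r k)) (hs : ∀ k, V k ≤ U (s k)) :
    refine F r hr = refine F s hs := by
  refine MonoidHom.ext fun x => ?_
  obtain ⟨σ, rfl⟩ := QuotientGroup.mk_surjective x
  refine (QuotientGroup.eq_iff_div_mem (N := (coboundary F V).range.subgroupOf (cocycles F V))
    (x := refineCocycle F r hr σ) (y := refineCocycle F s hs σ)).2 ?_
  refine ⟨fun k => res F (le_inf (hr k) (hs k)) (σ.1 (r k) (s k)), ?_⟩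
  ext k l
  have h₁ := cocycle_res F U σ.2 (W := V k ⊓ V l) (r k) (r l) (s l)
    (inf_le_left.trans (hr k)) (inf_le_right.trans (hr l)) (inf_le_right.trans (hs l))
  have h₂ := cocycle_res F U σ.2 (W := V k ⊓ V l) (r k) (s k) (s l)
    (inf_le_left.trans (hr k)) (inf_le_left.trans (hs k)) (inf_le_right.trans (hs l))
  simp only [coboundary, refineCocycle, MonoidHom.coe_mk, OneHom.coe_mk, Subgroup.coe_subtype,
    Subgroup.coe_div, Pi.div_apply, res_res]
  rw [div_eq_div_iff_mul_eq_mul, h₂.trans h₁.symm]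

end Family

/-- An open cover of `X`, with an index type in the universe of `X`. -/
structure OpenCover (X : TopCat.{u}) where
  /-- the index type -/
  ι : Type u
  /-- the members of the cover -/
  U : ι → Opens X
  isOpenCover : IsOpenCover U

/-- `𝒰 ≤ 𝒱` means that `𝒱` is a refinement of `𝒰`. -/
instance : Preorder (OpenCover X) where
  le 𝒰 𝒱 := ∀ j, ∃ i, 𝒱.U j ≤ 𝒰.U i
  le_refl _ j := ⟨j, le_rfl⟩
  le_trans _ _ _ h h' k :=
    have ⟨j, hj⟩ := h' k
    have ⟨i, hi⟩ := h j
    ⟨i, hj.trans hi⟩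

instance : Nonempty (OpenCover X) := ⟨⟨PUnit, fun _ => ⊤, by simp [IsOpenCover]⟩⟩

instance : IsDirectedOrder (OpenCover X) where
  directed 𝒰 𝒱 := ⟨⟨𝒰.ι × 𝒱.ι, fun p => 𝒰.U p.1 ⊓ 𝒱.U p.2, by
      rw [IsOpenCover, eq_top_iff]
      intro x _
      obtain ⟨i, hi⟩ := 𝒰.isOpenCover.exists_mem x
      obtain ⟨j, hj⟩ := 𝒱.isOpenCover.exists_mem x
      exact Opens.mem_iSup.2 ⟨(i, j), hi, hj⟩⟩,
    fun p => ⟨p.1, inf_le_left⟩, fun p => ⟨p.2, inf_le_right⟩⟩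

/-- The transition map `Ȟ¹(𝒰, F) → Ȟ¹(𝒱, F)` for a refinement `𝒱` of `𝒰`. -/
noncomputable def transition (𝒰 𝒱 : OpenCover X) (h : 𝒰 ≤ 𝒱) : H1 F 𝒰.U →* H1 F 𝒱.U :=
  refine F (fun j => (h j).choose) (fun j => (h j).choose_spec)

instance : DirectedSystem (fun 𝒰 : OpenCover X => H1 F 𝒰.U) (transition F · · ·) where
  map_self 𝒰 x := by
    rw [transition, refine_eq F _ id _ (fun _ => le_rfl)]
    obtain ⟨σ, rfl⟩ := QuotientGroup.mk_surjective x
    refine congrArg QuotientGroup.mk (Subtype.ext ?_)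
    ext i j
    exact res_self F _ _
  map_map 𝒰 𝒱 𝒲 h h' x := by
    rw [transition, transition, transition,
      refine_eq F (fun j => ((h.trans h') j).choose) (fun k => (h (h' k).choose).choose) _
        (fun k => (h' k).choose_spec.trans (h _).choose_spec)]
    obtain ⟨σ, rfl⟩ := QuotientGroup.mk_surjective x
    refine congrArg QuotientGroup.mk (Subtype.ext ?_)
    ext i j
    exact res_res F _ _ _

/-- The first Čech cohomology group `Ȟ¹(X, F)`: the direct limit of the groups `Ȟ¹(𝒰, F)` over
all open covers `𝒰` of `X`, ordered by refinement. -/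
abbrev CechH1 : Type _ :=
  DirectLimit (fun 𝒰 : OpenCover X => H1 F 𝒰.U) (transition F)

/-- The class in `Ȟ¹(X, F)` of a `1`-cocycle of the open cover `𝒰`. -/
noncomputable def cechClass (𝒰 : OpenCover X) (σ : cocycles F 𝒰.U) : CechH1 F :=
  ⟦⟨𝒰, QuotientGroup.mk σ⟩⟧

end Cech

/-! ### Tensor triangulated categories and their spectrum -/

namespace TTCat

variable (K : Type u) [Category.{v} K] [Preadditive K] [HasZeroObject K] [HasShift K ℤ]
  [∀ n : ℤ, (shiftFunctor K n).Additive] [Pretriangulated K] [MonoidalCategory K]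

/-- The tensor product is exact in each variable: the functors `a ⊗ -` and `- ⊗ b` are equipped
with natural isomorphisms `a ⊗ T b ≅ T (a ⊗ b)` and `T a ⊗ b ≅ T (a ⊗ b)`, for which they preserve
distinguished triangles and for which the two resulting isomorphisms `T a ⊗ T b ≅ T² (a ⊗ b)`
are opposite to each other (the sign is part of `CommShift₂Int`). -/
class TensorTriangulated where
  commShift : (curriedTensor K).CommShift₂Int
  exact_left (a : K) : ((curriedTensor K).obj a).IsTriangulated
  exact_right (b : K) : ((curriedTensor K).flip.obj b).IsTriangulated

attribute [reducible, instance] TensorTriangulated.commShift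
attribute [instance] TensorTriangulated.exact_left TensorTriangulated.exact_right

variable {K}

/-- The canonical morphism `D a ⊗ b ⟶ hom(a, b)`, adjoint to `a ⊗ (D a ⊗ b) ⟶ 𝟙 ⊗ b ≅ b`,
where `D a = hom(a, 𝟙)`. -/
def dualTensorToHom [MonoidalClosed K] (a b : K) :
    (ihom a).obj (𝟙_ K) ⊗ b ⟶ (ihom a).obj b :=
  MonoidalClosed.curry
    ((α_ a ((ihom a).obj (𝟙_ K)) b).inv ≫ ((ihom.ev a).app (𝟙_ K) ▷ b) ≫ (λ_ b).hom)

variable (K) in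
/-- The internal hom is exact in both variables and all objects are strongly dualizable. -/
class StronglyClosed [MonoidalClosed K] : Prop where
  exact_right (a : K) : ∃ _ : (ihom a).CommShift ℤ, (ihom a).IsTriangulated
  exact_left (c : K) : ∃ _ : ((MonoidalClosed.internalHom (C := K)).flip.obj c).CommShift ℤ,
    ((MonoidalClosed.internalHom (C := K)).flip.obj c).IsTriangulated
  isIso_dualTensorToHom (a b : K) : IsIso (dualTensorToHom a b)

/-- Prime ideals: proper, thick, triangulated `⊗`-ideals `P` such that `a ⊗ b ∈ P` implies
`a ∈ P` or `b ∈ P`. -/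
structure IsPrime (P : ObjectProperty K) : Prop where
  isClosedUnderIsomorphisms : P.IsClosedUnderIsomorphisms
  isTriangulated : P.IsTriangulated
  thick (a b : K) : P (a ⊞ b) → P a ∧ P b
  ideal (a b : K) : P a → P (a ⊗ b)
  prime (a b : K) : P (a ⊗ b) → P a ∨ P b
  proper : ∃ a : K, ¬ P a

variable (K) in
/-- The spectrum of `K`: the set of its prime ideals. -/
def Spc : Type u := {P : ObjectProperty K // IsPrime P}

/-- The support of an object. -/
def supp (a : K) : Set (Spc K) := {P | ¬ P.1 a}

/-- The Zariski topology, with the complements of the supports as a basis of open subsets. -/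
instance : TopologicalSpace (Spc K) :=
  TopologicalSpace.generateFrom (Set.range fun a : K => (supp a)ᶜ)

/-- The full subcategory of the objects supported on `Z`. -/
def supportedOn (Z : Set (Spc K)) : ObjectProperty K := fun a => supp a ⊆ Z

lemma isTriangulatedSupp (Z : Set (Spc K)) : (supportedOn Z).IsTriangulated := by
  have hiso : (supportedOn Z).IsClosedUnderIsomorphisms := ⟨by
    intro a b e ha P hP
    have := P.2.isClosedUnderIsomorphisms
    exact ha fun h => hP (P.1.prop_of_iso e h)⟩
  exact
    { exists_zero := ⟨0, isZero_zero K, fun P hP => by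
        have := P.2.isTriangulated
        have := P.2.isClosedUnderIsomorphisms
        exact (hP P.1.prop_zero).elim⟩
      isStableUnderShiftBy := fun n => ⟨fun a ha P hP => by
        have := P.2.isTriangulated
        exact ha fun h => hP (P.1.le_shift n _ h)⟩
      toIsTriangulatedClosed₂ := .mk' fun T hT h₁ h₃ P hP => by
        have := P.2.isTriangulated
        have := P.2.isClosedUnderIsomorphisms
        by_cases h : P.1 T.obj₁
        · exact h₃ fun h' => hP (P.1.ext_of_isTriangulatedClosed₂ T hT h h')
        · exact h₁ h }

instance (Z : Set (Spc K)) : (supportedOn Z).IsTriangulated := isTriangulatedSupp Z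

lemma supportedOn_tensor_left {Z : Set (Spc K)} {a : K} (ha : supportedOn Z a) (b : K) :
    supportedOn Z (a ⊗ b) := fun P hP => ha fun h => hP (P.2.ideal a b h)

lemma supportedOn_tensor_right [BraidedCategory K] {Z : Set (Spc K)} {b : K}
    (hb : supportedOn Z b) (a : K) : supportedOn Z (a ⊗ b) := fun P hP => hb fun h => hP <| by
  have := P.2.isClosedUnderIsomorphisms
  exact P.1.prop_of_iso (β_ b a) (P.2.ideal b a h)

/-! ### The local categories `K(U)` -/

/-- The morphisms of `K` whose cone is supported outside `U`. -/
abbrev locW (U : CompactOpens (Spc K)) : MorphismProperty K :=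
  (supportedOn ((U : Set (Spc K))ᶜ)).trW

/-- The Verdier localization `L(U)` of `K` at the objects supported outside `U`. -/
abbrev LU (U : CompactOpens (Spc K)) : Type u := (locW U).Localization

/-- `K(U)`: the idempotent completion of `L(U)`. -/
abbrev KU (U : CompactOpens (Spc K)) : Type _ := Idempotents.Karoubi (LU U)

/-- The restriction functor `ρ_U : K ⥤ K(U)`. -/
noncomputable def ρ (U : CompactOpens (Spc K)) : K ⥤ KU U := (locW U).Q ⋙ Idempotents.toKaroubi (LU U)

lemma locW_inverts {U V : CompactOpens (Spc K)} (h : U ≤ V) :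
    (locW V).IsInvertedBy (locW U).Q := fun _ _ f hf =>
  (locW U).Q_inverts f (ObjectProperty.trW_monotone
    (fun _ ha => ha.trans (Set.compl_subset_compl.2 h)) _ hf)

/-- The localization functor `L(V) ⥤ L(U)`, for `U ⊆ V`. -/
noncomputable def resL {U V : CompactOpens (Spc K)} (h : U ≤ V) : LU V ⥤ LU U :=
  Localization.Construction.lift (locW U).Q (locW_inverts h)

lemma Q_resL {U V : CompactOpens (Spc K)} (h : U ≤ V) : (locW V).Q ⋙ resL h = (locW U).Q :=
  Localization.Construction.fac _ _

/-- The restriction functor `ρ_{V,U} : K(V) ⥤ K(U)`, for `U ⊆ V`. -/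
noncomputable def resK {U V : CompactOpens (Spc K)} (h : U ≤ V) : KU V ⥤ KU U :=
  (Idempotents.functorExtension₂ _ _).obj (resL h)

/-- The canonical isomorphism `ρ_{V,U} ∘ ρ_V ≅ ρ_U`. -/
noncomputable def ρResK {U V : CompactOpens (Spc K)} (h : U ≤ V) : ρ V ⋙ resK h ≅ ρ U :=
  Functor.isoWhiskerLeft (locW V).Q
    ((Idempotents.functorExtension₂CompWhiskeringLeftToKaroubiIso _ _).app (resL h)) ≪≫
  Functor.isoWhiskerRight (eqToIso (Q_resL h)) (Idempotents.toKaroubi (LU U))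

/-- `Mor_U(a, b)`: the morphisms between `a` and `b` in `K(U)`. -/
abbrev Mor (U : CompactOpens (Spc K)) (a b : K) : Type _ := (ρ U).obj a ⟶ (ρ U).obj b

/-- The restriction `Mor_V(a, b) → Mor_U(a, b)`, for `U ⊆ V`. -/
noncomputable def resMor {U V : CompactOpens (Spc K)} (h : U ≤ V) {a b : K} (f : Mor V a b) : Mor U a b :=
  (ρResK h).inv.app a ≫ (resK h).map f ≫ (ρResK h).hom.app b

@[simp]
lemma resMor_id {U V : CompactOpens (Spc K)} (h : U ≤ V) (a : K) :
    resMor h (𝟙 ((ρ V).obj a)) = 𝟙 _ := by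
  simp [resMor]

@[simp]
lemma resMor_comp {U V : CompactOpens (Spc K)} (h : U ≤ V) {a b c : K} (f : Mor V a b)
    (g : Mor V b c) : resMor h (f ≫ g) = resMor h f ≫ resMor h g := by
  simp [resMor]

lemma resL_self {U : CompactOpens (Spc K)} (h : U ≤ U) : resL h = 𝟭 (LU U) :=
  Localization.Construction.uniq _ _ (Q_resL h)

lemma resL_resL {U V W : CompactOpens (Spc K)} (h : U ≤ V) (h' : V ≤ W) :
    resL h' ⋙ resL h = resL (h.trans h') :=
  Localization.Construction.uniq _ _ (by
    rw [← Functor.assoc, Q_resL, Q_resL, Q_resL])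

lemma ρResK_hom_f {U V : CompactOpens (Spc K)} (h : U ≤ V) (a : K) :
    ((ρResK h).hom.app a).f = 𝟙 ((locW U).Q.obj a) := by
  have : (eqToHom (Q_resL h)).app a = 𝟙 ((locW U).Q.obj a) := by
    rw [eqToHom_app]; rfl
  change 𝟙 _ ≫ (eqToHom (Q_resL h)).app a = _
  rw [this]
  exact Category.comp_id _

lemma ρResK_inv_f {U V : CompactOpens (Spc K)} (h : U ≤ V) (a : K) :
    ((ρResK h).inv.app a).f = 𝟙 ((locW U).Q.obj a) := by
  have : (eqToHom (Q_resL h).symm).app a = 𝟙 ((locW U).Q.obj a) := by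
    rw [eqToHom_app]; rfl
  change (eqToHom (Q_resL h).symm).app a ≫ 𝟙 _ = _
  rw [this]
  exact Category.comp_id _

lemma resMor_f {U V : CompactOpens (Spc K)} (h : U ≤ V) {a b : K} (f : Mor V a b) :
    (resMor h f).f = (resL h).map f.f := by
  change ((ρResK h).inv.app a).f ≫ (resL h).map f.f ≫ ((ρResK h).hom.app b).f = _
  rw [ρResK_inv_f, ρResK_hom_f]
  exact (Category.id_comp _).trans (Category.comp_id _)

lemma resMor_self {U : CompactOpens (Spc K)} (h : U ≤ U) {a b : K} (f : Mor U a b) :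
    resMor h f = f := by
  refine Idempotents.Karoubi.hom_ext _ _ ?_
  rw [resMor_f]
  exact (Functor.congr_hom (resL_self h) f.f).trans
    ((Category.id_comp _).trans (Category.comp_id _))

lemma resMor_resMor {U V W : CompactOpens (Spc K)} (h : U ≤ V) (h' : V ≤ W) {a b : K}
    (f : Mor W a b) : resMor h (resMor h' f) = resMor (h.trans h') f := by
  refine Idempotents.Karoubi.hom_ext _ _ ?_
  rw [resMor_f, resMor_f, resMor_f]
  exact (Functor.congr_hom (resL_resL h h') f.f).trans
    ((Category.id_comp _).trans (Category.comp_id _))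

/-! ### The groups `𝔾ₘ(K(U))` -/

lemma unit_comp_comm {C : Type*} [Category* C] [MonoidalCategory C] (f g : 𝟙_ C ⟶ 𝟙_ C) :
    f ≫ g = g ≫ f := by
  have hf : f = (λ_ (𝟙_ C)).inv ≫ (𝟙_ C ◁ f) ≫ (λ_ (𝟙_ C)).hom := by simp
  have hg : g = (λ_ (𝟙_ C)).inv ≫ (g ▷ 𝟙_ C) ≫ (λ_ (𝟙_ C)).hom := by
    rw [unitors_equal, unitors_inv_equal]; simp
  rw [hf, hg]
  simp only [Category.assoc, Iso.hom_inv_id_assoc]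
  rw [whisker_exchange_assoc]

/-- `𝔾ₘ(K(U))`: the group of invertible elements of the ring `Mor_U(𝟙, 𝟙)`. -/
def Gm (U : CompactOpens (Spc K)) : Type _ := (End ((ρ U).obj (𝟙_ K)))ˣ

/-- The isomorphism `𝟙 ⟶ 𝟙` in `K(U)` underlying an element of `𝔾ₘ(K(U))`. -/
def Gm.hom {U : CompactOpens (Spc K)} (x : Gm U) : Mor U (𝟙_ K) (𝟙_ K) :=
  Units.val (α := End ((ρ U).obj (𝟙_ K))) x

lemma Gm.ext {U : CompactOpens (Spc K)} {x y : Gm U} (h : x.hom = y.hom) : x = y :=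
  Units.ext (α := End ((ρ U).obj (𝟙_ K))) h

section Gm

variable [IsTriangulated K] [SymmetricCategory K] [TensorTriangulated K]

instance (U : CompactOpens (Spc K)) : (locW U).IsMonoidal where
  whiskerLeft a b c f := by
    rintro ⟨z, g, h, hT, hz⟩
    exact ObjectProperty.trW.mk _ (((curriedTensor K).obj a).map_distinguished _ hT)
      (supportedOn_tensor_right hz a)
  whiskerRight {a b} f := by
    rintro ⟨z, g, h, hT, hz⟩ c
    exact ObjectProperty.trW.mk _ (((curriedTensor K).flip.obj c).map_distinguished _ hT)
      (supportedOn_tensor_left hz c)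

lemma mor_unit_comm (U : CompactOpens (Spc K)) (f g : Mor U (𝟙_ K) (𝟙_ K)) :
    f ≫ g = g ≫ f := by
  refine Idempotents.Karoubi.hom_ext _ _ ?_
  exact unit_comp_comm (C := LocalizedMonoidal (locW U).Q (locW U)
    (Iso.refl ((locW U).Q.obj (𝟙_ K)))) f.f g.f

noncomputable instance (U : CompactOpens (Spc K)) : CommGroup (Gm U) :=
  { (inferInstance : Group (End ((ρ U).obj (𝟙_ K)))ˣ) with
    mul_comm := fun x y => Gm.ext (mor_unit_comm U y.hom x.hom) }

/-- The restriction `𝔾ₘ(K(V)) → 𝔾ₘ(K(U))`, for `U ⊆ V`. -/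
noncomputable def resGm {U V : CompactOpens (Spc K)} (h : U ≤ V) : Gm V →* Gm U :=
  Units.map (M := End ((ρ V).obj (𝟙_ K))) (N := End ((ρ U).obj (𝟙_ K)))
    { toFun := fun f => resMor h f
      map_one' := resMor_id h _
      map_mul' := fun f g => resMor_comp h g f }

variable (K) in
/-- The presheaf `U ↦ 𝔾ₘ(K(U))` on the quasi-compact open subsets of `Spc K`. -/
noncomputable def gmPresheaf : (CompactOpens (Spc K))ᵒᵖ ⥤ CommGrpCat.{max u v} where
  obj U := CommGrpCat.of (Gm U.unop)
  map h := CommGrpCat.ofHom (resGm (leOfHom h.unop))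
  map_id U := by
    ext x
    exact Gm.ext (resMor_self le_rfl x.hom)
  map_comp h h' := by
    ext x
    exact Gm.ext (resMor_resMor (leOfHom h'.unop) (leOfHom h.unop) x.hom).symm

end Gm

variable (K) in
/-- The inclusion of the quasi-compact open subsets of `Spc K` in all open subsets. -/
def compactOpensToOpens : CompactOpens (Spc K) ⥤ Opens (TopCat.of (Spc K)) :=
  Monotone.functor (f := CompactOpens.toOpens) fun _ _ h => h

/-! ### Gluing copies of the unit, and the Picard group -/

/-- A gluing of copies of `𝟙 ∈ K(U i)` along `σ`, where `σ j i` is an automorphism of `𝟙` over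
`U i ∩ U j`, given through its restrictions to all quasi-compact open subsets `W ⊆ U i ∩ U j`:
an object `a` with isomorphisms `f i : a ≅ 𝟙` over `U i` such that `σ j i ∘ f i = f j`
over `U i ∩ U j`. -/
structure UnitGluing {ι : Type*} (U : ι → CompactOpens (Spc K))
    (σ : ∀ (j i : ι) (W : CompactOpens (Spc K)), W ≤ U j → W ≤ U i →
      Mor W (𝟙_ K) (𝟙_ K)) where
  /-- the glued object -/
  obj : K
  /-- the isomorphism with `𝟙` over `U i` -/
  iso (i : ι) : (ρ (U i)).obj obj ≅ (ρ (U i)).obj (𝟙_ K)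
  comp_iso (j i : ι) (W : CompactOpens (Spc K)) (hj : W ≤ U j) (hi : W ≤ U i) :
    resMor hi (iso i).hom ≫ σ j i W hj hi = resMor hj (iso j).hom

/-- An isomorphism of objects of `K` is an isomorphism of gluings if it is compatible with the
isomorphisms to `𝟙` over each `U i`. -/
def UnitGluing.IsGluingIso {ι : Type*} {U : ι → CompactOpens (Spc K)}
    {σ : ∀ (j i : ι) (W : CompactOpens (Spc K)), W ≤ U j → W ≤ U i → Mor W (𝟙_ K) (𝟙_ K)}
    (G G' : UnitGluing U σ) (e : G.obj ≅ G'.obj) : Prop :=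
  ∀ i, (ρ (U i)).map e.hom ≫ (G'.iso i).hom = (G.iso i).hom

variable (K) in
/-- The Picard group: isomorphism classes of `⊗`-invertible objects, with the tensor product. -/
abbrev Pic [SymmetricCategory K] : Type u := (Skeleton K)ˣ

section Transition

variable [IsTriangulated K] [SymmetricCategory K] [TensorTriangulated K]

/-- For a presheaf `F` on `Spc K` which is identified with `U ↦ 𝔾ₘ(K(U))` on the quasi-compact open
subsets, and a `1`-cochain `σ` of a family of quasi-compact open subsets: the automorphism of `𝟙`
over a quasi-compact open `W ⊆ U j ∩ U i` which is given by `σ j i`. -/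
noncomputable def transitionMor {F : TopCat.Presheaf CommGrpCat.{max u v} (TopCat.of (Spc K))}
    (φ : (compactOpensToOpens K).op ⋙ F ≅ gmPresheaf K) {ι : Type*} (U : ι → CompactOpens (Spc K))
    (σ : Cech.Cochain₁ F (fun i => (U i).toOpens)) (j i : ι) (W : CompactOpens (Spc K))
    (hj : W ≤ U j) (hi : W ≤ U i) : Mor W (𝟙_ K) (𝟙_ K) :=
  Gm.hom ((φ.hom.app (op W)).hom
    (Cech.res F (U := W.toOpens) (V := (U j).toOpens ⊓ (U i).toOpens) (le_inf hj hi) (σ j i)))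

end Transition

end TTCat

set_option linter.unusedSectionVars false

/-! Morphisms between objects of `K` are the same in `K(U)` and in the Verdier quotient `L(U)`, so
the argument takes place in the categories `L(U)`, whose idempotents need not split.

The engine is a calculus of fractions with tensor denominators `s : w ⟶ 𝟙`. By rigidity `z` is a
retract of `z ⊗ Dz ⊗ z`, so thick ideals are radical, hence determined by the primes containing
them. The objects killed over `U₂` by some `s` invertible over `U₁` form a thick ideal. It contains
the objects supported off `U₁` (take the fibre of the coevaluation) and those supported off `U₂`,
hence all those supported off `U₁ ∩ U₂` (`annihilated_of_supportedOn`). So a morphism `a ⟶ b` over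
`U₁ ∩ U₂` is, up to a denominator `s`, a morphism `w ⊗ a ⟶ b` over `U₂`.

Together with excision this yields the needed part of a Mayer–Vietoris sequence: morphisms agreeing
on the overlap glue (`exists_glue`), and the failure of uniqueness comes from morphisms `T a ⟶ b`
over the overlap (`comp_eq_zero_of_locally`). If `a` and `b` are locally the unit, these are locally
morphisms `T 𝟙 ⟶ 𝟙`, which vanish by assumption. Hence morphisms between such objects satisfy the
sheaf condition for finite covers (`comp_eq_zero_of_forall`, `exists_glue_family`).

Objects over two open sets glue up to direct summands (`exists_glued_object`), and the summand is
cut out by an idempotent (`exists_glued_idempotent`). Induction over a finite cover glues copies of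
`𝟙` (`nonempty_partialGluing`); over the whole spectrum `L(⊤)` is `K`, where the idempotent splits
(`UnitCocycle.exists_gluing`).

The units of `Mor_U(𝟙, 𝟙)` thus form a sheaf on the basis of quasi-compact open sets, which extends
uniquely to all open sets. Finite quasi-compact covers are cofinal, so `α` can be defined by gluing
along their cocycles. Gluings along `σ` and `τ` tensor to a gluing along `στ`, and an isomorphism of
a gluing with `𝟙` is a `0`-cochain with coboundary `σ`, whence injectivity. -/

namespace TTCat

/-! ### Thick tensor ideals -/

section ThickIdeals

variable {K : Type u} [Category.{v} K] [Preadditive K] [HasZeroObject K] [HasShift K ℤ]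
  [∀ n : ℤ, (shiftFunctor K n).Additive] [Pretriangulated K] [MonoidalCategory K]

/-- Thick triangulated `⊗`-ideals. -/
structure IsThickIdeal (P : ObjectProperty K) : Prop where
  isClosedUnderIsomorphisms : P.IsClosedUnderIsomorphisms
  isTriangulated : P.IsTriangulated
  thick (a b : K) : P (a ⊞ b) → P a ∧ P b
  ideal (a b : K) : P a → P (a ⊗ b)

lemma IsPrime.isThickIdeal {P : ObjectProperty K} (h : IsPrime P) : IsThickIdeal P :=
  ⟨h.1, h.2, h.3, h.4⟩

/-- The connecting morphism of the cone of a split monomorphism vanishes, so the triangle splits.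
This lets `thick`, stated for biproducts, be applied to retracts. -/
lemma exists_biprod_of_retract {a b : K} (i : a ⟶ b) (r : b ⟶ a) (hir : i ≫ r = 𝟙 a) :
    ∃ c : K, Nonempty (b ≅ a ⊞ c) := by
  obtain ⟨c, g, h, hT⟩ := Pretriangulated.distinguished_cocone_triangle i
  have : h = 0 := by
    have h₁ : h ≫ i⟦(1 : ℤ)⟧' = 0 := Pretriangulated.comp_distTriang_mor_zero₃₁ _ hT
    rw [← Category.comp_id h, ← (shiftFunctor K (1 : ℤ)).map_id, ← hir, Functor.map_comp,
      ← Category.assoc, h₁, zero_comp]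
  obtain ⟨e, -, -⟩ := Pretriangulated.exists_iso_binaryBiproduct_of_distTriang _ hT this
  exact ⟨c, ⟨e⟩⟩

namespace IsThickIdeal

variable {P : ObjectProperty K}

lemma of_retract (hP : IsThickIdeal P) {a b : K} (i : a ⟶ b) (r : b ⟶ a) (hir : i ≫ r = 𝟙 a)
    (hb : P b) : P a := by
  have := hP.1
  obtain ⟨c, ⟨e⟩⟩ := exists_biprod_of_retract i r hir
  exact (hP.thick a c (P.prop_of_iso e hb)).1

lemma biprod (hP : IsThickIdeal P) {a b : K} (ha : P a) (hb : P b) : P (a ⊞ b) := by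
  have := hP.1
  have := hP.2
  exact P.ext_of_isTriangulatedClosed₂ _
    (Pretriangulated.binaryBiproductTriangle_distinguished a b) ha hb

lemma iff_of_iso (hP : IsThickIdeal P) {a b : K} (e : a ≅ b) : P a ↔ P b := by
  have := hP.1
  exact P.prop_iff_of_iso e

lemma ideal_left [BraidedCategory K] (hP : IsThickIdeal P) (a : K) {b : K} (hb : P b) :
    P (a ⊗ b) :=
  (hP.iff_of_iso (β_ b a)).1 (hP.ideal b a hb)

lemma zero (hP : IsThickIdeal P) {a : K} (ha : IsZero a) : P a := by
  have := hP.1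
  have := hP.2
  exact P.prop_of_isZero ha

/-- The quotient ideal `(P : y)` is the preimage of `P` under the exact functor `- ⊗ y`. It is
played off against maximality in the proof that maximal ideals avoiding a multiplicative set are
prime. -/
lemma colon [SymmetricCategory K] [TensorTriangulated K] (hP : IsThickIdeal P) (y : K) :
    IsThickIdeal (fun z => P (z ⊗ y)) := by
  have h₁ := hP.1
  have h₂ := hP.2
  let F := (curriedTensor K).flip.obj y
  have : F.Additive := inferInstance
  have : PreservesBinaryBiproducts F := preservesBinaryBiproducts_of_preservesBiproducts F
  exact
    { isClosedUnderIsomorphisms := inferInstanceAs (P.inverseImage F).IsClosedUnderIsomorphisms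
      isTriangulated := inferInstanceAs (P.inverseImage F).IsTriangulated
      thick := fun a b h => hP.thick (a ⊗ y) (b ⊗ y) ((hP.iff_of_iso (F.mapBiprod a b)).1 h)
      ideal := fun a b h => (hP.iff_of_iso (α_ a y b ≪≫ whiskerLeftIso a (β_ y b) ≪≫
        (α_ a b y).symm)).1 (hP.ideal _ b h) }

end IsThickIdeal

end ThickIdeals

/-! ### Existence of prime ideals -/

section Zorn

variable {K : Type u} [Category.{v} K] [Preadditive K] [HasZeroObject K] [HasShift K ℤ]
  [∀ n : ℤ, (shiftFunctor K n).Additive] [Pretriangulated K] [MonoidalCategory K]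
  [SymmetricCategory K] [TensorTriangulated K]

lemma isThickIdeal_sUnion {c : Set (ObjectProperty K)} (hc : IsChain (· ≤ ·) c)
    (hne : c.Nonempty) (h : ∀ P ∈ c, IsThickIdeal P) :
    IsThickIdeal (fun a : K => ∃ P ∈ c, P a) := by
  obtain ⟨P₀, hP₀⟩ := hne
  have hiso : ObjectProperty.IsClosedUnderIsomorphisms (fun a : K => ∃ P ∈ c, P a) :=
    ⟨fun e ⟨P, hP, hx⟩ => ⟨P, hP, ((h P hP).iff_of_iso e).1 hx⟩⟩
  refine
    { isClosedUnderIsomorphisms := hiso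
      isTriangulated :=
        { exists_zero := ⟨0, isZero_zero K, P₀, hP₀, (h P₀ hP₀).zero (isZero_zero K)⟩
          isStableUnderShiftBy := fun n => ⟨?_⟩
          toIsTriangulatedClosed₂ := .mk' ?_ }
      thick := ?_
      ideal := ?_ }
  · rintro a ⟨P, hP, ha⟩
    have := (h P hP).2
    exact ⟨P, hP, P.le_shift n _ ha⟩
  · rintro T hT ⟨P, hP, h₁⟩ ⟨Q, hQ, h₃⟩
    obtain ⟨R, hR, hPR, hQR⟩ : ∃ R ∈ c, P ≤ R ∧ Q ≤ R := by
      rcases hc.total hP hQ with h | h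
      · exact ⟨Q, hQ, h, le_rfl⟩
      · exact ⟨P, hP, le_rfl, h⟩
    have := (h R hR).1
    have := (h R hR).2
    exact ⟨R, hR, R.ext_of_isTriangulatedClosed₂ T hT (hPR _ h₁) (hQR _ h₃)⟩
  · rintro a b ⟨P, hP, hab⟩
    exact ⟨⟨P, hP, ((h P hP).thick a b hab).1⟩, ⟨P, hP, ((h P hP).thick a b hab).2⟩⟩
  · rintro a b ⟨P, hP, ha⟩
    exact ⟨P, hP, (h P hP).ideal a b ha⟩

/-- A thick ideal disjoint from a nonempty multiplicative set is contained in a prime ideal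
disjoint from it. -/
lemma exists_prime_of_disjoint {I : ObjectProperty K} (hI : IsThickIdeal I) (S : Set K)
    (hne : S.Nonempty) (hmul : ∀ a ∈ S, ∀ b ∈ S, a ⊗ b ∈ S) (hS : ∀ a ∈ S, ¬ I a) :
    ∃ P : Spc K, I ≤ P.1 ∧ ∀ a ∈ S, ¬ P.1 a := by
  obtain ⟨P, hIP, hP⟩ := zorn_le_nonempty₀
    {P : ObjectProperty K | IsThickIdeal P ∧ ∀ a ∈ S, ¬ P a}
    (fun c hc hchain P hP => ⟨fun a => ∃ P ∈ c, P a,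
      ⟨isThickIdeal_sUnion hchain ⟨P, hP⟩ fun Q hQ => (hc hQ).1,
        fun a ha ⟨Q, hQ, h⟩ => (hc hQ).2 a ha h⟩,
      fun Q hQ a ha => ⟨Q, hQ, ha⟩⟩) I ⟨hI, hS⟩
  have hPi := hP.prop.1
  -- If `(P : y)` avoided `S`, it would equal `P` by maximality, and `z` would lie in `P`.
  have key (y z : K) (hyz : P (z ⊗ y)) (hz : ¬ P z) : ∃ s ∈ S, P (s ⊗ y) := by
    by_contra! H
    exact hz (hP.le_of_ge ⟨hPi.colon y, H⟩ (fun a ha => hPi.ideal a y ha) z hyz)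
  refine ⟨⟨P, hPi.1, hPi.2, hPi.3, hPi.4, fun a b hab => ?_, ?_⟩, hIP, hP.prop.2⟩
  · by_contra! H
    obtain ⟨s, hs, h₁⟩ := key b a hab H.1
    obtain ⟨t, ht, h₂⟩ := key s b ((hPi.iff_of_iso (β_ s b)).1 h₁) H.2
    exact hP.prop.2 _ (hmul t ht s hs) h₂
  · obtain ⟨s, hs⟩ := hne
    exact ⟨s, hP.prop.2 s hs⟩

end Zorn

/-! ### The topology of the spectrum -/

section Topology

variable {K : Type u} [Category.{v} K] [Preadditive K] [HasZeroObject K] [HasShift K ℤ]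
  [∀ n : ℤ, (shiftFunctor K n).Additive] [Pretriangulated K] [MonoidalCategory K]

lemma supp_biprod (a b : K) : supp (a ⊞ b) = supp a ∪ supp b := by
  ext P
  have hP := P.2.isThickIdeal
  simp only [supp, Set.mem_ofPred_eq, Set.mem_union]
  rw [← not_and_or]
  exact not_congr ⟨hP.thick a b, fun h => hP.biprod h.1 h.2⟩

lemma supp_zero : supp (0 : K) = ∅ := by
  ext P
  simp [supp, P.2.isThickIdeal.zero (isZero_zero K)]

lemma supp_tensor [BraidedCategory K] (a b : K) : supp (a ⊗ b) = supp a ∩ supp b := by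
  ext P
  have hP := P.2.isThickIdeal
  simp only [supp, Set.mem_ofPred_eq, Set.mem_inter_iff]
  rw [← not_or]
  exact not_congr ⟨P.2.prime a b, fun h => h.elim (hP.ideal a b) (hP.ideal_left a)⟩

lemma supp_unit : supp (𝟙_ K) = Set.univ := by
  ext P
  simp only [supp, Set.mem_ofPred_eq, Set.mem_univ, iff_true]
  intro h
  obtain ⟨a, ha⟩ := P.2.proper
  exact ha ((P.2.isThickIdeal.iff_of_iso (λ_ a)).1 (P.2.ideal _ a h))

lemma isTopologicalBasis_compl_supp :
    IsTopologicalBasis (Set.range fun a : K => (supp a)ᶜ) where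
  exists_subset_inter := by
    rintro _ ⟨a, rfl⟩ _ ⟨b, rfl⟩ x hx
    refine ⟨_, ⟨a ⊞ b, rfl⟩, ?_, ?_⟩ <;> simp only [supp_biprod, Set.compl_union]
    · exact hx
    · exact subset_rfl
  sUnion_eq := by
    refine Set.eq_univ_of_univ_subset fun x _ => ⟨_, ⟨0, rfl⟩, ?_⟩
    simp [supp_zero]
  eq_generateFrom := rfl

/-- An object of the multiplicative set generated by a family of objects. -/
inductive MulClosure {ι : Type*} (b : ι → K) : K → Prop
  | unit : MulClosure b (𝟙_ K)
  | of (i : ι) : MulClosure b (b i)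
  | tensor {x y : K} : MulClosure b x → MulClosure b y → MulClosure b (x ⊗ y)

lemma MulClosure.exists_finset {ι : Type*} {b : ι → K} {x : K} (hx : MulClosure b x) :
    ∃ t : Finset ι, ∀ P : Spc K, P.1 x → ∃ i ∈ t, P.1 (b i) := by
  classical
  induction hx with
  | unit =>
    refine ⟨∅, fun P hP => ?_⟩
    have : P ∈ supp (𝟙_ K) := by simp [supp_unit]
    exact (this hP).elim
  | of i => exact ⟨{i}, fun P hP => ⟨i, by simp, hP⟩⟩
  | tensor _ _ h₁ h₂ =>
    obtain ⟨t₁, h₁⟩ := h₁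
    obtain ⟨t₂, h₂⟩ := h₂
    refine ⟨t₁ ∪ t₂, fun P hP => ?_⟩
    rcases P.2.prime _ _ hP with h | h
    · obtain ⟨i, hi, h⟩ := h₁ P h
      exact ⟨i, Finset.mem_union_left _ hi, h⟩
    · obtain ⟨i, hi, h⟩ := h₂ P h
      exact ⟨i, Finset.mem_union_right _ hi, h⟩

variable [SymmetricCategory K] [TensorTriangulated K]

lemma isThickIdeal_forall (p : Spc K → Prop) :
    IsThickIdeal (fun a : K => ∀ P : Spc K, p P → P.1 a) := by
  have hiso : ObjectProperty.IsClosedUnderIsomorphisms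
      (fun a : K => ∀ P : Spc K, p P → P.1 a) :=
    ⟨fun e h P hP => (P.2.isThickIdeal.iff_of_iso e).1 (h P hP)⟩
  exact
    { isClosedUnderIsomorphisms := hiso
      isTriangulated :=
        { exists_zero := ⟨0, isZero_zero K, fun P _ => P.2.isThickIdeal.zero (isZero_zero K)⟩
          isStableUnderShiftBy := fun n => ⟨fun a ha P hP => by
            have := P.2.2
            exact P.1.le_shift n _ (ha P hP)⟩
          toIsTriangulatedClosed₂ := .mk' fun T hT h₁ h₃ P hP => by
            have := P.2.1
            have := P.2.2
            exact P.1.ext_of_isTriangulatedClosed₂ T hT (h₁ P hP) (h₃ P hP) }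
      thick := fun a b h =>
        ⟨fun P hP => (P.2.3 a b (h P hP)).1, fun P hP => (P.2.3 a b (h P hP)).2⟩
      ideal := fun a b h P hP => P.2.4 a b (h P hP) }

lemma isThickIdeal_supportedOn (Z : Set (Spc K)) :
    IsThickIdeal (supportedOn Z : ObjectProperty K) := by
  have : (supportedOn Z : ObjectProperty K) = fun a : K => ∀ P : Spc K, P ∉ Z → P.1 a := by
    ext a
    exact ⟨fun h P hP => by_contra fun H => hP (h H),
      fun h P hP => by_contra fun H => hP (h P H)⟩
  rw [this]
  exact isThickIdeal_forall fun P => P ∉ Z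

/-- For a cover by sets `{P | b i ∈ P}`, either some product of the `b i` lies in every prime
containing `a`, and its finitely many factors give a subcover, or there is a prime containing `a`
and none of the `b i`, which the cover misses. -/
lemma isCompact_compl_supp (a : K) : IsCompact (supp a)ᶜ := by
  refine isCompact_generateFrom' rfl fun ι V hV => ?_
  choose b hb using fun i => (V i).2
  by_cases H : ∃ x, MulClosure b x ∧ ∀ P : Spc K, P.1 a → P.1 x
  · obtain ⟨x, hx, h⟩ := H
    obtain ⟨t, ht⟩ := hx.exists_finset
    refine ⟨t, t.finite_toSet, fun P hP => ?_⟩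
    obtain ⟨i, hi, hPi⟩ := ht P (h P (not_not.1 hP))
    refine Set.mem_biUnion hi ?_
    rw [← hb i]
    exact not_not.2 hPi
  · obtain ⟨P, hP, h⟩ := exists_prime_of_disjoint (isThickIdeal_forall (K := K) fun P => P.1 a)
      {x | MulClosure b x} ⟨_, .unit⟩ (fun _ h _ h' => h.tensor h') (fun x hx h => H ⟨x, hx, h⟩)
    obtain ⟨_, ⟨i, rfl⟩, hi⟩ := hV (not_not.2 (hP a fun _ h => h) : P ∈ (supp a)ᶜ)
    dsimp only at hi
    rw [← hb i] at hi
    exact (h _ (.of i) (not_not.1 hi)).elim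

instance : PrespectralSpace (Spc K) :=
  .of_isTopologicalBasis' isTopologicalBasis_compl_supp isCompact_compl_supp

instance : QuasiSeparatedSpace (Spc K) :=
  .of_isTopologicalBasis isTopologicalBasis_compl_supp fun a b => by
    rw [← Set.compl_union, ← supp_biprod]
    exact isCompact_compl_supp _

instance : CompactSpace (Spc K) := ⟨by
  rw [← Set.compl_empty, ← supp_zero]
  exact isCompact_compl_supp _⟩

/-- The complement of a finite union of basic open sets is a finite intersection of supports, that
is, the support of a tensor product. -/
lemma exists_compl_supp_eq (U : CompactOpens (Spc K)) : ∃ b : K, (U : Set (Spc K))ᶜ = supp b := by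
  obtain ⟨s, hs, h⟩ := (isCompact_open_iff_eq_finite_iUnion_of_isTopologicalBasis _
    isTopologicalBasis_compl_supp isCompact_compl_supp (U : Set (Spc K))).1
      ⟨U.isCompact, U.isOpen⟩
  rw [h]
  clear h
  induction s, hs using Set.Finite.induction_on with
  | empty => exact ⟨𝟙_ K, by simp [supp_unit]⟩
  | @insert a s _ _ ih =>
    obtain ⟨b, hb⟩ := ih
    exact ⟨a ⊗ b, by rw [supp_tensor, ← hb]; simp⟩

end Topology

/-! ### Rigidity: thick ideals are radical -/

section Rigid

variable {K : Type u} [Category.{v} K] [Preadditive K] [HasZeroObject K] [HasShift K ℤ]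
  [∀ n : ℤ, (shiftFunctor K n).Additive] [Pretriangulated K] [MonoidalCategory K]
  [SymmetricCategory K] [TensorTriangulated K] [MonoidalClosed K] [StronglyClosed K]

/-- The coevaluation `𝟙 ⟶ D z ⊗ z`. -/
noncomputable def coev (z : K) : 𝟙_ K ⟶ (ihom z).obj (𝟙_ K) ⊗ z :=
  have := StronglyClosed.isIso_dualTensorToHom z z
  MonoidalClosed.curry (ρ_ z).hom ≫ inv (dualTensorToHom z z)

/-- The retraction of `z ◁ coev z` given by the evaluation. -/
noncomputable def evRetraction (z : K) : z ⊗ ((ihom z).obj (𝟙_ K) ⊗ z) ⟶ z :=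
  (α_ z ((ihom z).obj (𝟙_ K)) z).inv ≫ ((ihom.ev z).app (𝟙_ K) ▷ z) ≫ (λ_ z).hom

/-- The triangle identity of duality: its adjoint form is the definition of `coev`. -/
lemma whiskerLeft_coev_evRetraction (z : K) :
    z ◁ coev z ≫ evRetraction z = (ρ_ z).hom := by
  have := StronglyClosed.isIso_dualTensorToHom z z
  apply MonoidalClosed.curry_injective
  rw [MonoidalClosed.curry_natural_left]
  change coev z ≫ dualTensorToHom z z = _
  simp [coev]

/-- By the triangle identity `z ⊗ y` is a retract of `z ⊗ Dz ⊗ z ⊗ y`. This removes one tensor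
factor at a time from a power of `z`. -/
lemma IsThickIdeal.of_tensor_self {I : ObjectProperty K} (hI : IsThickIdeal I) (z y : K)
    (h : I (z ⊗ (z ⊗ y))) : I (z ⊗ y) := by
  refine hI.of_retract (b := (z ⊗ ((ihom z).obj (𝟙_ K) ⊗ z)) ⊗ y)
    ((ρ_ z).inv ▷ y ≫ (z ◁ coev z) ▷ y) (evRetraction z ▷ y) ?_ ?_
  · rw [Category.assoc, ← comp_whiskerRight, whiskerLeft_coev_evRetraction,
      ← comp_whiskerRight, Iso.inv_hom_id, id_whiskerRight]
  · refine (hI.iff_of_iso ?_).1 (hI.ideal_left ((ihom z).obj (𝟙_ K)) h)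
    exact (α_ _ _ _).symm ≪≫ whiskerRightIso (β_ _ _) _ ≪≫ (α_ _ _ _) ≪≫
      whiskerLeftIso z (α_ _ _ _).symm ≪≫ (α_ _ _ _).symm

/-- The `n`-th tensor power of `z`. -/
noncomputable def tpow (z : K) : ℕ → K
  | 0 => 𝟙_ K
  | n + 1 => z ⊗ tpow z n

lemma exists_tpow_iso (z : K) (m n : ℕ) : Nonempty (tpow z m ⊗ tpow z n ≅ tpow z (m + n)) := by
  induction m with
  | zero => exact ⟨λ_ _ ≪≫ eqToIso (by rw [Nat.zero_add])⟩
  | succ m ih =>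
    obtain ⟨e⟩ := ih
    exact ⟨α_ _ _ _ ≪≫ whiskerLeftIso z e ≪≫ eqToIso (by rw [Nat.succ_add]; rfl)⟩

lemma IsThickIdeal.of_tpow {I : ObjectProperty K} (hI : IsThickIdeal I) (z : K) (n : ℕ)
    (h : I (tpow z n)) : I z := by
  have hz : I (tpow z 1) := by
    induction n with
    | zero => exact hI.ideal_left z h
    | succ n ih =>
      cases n with
      | zero => exact h
      | succ n => exact ih (hI.of_tensor_self z (tpow z n) h)
  exact (hI.iff_of_iso (ρ_ z)).1 hz

/-- Thick ideals are determined by the prime ideals which contain them. -/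
lemma IsThickIdeal.mem_of_forall_prime {I : ObjectProperty K} (hI : IsThickIdeal I) (z : K)
    (h : ∀ P : Spc K, I ≤ P.1 → P.1 z) : I z := by
  by_contra H
  obtain ⟨P, hP, hS⟩ := exists_prime_of_disjoint hI {x | ∃ n, Nonempty (x ≅ tpow z n)}
    ⟨_, 0, ⟨Iso.refl _⟩⟩
    (fun a ⟨m, ⟨e⟩⟩ b ⟨n, ⟨f⟩⟩ => ⟨m + n, ⟨(e ⊗ᵢ f) ≪≫ (exists_tpow_iso z m n).some⟩⟩)
    (fun a ⟨n, ⟨e⟩⟩ ha => H (hI.of_tpow z n ((hI.iff_of_iso e).1 ha)))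
  exact hS z ⟨1, ⟨(ρ_ z).symm⟩⟩ (h P hP)

lemma isThickIdeal_isZero : IsThickIdeal (fun a : K => IsZero a) where
  isClosedUnderIsomorphisms := ⟨fun e h => h.of_iso e.symm⟩
  isTriangulated :=
    have : ObjectProperty.IsClosedUnderIsomorphisms (fun a : K => IsZero a) :=
      ⟨fun e h => h.of_iso e.symm⟩
    { exists_zero := ⟨0, isZero_zero K, isZero_zero K⟩
      isStableUnderShiftBy := fun n => ⟨fun a ha => (shiftFunctor K n).map_isZero ha⟩
      toIsTriangulatedClosed₂ := .mk' fun T hT h₁ h₃ =>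
        Pretriangulated.Triangle.isZero₂_of_isZero₁₃ T hT h₁ h₃ }
  thick a b h := by
    rw [biprod_isZero_iff] at h
    exact h
  ideal a b h := ((curriedTensor K).flip.obj b).map_isZero h

lemma isZero_of_supp_eq_empty {a : K} (ha : supp a = ∅) : IsZero a :=
  isThickIdeal_isZero.mem_of_forall_prime a fun P _ => not_not.1 fun h =>
    (ha ▸ h : P ∈ (∅ : Set (Spc K)))

end Rigid

end TTCat

namespace TTCat

/-! ### Morphisms in the Verdier quotients -/

section Hom

variable {K : Type u} [Category.{v} K] [Preadditive K] [HasZeroObject K] [HasShift K ℤ]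
  [∀ n : ℤ, (shiftFunctor K n).Additive] [Pretriangulated K] [MonoidalCategory K]

/-- The morphisms between the images of `a` and `b` in the Verdier localization `L(U)`. -/
abbrev LHom (U : CompactOpens (Spc K)) (a b : K) : Type _ :=
  (locW U).Q.obj a ⟶ (locW U).Q.obj b

/-- The image in `L(U)` of a morphism of `K`. -/
noncomputable def lmap (U : CompactOpens (Spc K)) {a b : K} (f : a ⟶ b) : LHom U a b :=
  (locW U).Q.map f

@[simp]
lemma lmap_id (U : CompactOpens (Spc K)) (a : K) : lmap U (𝟙 a) = 𝟙 _ :=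
  (locW U).Q.map_id a

lemma lmap_comp (U : CompactOpens (Spc K)) {a b c : K} (f : a ⟶ b) (g : b ⟶ c) :
    lmap U (f ≫ g) = lmap U f ≫ lmap U g :=
  (locW U).Q.map_comp f g

lemma lmap_comp_assoc (U : CompactOpens (Spc K)) {a b c : K} (f : a ⟶ b) (g : b ⟶ c) {x : LU U}
    (h : (locW U).Q.obj c ⟶ x) : lmap U (f ≫ g) ≫ h = lmap U f ≫ lmap U g ≫ h := by
  rw [lmap_comp, Category.assoc]

lemma isIso_lmap {U : CompactOpens (Spc K)} {a b : K} {f : a ⟶ b} (hf : locW U f) :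
    IsIso (lmap U f) :=
  (locW U).Q_inverts f hf

instance (U : CompactOpens (Spc K)) {a b : K} (f : a ⟶ b) [IsIso f] : IsIso (lmap U f) :=
  inferInstanceAs (IsIso ((locW U).Q.map f))

lemma locW_mono {U V : CompactOpens (Spc K)} (h : U ≤ V) {a b : K} {f : a ⟶ b}
    (hf : locW V f) : locW U f :=
  ObjectProperty.trW_monotone (fun _ ha => ha.trans (Set.compl_subset_compl.2 h)) _ hf

/-- Restriction of morphisms from `L(V)` to `L(U)`. -/
noncomputable def lres {U V : CompactOpens (Spc K)} (h : U ≤ V) {a b : K} (f : LHom V a b) :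
    LHom U a b :=
  (resL h).map f

section

variable {U V W : CompactOpens (Spc K)} (h : U ≤ V) (h' : V ≤ W) {a b c : K}

@[simp]
lemma lres_lmap (f : a ⟶ b) : lres h (lmap V f) = lmap U f :=
  (Functor.congr_hom (Q_resL h) f).trans ((Category.id_comp _).trans (Category.comp_id _))

@[simp]
lemma lres_id : lres h (𝟙 ((locW V).Q.obj a)) = 𝟙 _ :=
  (resL h).map_id _

@[simp]
lemma lres_comp (f : LHom V a b) (g : LHom V b c) :
    lres h (f ≫ g) = lres h f ≫ lres h g :=
  (resL h).map_comp f g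

@[simp]
lemma lres_self (f : LHom U a b) : lres le_rfl f = f :=
  (Functor.congr_hom (resL_self le_rfl) f).trans ((Category.id_comp _).trans (Category.comp_id _))

@[simp]
lemma lres_lres (f : LHom W a b) : lres h (lres h' f) = lres (h.trans h') f :=
  (Functor.congr_hom (resL_resL h h') f).trans ((Category.id_comp _).trans (Category.comp_id _))

end

variable [IsTriangulated K]

@[simp]
lemma lmap_zero (U : CompactOpens (Spc K)) (a b : K) : lmap U (0 : a ⟶ b) = 0 :=
  (locW U).Q.map_zero a b

@[simp]
lemma lmap_add (U : CompactOpens (Spc K)) {a b : K} (f g : a ⟶ b) :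
    lmap U (f + g) = lmap U f + lmap U g :=
  (locW U).Q.map_add

instance {U V : CompactOpens (Spc K)} (h : U ≤ V) : (resL h).Additive := by
  rw [Localization.functor_additive_iff (locW V).Q (locW V), Q_resL]
  infer_instance

section

variable {U V : CompactOpens (Spc K)} (h : U ≤ V) {a b : K}

@[simp]
lemma lres_add (f g : LHom V a b) : lres h (f + g) = lres h f + lres h g := (resL h).map_add

@[simp]
lemma lres_sub (f g : LHom V a b) : lres h (f - g) = lres h f - lres h g := (resL h).map_sub

end

lemma exists_fraction {U : CompactOpens (Spc K)} {a b : K} (f : LHom U a b) :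
    ∃ (a' : K) (t : a' ⟶ a) (_ : locW U t) (g : a' ⟶ b), lmap U t ≫ f = lmap U g := by
  obtain ⟨φ, rfl⟩ := Localization.exists_rightFraction (locW U).Q (locW U) f
  exact ⟨φ.X', φ.s, φ.hs, φ.f, φ.map_s_comp_map _ _⟩

section Exact

variable (U : CompactOpens (Spc K)) {x y z : K} {f : x ⟶ y} {g : y ⟶ z} {h : z ⟶ x⟦(1 : ℤ)⟧}
  (hT : Pretriangulated.Triangle.mk f g h ∈ Pretriangulated.distinguishedTriangles) {d : K}
include hT

lemma exists_desc (p : LHom U y d) (hp : lmap U f ≫ p = 0) :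
    ∃ q : LHom U z d, p = lmap U g ≫ q :=
  Pretriangulated.Triangle.yoneda_exact₂ _ ((locW U).Q.map_distinguished _ hT) p hp

lemma exists_lift (p : LHom U d y) (hp : p ≫ lmap U g = 0) :
    ∃ q : LHom U d x, p = q ≫ lmap U f :=
  Pretriangulated.Triangle.coyoneda_exact₂ _ ((locW U).Q.map_distinguished _ hT) p hp

lemma exists_desc₃ (p : LHom U z d) (hp : lmap U g ≫ p = 0) :
    ∃ q : LHom U (x⟦(1 : ℤ)⟧) d, p = lmap U h ≫ q :=
  exists_desc U (Pretriangulated.rot_of_distTriang _ hT) p hp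

end Exact

lemma isZero_Q_obj {U : CompactOpens (Spc K)} {a : K} (ha : supportedOn (U : Set (Spc K))ᶜ a) :
    IsZero ((locW U).Q.obj a) := by
  have h₀ : locW U (0 : a ⟶ 0) := by
    refine (ObjectProperty.trW_iff' _ _).2 ?_
    refine ⟨a, 𝟙 a, 0, ?_, ha⟩
    exact Pretriangulated.contractible_distinguished a
  have := isIso_lmap h₀
  exact IsZero.of_iso ((locW U).Q.map_isZero (isZero_zero K)) (asIso (lmap U (0 : a ⟶ 0)))

variable [SymmetricCategory K] [TensorTriangulated K]

/-- Vanishing in the quotient means vanishing after precomposition with a denominator, so `f`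
factors through the cone of that denominator. -/
lemma exists_factor_of_lmap_eq_zero {U : CompactOpens (Spc K)} {a b : K} (f : a ⟶ b)
    (hf : lmap U f = 0) : ∃ (z : K) (_ : supportedOn (U : Set (Spc K))ᶜ z) (p : a ⟶ z) (q : z ⟶ b),
      f = p ≫ q := by
  obtain ⟨c, t, ht, h⟩ := (MorphismProperty.map_eq_iff_precomp (locW U).Q (locW U) f 0).1
    (hf.trans (lmap_zero U a b).symm)
  obtain ⟨z, p, q, hT, hz⟩ := ht
  obtain ⟨g, hg⟩ := Pretriangulated.Triangle.yoneda_exact₂ _ hT f (h.trans comp_zero)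
  exact ⟨z, hz, p, g, hg⟩

lemma supportedOn_of_isZero {U : CompactOpens (Spc K)} {a : K} (ha : IsZero ((locW U).Q.obj a)) :
    supportedOn (U : Set (Spc K))ᶜ a := by
  obtain ⟨z, hz, p, q, h⟩ := exists_factor_of_lmap_eq_zero (U := U) (𝟙 a) (ha.eq_of_src _ _)
  exact (isThickIdeal_supportedOn _).of_retract p q h.symm hz

/-- The functor `c ⊗ -` on `L(U)`. -/
noncomputable def tensorL (U : CompactOpens (Spc K)) (c : K) : LU U ⥤ LU U :=
  Localization.Construction.lift (tensorLeft c ⋙ (locW U).Q) fun _ _ f hf =>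
    isIso_lmap ((locW U).whiskerLeft_mem c f hf)

lemma Q_tensorL (U : CompactOpens (Spc K)) (c : K) :
    (locW U).Q ⋙ tensorL U c = tensorLeft c ⋙ (locW U).Q :=
  Localization.Construction.fac _ _

/-- The tensor product `c ◁ f` for a morphism `f` of `L(U)`. -/
noncomputable def lwhisker {U : CompactOpens (Spc K)} (c : K) {a b : K} (f : LHom U a b) :
    LHom U (c ⊗ a) (c ⊗ b) :=
  (tensorL U c).map f

section

variable {U V : CompactOpens (Spc K)} (c : K) {a b d : K}

@[simp]
lemma lwhisker_lmap (f : a ⟶ b) : lwhisker c (lmap U f) = lmap U (c ◁ f) :=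
  (Functor.congr_hom (Q_tensorL U c) f).trans ((Category.id_comp _).trans (Category.comp_id _))

@[simp]
lemma lwhisker_comp (f : LHom U a b) (g : LHom U b d) :
    lwhisker c (f ≫ g) = lwhisker c f ≫ lwhisker c g :=
  (tensorL U c).map_comp f g

@[simp]
-- Precomposition with the denominator of a fraction, which is invertible in the quotient, reduces
-- the claim to morphisms of `K`; the naturality lemmas below are proved in the same way.
lemma lres_lwhisker (h : U ≤ V) (f : LHom V a b) :
    lres h (lwhisker c f) = lwhisker c (lres h f) := by
  obtain ⟨a', t, ht, g, hg⟩ := exists_fraction f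
  have := isIso_lmap (locW_mono h ((locW V).whiskerLeft_mem c t ht))
  rw [← cancel_epi (lmap U (c ◁ t))]
  have h₁ := congrArg (fun x => lres h (lwhisker c x)) hg
  have h₂ := congrArg (fun x => lwhisker c (lres h x)) hg
  simp only [lres_comp, lwhisker_comp, lres_lmap, lwhisker_lmap] at h₁ h₂
  rw [h₁, h₂]

lemma lwhisker_naturality {c c' : K} (s : c ⟶ c') (f : LHom U a b) :
    lwhisker c f ≫ lmap U (s ▷ b) = lmap U (s ▷ a) ≫ lwhisker c' f := by
  obtain ⟨a', t, ht, g, hg⟩ := exists_fraction f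
  have := isIso_lmap ((locW U).whiskerLeft_mem c t ht)
  rw [← cancel_epi (lmap U (c ◁ t))]
  have h₁ := congrArg (lwhisker c) hg
  have h₂ := congrArg (lwhisker c') hg
  simp only [lwhisker_comp, lwhisker_lmap] at h₁ h₂
  rw [reassoc_of% h₁, ← lmap_comp, ← lmap_comp_assoc, whisker_exchange,
    whisker_exchange, lmap_comp, lmap_comp, Category.assoc, h₂]

lemma lwhisker_unit_naturality (f : LHom U a b) :
    lwhisker (𝟙_ K) f ≫ lmap U (λ_ b).hom = lmap U (λ_ a).hom ≫ f := by
  obtain ⟨a', t, ht, g, hg⟩ := exists_fraction f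
  have := isIso_lmap ((locW U).whiskerLeft_mem (𝟙_ K) t ht)
  rw [← cancel_epi (lmap U (𝟙_ K ◁ t))]
  have h₁ := congrArg (lwhisker (𝟙_ K)) hg
  simp only [lwhisker_comp, lwhisker_lmap] at h₁
  rw [reassoc_of% h₁, ← lmap_comp, ← lmap_comp_assoc, leftUnitor_naturality,
    leftUnitor_naturality, lmap_comp, lmap_comp, Category.assoc, hg]

end

end Hom

end TTCat

namespace TTCat

/-! ### Annihilating objects by morphisms to the unit -/

section Annihilators

variable {K : Type u} [Category.{v} K] [Preadditive K] [HasZeroObject K] [HasShift K ℤ]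
  [∀ n : ℤ, (shiftFunctor K n).Additive] [Pretriangulated K] [MonoidalCategory K]
  [IsTriangulated K] [SymmetricCategory K] [TensorTriangulated K]

@[simp]
lemma whiskerLeft_zero' (a b c : K) : c ◁ (0 : a ⟶ b) = 0 :=
  ((curriedTensor K).obj c).map_zero _ _

lemma whiskerRight_distinguished {x y z : K} {f : x ⟶ y} {g : y ⟶ z} {h : z ⟶ x⟦(1 : ℤ)⟧}
    (hT : Pretriangulated.Triangle.mk f g h ∈ Pretriangulated.distinguishedTriangles) (a : K) :
    Pretriangulated.Triangle.mk (f ▷ a) (g ▷ a)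
      (h ▷ a ≫ (((curriedTensor K).flip.obj a).commShiftIso (1 : ℤ)).hom.app x) ∈
        Pretriangulated.distinguishedTriangles :=
  ((curriedTensor K).flip.obj a).map_distinguished _ hT

lemma lmap_eq_zero_of_factor {U : CompactOpens (Spc K)} {a b z : K} {f : a ⟶ b}
    (hz : supportedOn (U : Set (Spc K))ᶜ z) (p : a ⟶ z) (q : z ⟶ b) (h : f = p ≫ q) :
    lmap U f = 0 := by
  rw [h, lmap_comp, (isZero_Q_obj hz).eq_of_src (lmap U q) 0, comp_zero]

lemma lmap_shift_eq_zero {U : CompactOpens (Spc K)} {a b : K} {f : a ⟶ b} (hf : lmap U f = 0)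
    (n : ℤ) : lmap U (f⟦n⟧') = 0 := by
  obtain ⟨z, hz, p, q, h⟩ := exists_factor_of_lmap_eq_zero f hf
  exact lmap_eq_zero_of_factor ((supportedOn _).le_shift n _ hz) (p⟦n⟧') (q⟦n⟧')
    (by rw [h, Functor.map_comp])

lemma lmap_whiskerRight_eq_zero {U : CompactOpens (Spc K)} {a b : K} {f : a ⟶ b}
    (hf : lmap U f = 0) (c : K) : lmap U (f ▷ c) = 0 := by
  obtain ⟨z, hz, p, q, h⟩ := exists_factor_of_lmap_eq_zero f hf
  exact lmap_eq_zero_of_factor (supportedOn_tensor_left hz c) (p ▷ c) (q ▷ c)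
    (by rw [h, comp_whiskerRight])

/-- The objects which are annihilated over `U₂` by a morphism `w ⟶ 𝟙` invertible over `U₁`. -/
def annihilated (U₁ U₂ : CompactOpens (Spc K)) : ObjectProperty K := fun z =>
  ∃ (w : K) (s : w ⟶ 𝟙_ K), locW U₁ s ∧ lmap U₂ (s ▷ z) = 0

lemma annihilated.of_retract {U₁ U₂ : CompactOpens (Spc K)} {z z' : K}
    (hz : annihilated U₁ U₂ z) (p : z' ⟶ z) (q : z ⟶ z') (h : p ≫ q = 𝟙 z') :
    annihilated U₁ U₂ z' := by
  obtain ⟨w, s, hs, h₀⟩ := hz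
  refine ⟨w, s, hs, ?_⟩
  have : s ▷ z' = w ◁ p ≫ s ▷ z ≫ 𝟙_ K ◁ q := by
    rw [whisker_exchange_assoc, ← whiskerLeft_comp, h, whiskerLeft_id, Category.comp_id]
  rw [this, lmap_comp, lmap_comp, h₀, zero_comp, comp_zero]

lemma tensor_comp_mem {U : CompactOpens (Spc K)} {w w' : K} {s : w ⟶ 𝟙_ K} {s' : w' ⟶ 𝟙_ K}
    (hs : locW U s) (hs' : locW U s') : locW U (s ▷ w' ≫ (λ_ w').hom ≫ s') :=
  (locW U).comp_mem _ _ ((locW U).whiskerRight_mem s hs w')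
    ((locW U).comp_mem _ _ (ObjectProperty.trW_of_isIso _ _) hs')

/-- For extensions: if `s₁` and `s₃` kill the outer terms of a triangle, then `s₁ ⊗ s₃` kills the
middle one. -/
lemma isThickIdeal_annihilated (U₁ U₂ : CompactOpens (Spc K)) :
    IsThickIdeal (annihilated U₁ U₂) := by
  have hiso : (annihilated U₁ U₂).IsClosedUnderIsomorphisms :=
    ⟨fun e h => h.of_retract e.inv e.hom e.inv_hom_id⟩
  refine
    { isClosedUnderIsomorphisms := hiso
      isTriangulated :=
        { exists_zero := ⟨0, isZero_zero K, 𝟙_ K, 𝟙 _, ObjectProperty.trW_of_isIso _ _, ?_⟩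
          isStableUnderShiftBy := fun n => ⟨?_⟩
          toIsTriangulatedClosed₂ := .mk' ?_ }
      thick := fun a b h => ⟨h.of_retract biprod.inl biprod.fst biprod.inl_fst,
        h.of_retract biprod.inr biprod.snd biprod.inr_snd⟩
      ideal := ?_ }
  · have : IsZero (𝟙_ K ⊗ (0 : K)) := ((curriedTensor K).obj (𝟙_ K)).map_isZero (isZero_zero K)
    rw [this.eq_of_src (𝟙 (𝟙_ K) ▷ (0 : K)) 0, lmap_zero]
  · rintro z ⟨w, s, hs, h⟩
    refine ⟨w, s, hs, ?_⟩
    have := NatTrans.app_shift ((curriedTensor K).map s) n z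
    change s ▷ (z⟦n⟧) = _ ≫ (s ▷ z)⟦n⟧' ≫ _ at this
    rw [this, lmap_comp, lmap_comp, lmap_shift_eq_zero h, zero_comp, comp_zero]
  · rintro T hT ⟨w₁, s₁, hs₁, h₁⟩ ⟨w₃, s₃, hs₃, h₃⟩
    refine ⟨_, s₁ ▷ w₃ ≫ (λ_ w₃).hom ≫ s₃, tensor_comp_mem hs₁ hs₃, ?_⟩
    -- The action of `s₃` on the middle term dies in the third term, so it factors through the first
    -- term, which `s₁` kills.
    obtain ⟨g, hg⟩ := exists_lift U₂ hT (lmap U₂ (s₃ ▷ T.obj₂ ≫ (λ_ _).hom)) (by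
      rw [← lmap_comp, Category.assoc, ← leftUnitor_naturality,
        ← whisker_exchange_assoc, lmap_comp, lmap_comp, h₃, zero_comp, comp_zero])
    have e : (s₁ ▷ w₃ ≫ (λ_ w₃).hom ≫ s₃) ▷ T.obj₂ ≫ (λ_ T.obj₂).hom =
        (α_ w₁ w₃ T.obj₂).hom ≫ s₁ ▷ (w₃ ⊗ T.obj₂) ≫
          𝟙_ K ◁ (s₃ ▷ T.obj₂ ≫ (λ_ T.obj₂).hom) ≫ (λ_ _).hom := by
      simp only [comp_whiskerRight, whiskerLeft_comp, Category.assoc, leftUnitor_whiskerRight,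
        ← associator_naturality_left_assoc, leftUnitor_naturality, leftUnitor_naturality_assoc]
    rw [← cancel_mono (lmap U₂ (λ_ T.obj₂).hom), zero_comp, ← lmap_comp, e]
    simp only [lmap_comp]
    rw [← lwhisker_lmap (𝟙_ K), hg, lwhisker_comp, lwhisker_lmap]
    simp only [Category.assoc]
    rw [← reassoc_of% lwhisker_naturality, h₁]
    simp
  · rintro z b ⟨w, s, hs, h⟩
    refine ⟨w, s, hs, ?_⟩
    have : s ▷ (z ⊗ b) = (α_ _ _ _).inv ≫ (s ▷ z) ▷ b ≫ (α_ _ _ _).hom := by simp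
    rw [this, lmap_comp, lmap_comp, lmap_whiskerRight_eq_zero h, zero_comp,
      comp_zero]

lemma annihilated_of_supportedOn_right {U₁ U₂ : CompactOpens (Spc K)} {z : K}
    (hz : supportedOn (U₂ : Set (Spc K))ᶜ z) : annihilated U₁ U₂ z :=
  ⟨𝟙_ K, 𝟙 _, ObjectProperty.trW_of_isIso _ _,
    (isZero_Q_obj (supportedOn_tensor_right hz _)).eq_of_src _ _⟩

variable [MonoidalClosed K] [StronglyClosed K]

/-- Take for `s` the fibre of the coevaluation `𝟙 ⟶ Dz ⊗ z`. Its cone `Dz ⊗ z` is supported where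
`z` is, and `z ◁ s = 0` because `z ◁ coev z` is a split monomorphism. -/
lemma exists_annihilator {U : CompactOpens (Spc K)} {z : K}
    (hz : supportedOn (U : Set (Spc K))ᶜ z) :
    ∃ (w : K) (s : w ⟶ 𝟙_ K), locW U s ∧ s ▷ z = 0 := by
  obtain ⟨w, s, g, hT⟩ := Pretriangulated.distinguished_cocone_triangle₁ (coev z)
  refine ⟨w, s, ⟨_, _, _, hT, supportedOn_tensor_right hz _⟩, ?_⟩
  have h₀ : s ≫ coev z = 0 := Pretriangulated.comp_distTriang_mor_zero₁₂ _ hT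
  have h₁ : z ◁ s = 0 := by
    rw [← cancel_mono (ρ_ z).hom, ← whiskerLeft_coev_evRetraction, ← whiskerLeft_comp_assoc, h₀]
    simp
  rw [← cancel_mono (β_ _ z).hom, BraidedCategory.braiding_naturality_left, h₁]
  simp

lemma annihilated_of_supportedOn_left {U₁ U₂ : CompactOpens (Spc K)} {z : K}
    (hz : supportedOn (U₁ : Set (Spc K))ᶜ z) : annihilated U₁ U₂ z := by
  obtain ⟨w, s, hs, h⟩ := exists_annihilator hz
  exact ⟨w, s, hs, by rw [h, lmap_zero]⟩

/-- The annihilated objects form a thick ideal containing objects `b₁`, `b₂` with supports exactly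
the complements of `U₁`, `U₂`. A prime above this ideal therefore lies in `U₁ ∩ U₂`, and contains
`z`; since thick ideals are radical, `z` is annihilated. -/
lemma annihilated_of_supportedOn {U₁ U₂ W : CompactOpens (Spc K)}
    (hW : (U₁ : Set (Spc K)) ∩ U₂ ⊆ W) {z : K} (hz : supportedOn (W : Set (Spc K))ᶜ z) :
    annihilated U₁ U₂ z := by
  obtain ⟨b₁, hb₁⟩ := exists_compl_supp_eq U₁
  obtain ⟨b₂, hb₂⟩ := exists_compl_supp_eq U₂
  have hI := isThickIdeal_annihilated U₁ U₂
  refine hI.mem_of_forall_prime z fun P hP => not_not.1 fun h => hz h (hW ⟨?_, ?_⟩)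
  · by_contra h₁
    have h₂ : P ∈ supp b₁ := hb₁ ▸ h₁
    exact h₂ (hP _ (annihilated_of_supportedOn_left hb₁.ge))
  · by_contra h₁
    have h₂ : P ∈ supp b₂ := hb₂ ▸ h₁
    exact h₂ (hP _ (annihilated_of_supportedOn_right hb₂.ge))

/-! ### Morphisms over an intersection as a colimit over denominators -/

section Colimit

variable {U₁ U₂ W : CompactOpens (Spc K)} (hW₂ : W ≤ U₂)
  (hW : (U₁ : Set (Spc K)) ∩ U₂ ⊆ W) {a b : K}
include hW

/-- Injectivity of `colim Mor_{U₂}(w ⊗ a, b) → Mor_W(a, b)`, the colimit being over `s : w ⟶ 𝟙`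
invertible over `U₁`: the numerator of `f` factors through an object supported off `W`, which some
`s` kills. -/
lemma exists_whisker_comp_eq_zero (f : LHom U₂ a b) (hf : lres hW₂ f = 0) :
    ∃ (w : K) (s : w ⟶ 𝟙_ K), locW U₁ s ∧ lmap U₂ (s ▷ a ≫ (λ_ a).hom) ≫ f = 0 := by
  obtain ⟨a', t, ht, g, hg⟩ := exists_fraction f
  obtain ⟨z, hz, p, q, h⟩ := exists_factor_of_lmap_eq_zero (U := W) g (by
    rw [← lres_lmap hW₂, ← hg, lres_comp, hf, comp_zero])
  obtain ⟨w, s, hs, h₀⟩ := annihilated_of_supportedOn hW hz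
  refine ⟨w, s, hs, ?_⟩
  have := isIso_lmap ((locW U₂).whiskerLeft_mem w t ht)
  rw [← cancel_epi (lmap U₂ (w ◁ t)), ← lmap_comp_assoc, whisker_exchange_assoc,
    leftUnitor_naturality, lmap_comp, lmap_comp, Category.assoc, Category.assoc, hg,
    h, ← lmap_comp, ← lmap_comp, ← leftUnitor_naturality_assoc,
    ← whisker_exchange_assoc]
  simp only [lmap_comp]
  rw [h₀]
  simp

/-- Surjectivity of the same map: some `s` kills the cone of the denominator of `f`, so the action
of `s` lifts through this denominator over `U₂`. -/
lemma exists_whisker_comp_eq_lres (f : LHom W a b) :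
    ∃ (w : K) (s : w ⟶ 𝟙_ K) (g : LHom U₂ (w ⊗ a) b), locW U₁ s ∧
      lmap W (s ▷ a ≫ (λ_ a).hom) ≫ f = lres hW₂ g := by
  obtain ⟨a', t, ht, g, hg⟩ := exists_fraction f
  have := isIso_lmap ht
  obtain ⟨z, p, q, hT, hz⟩ := ht
  obtain ⟨w, s, hs, h₀⟩ := annihilated_of_supportedOn hW hz
  obtain ⟨l, hl⟩ := exists_lift U₂ hT (lmap U₂ (s ▷ a ≫ (λ_ a).hom)) (by
    rw [← lmap_comp, Category.assoc, ← leftUnitor_naturality, ← whisker_exchange_assoc,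
      lmap_comp, lmap_comp, h₀, zero_comp, comp_zero])
  refine ⟨w, s, l ≫ lmap U₂ g, hs, ?_⟩
  have hl' := congrArg (lres hW₂) hl
  simp only [lres_lmap, lres_comp] at hl'
  rw [hl', lres_comp, lres_lmap, Category.assoc]
  exact congrArg (_ ≫ ·) hg

end Colimit

/-! ### Excision -/

section Excision

variable {U U₁ U₂ : CompactOpens (Spc K)} (h₂ : U₂ ≤ U)
  (hU : (U : Set (Spc K)) ⊆ U₁ ∪ U₂) {x b : K} (hx : supportedOn (U₁ : Set (Spc K))ᶜ x)
include hU hx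

/-- The cone is supported off `U₁` because of `x` and off `U₂` because of `s`, hence off `U`. Thus
the colimit over the denominators `s` is constant on `x`, and morphisms out of `x` are the same over
`U` and `U₂`. -/
lemma locW_whiskerRight_of_supportedOn {w : K} {s : w ⟶ 𝟙_ K} (hs : locW U₂ s) :
    locW U (s ▷ x) := by
  obtain ⟨z, p, q, hT, hz⟩ := hs
  refine ⟨_, _, _, whiskerRight_distinguished hT x, fun P hP hPU => ?_⟩
  change P ∈ supp (z ⊗ x) at hP
  rw [supp_tensor] at hP
  exact (hU hPU).elim (hx hP.2) (hz hP.1)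

lemma lres_injective_of_supportedOn {f : LHom U x b} (hf : lres h₂ f = 0) : f = 0 := by
  -- The colimit description is used for the pair `U₂`, `U`, with intersection `U₂`.
  obtain ⟨w, s, hs, h⟩ := exists_whisker_comp_eq_zero (U₁ := U₂) h₂ Set.inter_subset_left f hf
  have h₃ := isIso_lmap (locW_whiskerRight_of_supportedOn hU hx hs)
  have h₄ : IsIso (lmap U (s ▷ x ≫ (λ_ x).hom)) := by
    rw [lmap_comp]
    infer_instance
  rwa [← cancel_epi (lmap U (s ▷ x ≫ (λ_ x).hom)), comp_zero]

lemma exists_lres_eq_of_supportedOn (f : LHom U₂ x b) :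
    ∃ g : LHom U x b, lres h₂ g = f := by
  obtain ⟨w, s, g, hs, h⟩ := exists_whisker_comp_eq_lres (U₁ := U₂) h₂ Set.inter_subset_left
    f
  have h₃ := isIso_lmap (locW_whiskerRight_of_supportedOn hU hx hs)
  have h₄ : IsIso (lmap U (s ▷ x ≫ (λ_ x).hom)) := by
    rw [lmap_comp]
    infer_instance
  have h₅ : IsIso (lmap U₂ (s ▷ x ≫ (λ_ x).hom)) := by
    rw [← lres_lmap h₂]
    exact inferInstanceAs (IsIso ((resL h₂).map _))
  refine ⟨inv (lmap U (s ▷ x ≫ (λ_ x).hom)) ≫ g, ?_⟩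
  rw [← cancel_epi (lmap U₂ (s ▷ x ≫ (λ_ x).hom)), h, ← lres_lmap h₂, ← lres_comp,
    IsIso.hom_inv_id_assoc]

end Excision

end Annihilators

end TTCat

namespace TTCat

/-! ### Mayer–Vietoris for morphisms -/

section MayerVietoris

variable {K : Type u} [Category.{v} K] [Preadditive K] [HasZeroObject K] [HasShift K ℤ]
  [∀ n : ℤ, (shiftFunctor K n).Additive] [Pretriangulated K] [MonoidalCategory K]

/-- The morphism `w ⊗ a ⟶ a` induced by `s : w ⟶ 𝟙`. -/
def act {w : K} (s : w ⟶ 𝟙_ K) (a : K) : w ⊗ a ⟶ a := s ▷ a ≫ (λ_ a).hom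

lemma act_tensor {w w' : K} (s : w ⟶ 𝟙_ K) (s' : w' ⟶ 𝟙_ K) (a : K) :
    act (act s w' ≫ s') a = (α_ w w' a).hom ≫ act s (w' ⊗ a) ≫ act s' a := by
  simp [act]

variable [IsTriangulated K] [SymmetricCategory K] [TensorTriangulated K]

lemma act_comp_mem {U : CompactOpens (Spc K)} {w w' : K} {s : w ⟶ 𝟙_ K} {s' : w' ⟶ 𝟙_ K}
    (hs : locW U s) (hs' : locW U s') : locW U (act s w' ≫ s') := by
  rw [act, Category.assoc]
  exact tensor_comp_mem hs hs'

lemma isIso_lmap_act {U : CompactOpens (Spc K)} {w : K} {s : w ⟶ 𝟙_ K} (hs : locW U s) (a : K) :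
    IsIso (lmap U (act s a)) := by
  have := isIso_lmap ((locW U).whiskerRight_mem s hs a)
  rw [act, lmap_comp]
  infer_instance

lemma act_distinguished {w x : K} {s : w ⟶ 𝟙_ K} {p : 𝟙_ K ⟶ x} {q : x ⟶ w⟦(1 : ℤ)⟧}
    (hT : Pretriangulated.Triangle.mk s p q ∈ Pretriangulated.distinguishedTriangles) (a : K) :
    Pretriangulated.Triangle.mk (act s a) ((λ_ a).inv ≫ p ▷ a)
      (q ▷ a ≫ (((curriedTensor K).flip.obj a).commShiftIso (1 : ℤ)).hom.app w) ∈
        Pretriangulated.distinguishedTriangles := by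
  refine Pretriangulated.isomorphic_distinguished _ (whiskerRight_distinguished hT a) _ ?_
  exact Pretriangulated.Triangle.isoMk _ _ (Iso.refl _) (λ_ a).symm (Iso.refl _)
    (by change act s a ≫ (λ_ a).inv = 𝟙 _ ≫ s ▷ a; simp [act])
    (by change ((λ_ a).inv ≫ p ▷ a) ≫ 𝟙 _ = (λ_ a).inv ≫ p ▷ a; simp)
    (by
      change (q ▷ a ≫ _) ≫ (𝟙 _)⟦(1 : ℤ)⟧' = 𝟙 _ ≫ q ▷ a ≫ _
      rw [CategoryTheory.Functor.map_id, Category.id_comp]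
      exact Category.comp_id _)

lemma exists_distinguished_left {x y z : K} {f : x ⟶ y} {g : y ⟶ z} {h : z ⟶ x⟦(1 : ℤ)⟧}
    (hT : Pretriangulated.Triangle.mk f g h ∈ Pretriangulated.distinguishedTriangles) :
    ∃ (i : z⟦(-1 : ℤ)⟧ ⟶ x) (j : y ⟶ z⟦(-1 : ℤ)⟧⟦(1 : ℤ)⟧),
      Pretriangulated.Triangle.mk i f j ∈ Pretriangulated.distinguishedTriangles :=
  ⟨_, _, Pretriangulated.inv_rot_of_distTriang _ hT⟩

/-- The comparison of `T (𝟙 ⊗ w)` with `T w`. -/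
noncomputable def shiftUnit (w : K) : w⟦(1 : ℤ)⟧ ⟶ w⟦(1 : ℤ)⟧ :=
  (λ_ _).inv ≫ (((curriedTensor K).obj (𝟙_ K)).commShiftIso (1 : ℤ)).hom.app w ≫
    (λ_ w).hom⟦(1 : ℤ)⟧'

/-- Compares the shift of an action with the action on the shift. It is used only to transport a
vanishing statement, so `shiftUnit` need not be identified further. -/
lemma shift_act {w w' : K} (r : w' ⟶ 𝟙_ K) :
    (act r w)⟦(1 : ℤ)⟧' = (((curriedTensor K).obj w').commShiftIso (1 : ℤ)).inv.app w ≫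
      act r (w⟦(1 : ℤ)⟧) ≫ shiftUnit w := by
  have := NatTrans.app_shift ((curriedTensor K).map r) (1 : ℤ) w
  change r ▷ (w⟦(1 : ℤ)⟧) = _ ≫ (r ▷ w)⟦(1 : ℤ)⟧' ≫ _ at this
  simp [act, shiftUnit, this]

variable [MonoidalClosed K] [StronglyClosed K]

section

variable {U U₁ U₂ W : CompactOpens (Spc K)} (h₁ : U₁ ≤ U) (h₂ : U₂ ≤ U)
  (hU : (U : Set (Spc K)) ⊆ U₁ ∪ U₂) {a b : K}

/-- A morphism which vanishes over `U₁` factors through an object supported outside `U₁`. -/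
lemma exists_factor_of_lres_eq_zero (f : LHom U a b) (hf : lres h₁ f = 0) :
    ∃ (w x : K) (s : w ⟶ 𝟙_ K) (p : 𝟙_ K ⟶ x) (q : x ⟶ w⟦(1 : ℤ)⟧)
      (_ : Pretriangulated.Triangle.mk s p q ∈ Pretriangulated.distinguishedTriangles)
      (_ : supportedOn (U₁ : Set (Spc K))ᶜ x) (κ : LHom U (x ⊗ a) b),
      f = lmap U ((λ_ a).inv ≫ p ▷ a) ≫ κ := by
  obtain ⟨w, s, ⟨x, p, q, hT, hx⟩, h⟩ := exists_whisker_comp_eq_zero (U₁ := U₁) h₁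
    Set.inter_subset_left f hf
  obtain ⟨κ, hκ⟩ := exists_desc U (act_distinguished hT a) f h
  exact ⟨w, x, s, p, q, hT, hx, κ, hκ⟩

include hU in
-- Since `f` factors through an object supported off `U₁`, excision makes the vanishing over `U₂` of
-- the second part of this factorization followed by `g` imply its vanishing over `U`. In particular
-- locally zero endomorphisms have square zero.
lemma comp_eq_zero_of_lres_eq_zero {c : K} (f : LHom U a b) (g : LHom U b c)
    (hf : lres h₁ f = 0) (hg : lres h₂ g = 0) : f ≫ g = 0 := by
  obtain ⟨w, x, s, p, q, -, hx, κ, rfl⟩ := exists_factor_of_lres_eq_zero h₁ f hf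
  have : κ ≫ g = 0 := lres_injective_of_supportedOn h₂ hU (supportedOn_tensor_left hx a)
    (by rw [lres_comp, hg, comp_zero])
  rw [Category.assoc, this, comp_zero]

variable (k₁ : W ≤ U₁) (k₂ : W ≤ U₂) (hW : (U₁ : Set (Spc K)) ∩ U₂ ⊆ W)
include hU hW

/-- After multiplication by a suitable denominator `s` invertible over `U₁`, both morphisms are
restrictions of one `g` over `U`. By excision `g` descends along the action of `s`, and a correction
supported off `U₁` adjusts the result over `U₂`. -/
lemma exists_glue (f₁ : LHom U₁ a b) (f₂ : LHom U₂ a b) (hf : lres k₁ f₁ = lres k₂ f₂) :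
    ∃ f : LHom U a b, lres h₁ f = f₁ ∧ lres h₂ f = f₂ := by
  obtain ⟨w₀, s₀, g₀, hs₀, hg₀⟩ : ∃ (w : K) (s : w ⟶ 𝟙_ K) (g : LHom U (w ⊗ a) b), locW U₁ s ∧
      lmap U₁ (act s a) ≫ f₁ = lres h₁ g :=
    exists_whisker_comp_eq_lres (U₁ := U₁) h₁ Set.inter_subset_left f₁
  -- The extension `g₀` and `f₂` agree over `W` after the action of `s₀`; enlarging the denominator
  -- by `s₁` makes them agree over `U₂`.
  obtain ⟨w₁, s₁, hs₁, hδ⟩ : ∃ (w : K) (s : w ⟶ 𝟙_ K), locW U₁ s ∧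
      lmap U₂ (act s (w₀ ⊗ a)) ≫ (lmap U₂ (act s₀ a) ≫ f₂ - lres h₂ g₀) = 0 :=
    exists_whisker_comp_eq_zero k₂ hW _ (by
      have := congrArg (lres k₁) hg₀
      simp only [lres_comp, lres_lmap, lres_lres] at this
      simp [← hf, this])
  obtain ⟨s, hs, rfl⟩ : ∃ s : w₁ ⊗ w₀ ⟶ 𝟙_ K, locW U₁ s ∧ s = act s₁ w₀ ≫ s₀ :=
    ⟨_, act_comp_mem hs₁ hs₀, rfl⟩
  have hact := act_tensor s₁ s₀ a
  obtain ⟨g, hg⟩ : ∃ g : LHom U ((w₁ ⊗ w₀) ⊗ a) b,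
      g = lmap U ((α_ w₁ w₀ a).hom ≫ act s₁ (w₀ ⊗ a)) ≫ g₀ := ⟨_, rfl⟩
  have hg₁ : lmap U₁ (act (act s₁ w₀ ≫ s₀) a) ≫ f₁ = lres h₁ g := by
    simp only [hact, hg, lmap_comp, Category.assoc, lres_comp, lres_lmap, hg₀]
  have hg₂ : lmap U₂ (act (act s₁ w₀ ≫ s₀) a) ≫ f₂ = lres h₂ g := by
    rw [Preadditive.comp_sub, sub_eq_zero] at hδ
    simp only [hact, hg, lmap_comp, Category.assoc, lres_comp, lres_lmap, hδ]
  have := isIso_lmap_act hs a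
  obtain ⟨x, p, q, hT, hx⟩ := hs
  have hT' := act_distinguished hT a
  obtain ⟨i, j, hT''⟩ := exists_distinguished_left hT'
  -- The fibre of the action is supported off `U₁`, so the vanishing may be checked over `U₂`, where
  -- `g` comes from `f₂`.
  have hi : lmap U i ≫ g = 0 := by
    refine lres_injective_of_supportedOn h₂ hU ((supportedOn _).le_shift (-1 : ℤ) _
      (supportedOn_tensor_left hx a)) ?_
    have h₀ : i ≫ act (act s₁ w₀ ≫ s₀) a = 0 :=
      Pretriangulated.comp_distTriang_mor_zero₁₂ _ hT''
    rw [lres_comp, lres_lmap, ← hg₂, ← lmap_comp_assoc, h₀, lmap_zero, zero_comp]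
  obtain ⟨f, hf'⟩ := exists_desc U hT'' g hi
  have hf₁ : lres h₁ f = f₁ := by
    rw [← cancel_epi (lmap U₁ (act (act s₁ w₀ ≫ s₀) a)), hg₁, hf', lres_comp, lres_lmap]
  -- The error over `U₂` factors through an object supported off `U₁`, so by excision it extends to
  -- `U`; there it does not disturb `f₁`.
  obtain ⟨κ, hκ⟩ := exists_desc U₂ hT' (lres h₂ f - f₂) (by
    rw [Preadditive.comp_sub, hg₂, hf', lres_comp, lres_lmap, sub_self])
  obtain ⟨κ', rfl⟩ := exists_lres_eq_of_supportedOn h₂ hU (supportedOn_tensor_left hx a) κ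
  refine ⟨f - lmap U ((λ_ a).inv ≫ p ▷ a) ≫ κ', ?_, ?_⟩
  · rw [lres_sub, hf₁, lres_comp,
      (isZero_Q_obj (supportedOn_tensor_left hx a)).eq_of_src (lres h₁ κ') 0, comp_zero, sub_zero]
  · rw [lres_sub, lres_comp, lres_lmap, ← hκ, sub_sub_cancel]

include k₂ in
-- A locally zero `f` arises from a boundary class in `Mor_W(T 𝟙 ⊗ a, b)`. Composition with `e` and
-- `e'` allows `a` and `b` to be replaced by images of idempotents that need not exist as objects of
-- `L(U)`.
lemma comp_eq_zero_of_locally (e : LHom U a a) (f : LHom U a b) (e' : LHom U b b)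
    (hf₁ : lres h₁ f = 0) (hf₂ : lres h₂ f = 0)
    (hvan : ∀ h : LHom W ((𝟙_ K)⟦(1 : ℤ)⟧ ⊗ a) b,
      lwhisker _ (lres (k₁.trans h₁) e) ≫ h ≫ lres (k₁.trans h₁) e' = 0) :
    e ≫ f ≫ e' = 0 := by
  obtain ⟨w, s, hs, h₀⟩ := exists_whisker_comp_eq_zero (U₁ := U₁) h₁
    Set.inter_subset_left f hf₁
  have hs' := hs
  obtain ⟨x, p, q, hT, hx⟩ := hs
  obtain ⟨κ, hκ⟩ := exists_desc U (act_distinguished hT a) f h₀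
  obtain ⟨h, hh⟩ : ∃ h : LHom U₂ (w⟦(1 : ℤ)⟧ ⊗ a) b, lres h₂ κ = lmap U₂ (q ▷ a) ≫ h := by
    obtain ⟨h, hh⟩ := exists_desc₃ U₂ (act_distinguished hT a) (lres h₂ κ) (by
      rw [← lres_lmap h₂, ← lres_comp, ← hκ, hf₂])
    exact ⟨_, hh.trans (by rw [lmap_comp, Category.assoc])⟩
  -- Over `W` the denominator `s` is invertible, so there `T w ⊗ a` may be replaced by `T 𝟙 ⊗ a`, to
  -- which `hvan` applies.
  have hiso : IsIso (lmap W (s⟦(1 : ℤ)⟧' ▷ a)) :=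
    isIso_lmap ((locW W).whiskerRight_mem _ (ObjectProperty.trW.shift
      (locW_mono k₁ hs') (1 : ℤ)) a)
  obtain ⟨h', hh'⟩ : ∃ h', h' = lwhisker _ (lres h₂ e) ≫ h ≫ lres h₂ e' := ⟨_, rfl⟩
  have hW₀ : lres k₂ h' = 0 := by
    obtain ⟨k, hk⟩ : ∃ k, lres k₂ h = lmap W (s⟦(1 : ℤ)⟧' ▷ a) ≫ k :=
      ⟨inv (lmap W (s⟦(1 : ℤ)⟧' ▷ a)) ≫ lres k₂ h, by simp⟩
    simp only [hh', lres_comp, lres_lwhisker, lres_lres, hk, Category.assoc]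
    rw [reassoc_of% lwhisker_naturality, hvan, comp_zero]
  obtain ⟨w₁, r₀, hr₀, hr⟩ : ∃ (w' : K) (r : w' ⟶ 𝟙_ K), locW U₁ r ∧
      lmap U₂ (act r (w⟦(1 : ℤ)⟧ ⊗ a)) ≫ lmap U₂ (shiftUnit w ▷ a) ≫ h' = 0 :=
    exists_whisker_comp_eq_zero k₂ hW _ (by rw [lres_comp, hW₀, comp_zero])
  have hr' : lmap U₂ ((act r₀ w)⟦(1 : ℤ)⟧' ▷ a) ≫ h' = 0 := by
    have : act r₀ (w⟦(1 : ℤ)⟧) ▷ a = (α_ _ _ _).hom ≫ act r₀ (w⟦(1 : ℤ)⟧ ⊗ a) := by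
      simp [act]
    rw [shift_act, comp_whiskerRight, comp_whiskerRight, this]
    simp only [lmap_comp, Category.assoc]
    rw [hr]
    simp
  -- Passing to the larger denominator replaces the cone `x` by `x'`; the comparison `c : x' ⟶ x`
  -- carries the boundary class to one that is zero over `U₂`.
  obtain ⟨x', p', q', hT', hx'⟩ := act_comp_mem hr₀ hs'
  obtain ⟨c, hc₁, hc₂⟩ : ∃ c : x' ⟶ x, p' ≫ c = p ∧ q' ≫ (act r₀ w)⟦(1 : ℤ)⟧' = c ≫ q := by
    obtain ⟨c, hc₁, hc₂⟩ := Pretriangulated.complete_distinguished_triangle_morphism _ _ hT' hT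
      (act r₀ w) (𝟙 _) (Category.comp_id _)
    exact ⟨c, hc₁.trans (Category.id_comp _), hc₂⟩
  have key : lmap U (c ▷ a) ≫ lwhisker x e ≫ κ ≫ e' = 0 := by
    refine lres_injective_of_supportedOn h₂ hU (supportedOn_tensor_left hx' a) ?_
    simp only [lres_comp, lres_lwhisker, lres_lmap, hh, Category.assoc]
    rw [reassoc_of% lwhisker_naturality, ← lmap_comp_assoc, ← comp_whiskerRight, ← hc₂,
      comp_whiskerRight, lmap_comp, Category.assoc, ← hh', hr', comp_zero]
  have e₁ : e ≫ lmap U ((λ_ a).inv ≫ p ▷ a) = lmap U ((λ_ a).inv ≫ p ▷ a) ≫ lwhisker x e := by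
    rw [← cancel_epi (lmap U (λ_ a).hom), ← lmap_comp_assoc, Iso.hom_inv_id_assoc,
      ← lwhisker_naturality, lmap_comp, ← reassoc_of% lwhisker_unit_naturality, ← lmap_comp_assoc]
    simp
  rw [hκ, Category.assoc, reassoc_of% e₁, ← hc₁, comp_whiskerRight, lmap_comp, lmap_comp,
    Category.assoc, Category.assoc, key, comp_zero, comp_zero]

end

end MayerVietoris

end TTCat

namespace TTCat

/-! ### Gluing objects and idempotents over two open sets -/

section ObjectGluing

variable {K : Type u} [Category.{v} K] [Preadditive K] [HasZeroObject K] [HasShift K ℤ]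
  [∀ n : ℤ, (shiftFunctor K n).Additive] [Pretriangulated K] [MonoidalCategory K]

instance isIso_lres {U V : CompactOpens (Spc K)} (h : U ≤ V) {a b : K} (f : LHom V a b) [IsIso f] :
    IsIso (lres h f) :=
  inferInstanceAs (IsIso ((resL h).map f))

variable [IsTriangulated K] [SymmetricCategory K] [TensorTriangulated K]
  [MonoidalClosed K] [StronglyClosed K]

variable {U U₁ U₂ W : CompactOpens (Spc K)} (h₁ : U₁ ≤ U) (h₂ : U₂ ≤ U)
  (hU : (U : Set (Spc K)) ⊆ U₁ ∪ U₂) (k₁ : W ≤ U₁) (k₂ : W ≤ U₂)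
  (hW : (U₁ : Set (Spc K)) ∩ U₂ ⊆ W)

/-- The image in `L(U)` of a distinguished triangle of `K`. -/
lemma lmap_distinguished (U : CompactOpens (Spc K)) {x y z : K} {f : x ⟶ y} {g : y ⟶ z}
    {h : z ⟶ x⟦(1 : ℤ)⟧}
    (hT : Pretriangulated.Triangle.mk f g h ∈ Pretriangulated.distinguishedTriangles) :
    Pretriangulated.Triangle.mk (lmap U f) (lmap U g)
      (lmap U h ≫ ((locW U).Q.commShiftIso (1 : ℤ)).hom.app x) ∈
        Pretriangulated.distinguishedTriangles :=
  (locW U).Q.map_distinguished _ hT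

/-- Modification of the first object of the image of a distinguished triangle of `K`. -/
lemma lmap_distinguished_of_fraction (U : CompactOpens (Spc K)) {x x' y z : K} {f : x ⟶ y}
    {g : y ⟶ z} {h : z ⟶ x⟦(1 : ℤ)⟧}
    (hT : Pretriangulated.Triangle.mk f g h ∈ Pretriangulated.distinguishedTriangles)
    (t : x ⟶ x') [IsIso (lmap U t)] (f' : LHom U x' y) (hf : lmap U t ≫ f' = lmap U f) :
    Pretriangulated.Triangle.mk f' (lmap U g)
      (lmap U (h ≫ t⟦(1 : ℤ)⟧') ≫ ((locW U).Q.commShiftIso (1 : ℤ)).hom.app x') ∈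
        Pretriangulated.distinguishedTriangles := by
  refine Pretriangulated.isomorphic_distinguished _ (lmap_distinguished U hT) _ ?_
  refine Pretriangulated.Triangle.isoMk _ _ (asIso (lmap U t)).symm (Iso.refl _) (Iso.refl _)
    ?_ ?_ ?_
  · change f' ≫ 𝟙 _ = inv (lmap U t) ≫ lmap U f
    rw [← hf]
    simp
  · change lmap U g ≫ 𝟙 _ = 𝟙 _ ≫ lmap U g
    simp
  · change (lmap U (h ≫ t⟦(1 : ℤ)⟧') ≫ ((locW U).Q.commShiftIso (1 : ℤ)).hom.app x') ≫
      (inv (lmap U t))⟦(1 : ℤ)⟧' =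
        𝟙 _ ≫ lmap U h ≫ ((locW U).Q.commShiftIso (1 : ℤ)).hom.app x
    have := ((locW U).Q.commShiftIso (1 : ℤ)).hom.naturality t
    change lmap U (t⟦(1 : ℤ)⟧') ≫ _ = _ ≫ (lmap U t)⟦(1 : ℤ)⟧' at this
    rw [lmap_comp, Category.assoc, Category.assoc, reassoc_of% this, ← Functor.map_comp,
      IsIso.hom_inv_id, CategoryTheory.Functor.map_id, Category.id_comp]
    exact congrArg _ (Category.comp_id _)

include h₁ h₂ hU k₁ k₂ hW in
-- The extension of `g` to `w ⊗ A ⟶ B` over `U₂` has a cone `z` supported off `W`, which over `U₂`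
-- is a retract of an object `x₁ ⊗ z` supported off `U₁`. By excision the induced class `x₁ ⊗ z ⟶ T
-- (w ⊗ A)` exists over `U`, and the corresponding extension is `c`. Over `U₂` only a retract is
-- obtained, because `x₁ ⊗ z` may be larger than `z`.
lemma exists_glued_object {A B : K} (g : LHom W A B) [IsIso g] :
    ∃ (c : K) (k : LHom U₁ A c) (m : LHom U₂ B c) (n : LHom U₂ c B),
      IsIso k ∧ m ≫ n = 𝟙 _ ∧ g ≫ lres k₂ m = lres k₁ k := by
  obtain ⟨w, s, g₀, hs, hg₀⟩ : ∃ (w : K) (s : w ⟶ 𝟙_ K) (g₀ : LHom U₂ (w ⊗ A) B), locW U₁ s ∧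
      lmap W (act s A) ≫ g = lres k₂ g₀ := exists_whisker_comp_eq_lres k₂ hW g
  have hactW := isIso_lmap_act (locW_mono k₁ hs) A
  have hact₁ := isIso_lmap_act hs A
  obtain ⟨D, t, ht, g₁, hg₁⟩ := exists_fraction g₀
  have ht₂ := isIso_lmap ht
  have htW := isIso_lmap (locW_mono k₂ ht)
  obtain ⟨z, p₀, q₀, hz⟩ := Pretriangulated.distinguished_cocone_triangle g₁
  have hzW : supportedOn (W : Set (Spc K))ᶜ z := by
    refine supportedOn_of_isZero
      ((Pretriangulated.Triangle.isZero₃_iff_isIso₁ _ (lmap_distinguished W hz)).2 ?_)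
    change IsIso (lmap W g₁)
    rw [← lres_lmap k₂, ← hg₁, lres_comp, lres_lmap, ← hg₀]
    infer_instance
  obtain ⟨w₁, s₁, hs₁, h₀⟩ := annihilated_of_supportedOn hW hzW
  obtain ⟨x₁, p₁, q₁, hT₁, hx₁⟩ := hs₁
  -- As `s₁` kills `z` over `U₂`, the identity of `z` factors through `x₁ ⊗ z`.
  obtain ⟨r, hr⟩ := exists_desc U₂ (act_distinguished hT₁ z) (𝟙 _) (by
    rw [act, lmap_comp, h₀, zero_comp, zero_comp])
  obtain ⟨δ, hδ⟩ := exists_lres_eq_of_supportedOn h₂ hU (supportedOn_tensor_left hx₁ z)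
    (r ≫ lmap U₂ (q₀ ≫ t⟦(1 : ℤ)⟧'))
  obtain ⟨z', t₁, ht₁, δ₀, hδ₀⟩ := exists_fraction δ
  have ht₁₂ := isIso_lmap (locW_mono h₂ ht₁)
  have hz' : IsZero ((locW U₁).Q.obj z') := by
    have := isIso_lmap (locW_mono h₁ ht₁)
    exact IsZero.of_iso (isZero_Q_obj (supportedOn_tensor_left hx₁ z)) (asIso (lmap U₁ t₁))
  obtain ⟨c, k₀, l₀, hc⟩ := Pretriangulated.distinguished_cocone_triangle₂ δ₀
  have hk₀ : IsIso (lmap U₁ k₀) :=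
    (Pretriangulated.Triangle.isZero₃_iff_isIso₁ _ (lmap_distinguished U₁ hc)).1 hz'
  have hT := lmap_distinguished_of_fraction U₂ hz t g₀ hg₁
  have hT' := lmap_distinguished U₂ hc
  have hδ₀' : lmap U₂ δ₀ = lmap U₂ t₁ ≫ r ≫ lmap U₂ (q₀ ≫ t⟦(1 : ℤ)⟧') := by
    rw [← hδ, ← lres_lmap h₂, ← hδ₀, lres_comp, lres_lmap]
  obtain ⟨γ, hγ⟩ : ∃ γ : LHom U₂ z z', γ ≫ lmap U₂ t₁ ≫ r = 𝟙 _ :=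
    ⟨lmap U₂ ((λ_ z).inv ≫ p₁ ▷ z) ≫ inv (lmap U₂ t₁), by
      rw [Category.assoc, IsIso.inv_hom_id_assoc, ← hr]⟩
  obtain ⟨m, hm₁, hm₂⟩ : ∃ m : LHom U₂ B c, g₀ ≫ m = lmap U₂ k₀ ∧
      lmap U₂ p₀ ≫ γ = m ≫ lmap U₂ l₀ := by
    obtain ⟨m, hm₁, hm₂⟩ := Pretriangulated.complete_distinguished_triangle_morphism₂ _ _ hT hT'
      (𝟙 _) γ (by
        change (lmap U₂ _ ≫ _) ≫ (𝟙 _)⟦(1 : ℤ)⟧' = γ ≫ lmap U₂ δ₀ ≫ _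
        rw [CategoryTheory.Functor.map_id, hδ₀']
        simp only [Category.assoc]
        rw [reassoc_of% hγ]
        exact congrArg _ (Category.comp_id _))
    exact ⟨m, hm₁.trans (Category.id_comp _), hm₂⟩
  obtain ⟨n, hn₁, hn₂⟩ : ∃ n : LHom U₂ c B, lmap U₂ k₀ ≫ n = g₀ ∧
      lmap U₂ l₀ ≫ lmap U₂ t₁ ≫ r = n ≫ lmap U₂ p₀ := by
    obtain ⟨n, hn₁, hn₂⟩ := Pretriangulated.complete_distinguished_triangle_morphism₂ _ _ hT' hT
      (𝟙 _) (lmap U₂ t₁ ≫ r) (by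
        change (lmap U₂ δ₀ ≫ _) ≫ (𝟙 _)⟦(1 : ℤ)⟧' = (_ ≫ _) ≫ lmap U₂ _ ≫ _
        rw [CategoryTheory.Functor.map_id, hδ₀']
        simp only [Category.assoc]
        exact congrArg (fun x => _ ≫ _ ≫ _ ≫ x) (Category.comp_id _))
    exact ⟨n, hn₁.trans (Category.id_comp _), hn₂⟩
  -- Fillers of triangle morphisms are not unique, so `m ≫ n` is only an isomorphism, by the five
  -- lemma; `n` is normalized at the end.
  have hmn : IsIso (m ≫ n) := by
    let φ : Pretriangulated.Triangle.mk g₀ (lmap U₂ p₀) (lmap U₂ (q₀ ≫ t⟦(1 : ℤ)⟧') ≫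
        ((locW U₂).Q.commShiftIso (1 : ℤ)).hom.app (w ⊗ A)) ⟶ Pretriangulated.Triangle.mk g₀
          (lmap U₂ p₀) (lmap U₂ (q₀ ≫ t⟦(1 : ℤ)⟧') ≫
        ((locW U₂).Q.commShiftIso (1 : ℤ)).hom.app (w ⊗ A)) :=
      { hom₁ := 𝟙 _
        hom₂ := m ≫ n
        hom₃ := 𝟙 _
        comm₁ := by
          change g₀ ≫ m ≫ n = 𝟙 _ ≫ g₀
          rw [reassoc_of% hm₁, hn₁, Category.id_comp]
        comm₂ := by
          change lmap U₂ p₀ ≫ 𝟙 _ = (m ≫ n) ≫ lmap U₂ p₀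
          rw [Category.assoc, ← hn₂, ← reassoc_of% hm₂, hγ]
        comm₃ := by
          rw [CategoryTheory.Functor.map_id, Category.id_comp, Category.comp_id] }
    exact Pretriangulated.isIso₂_of_isIso₁₃ φ hT hT (inferInstanceAs (IsIso (𝟙 _)))
      (inferInstanceAs (IsIso (𝟙 _)))
  refine ⟨c, inv (lmap U₁ (act s A)) ≫ lmap U₁ k₀, m, n ≫ inv (m ≫ n), inferInstance, ?_, ?_⟩
  · rw [← Category.assoc, IsIso.hom_inv_id]
  · rw [← cancel_epi (lmap W (act s A)), reassoc_of% hg₀, ← lres_comp, hm₁, ← lres_lmap k₁,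
      ← lres_comp, IsIso.hom_inv_id_assoc, lres_lmap, lres_lmap]

/-- The polynomial `3x² - 2x³` lifts idempotents modulo an ideal of square zero. -/
lemma isIdempotentElem_three_sub_two {R : Type*} [Ring R] (x : R)
    (h : (x * x - x) * (x * x - x) = 0) :
    IsIdempotentElem (x * x + x * x + x * x - (x * x * x + x * x * x)) := by
  rw [IsIdempotentElem, ← sub_eq_zero]
  have : (x * x + x * x + x * x - (x * x * x + x * x * x)) *
      (x * x + x * x + x * x - (x * x * x + x * x * x)) -
      (x * x + x * x + x * x - (x * x * x + x * x * x)) =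
        (x * x - x) * (x * x - x) * (4 * x * x - 4 * x - 3) := by noncomm_ring
  rw [this, h, zero_mul]

include hU k₁ k₂ hW in
/-- Idempotents over `U₁` and `U₂` which agree over `U₁ ∩ U₂` lift to an idempotent. -/
lemma exists_idempotent_lift {c : K} (e₁ : LHom U₁ c c) (e₂ : LHom U₂ c c)
    (he₁ : e₁ ≫ e₁ = e₁) (he₂ : e₂ ≫ e₂ = e₂) (h : lres k₁ e₁ = lres k₂ e₂) :
    ∃ ε : LHom U c c, ε ≫ ε = ε ∧ lres h₁ ε = e₁ ∧ lres h₂ ε = e₂ := by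
  obtain ⟨η, hη₁, hη₂⟩ := exists_glue h₁ h₂ hU k₁ k₂ hW e₁ e₂ h
  have hN : (η ≫ η - η) ≫ (η ≫ η - η) = 0 :=
    comp_eq_zero_of_lres_eq_zero h₁ h₂ hU _ _ (by simp [hη₁, he₁]) (by simp [hη₂, he₂])
  refine ⟨η ≫ η + η ≫ η + η ≫ η - (η ≫ η ≫ η + η ≫ η ≫ η),
    isIdempotentElem_three_sub_two (R := End ((locW U).Q.obj c)) η hN, ?_, ?_⟩
  · simp [hη₁, he₁]
  · simp [hη₂, he₂]

include h₁ h₂ hU k₁ k₂ hW in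
/-- Gluing of an idempotent `e` over `U₁` and an object `B` over `U₂` which is isomorphic over
`U₁ ∩ U₂` to the image of `e`. -/
lemma exists_glued_idempotent {A B : K} (e : LHom U₁ A A) (he : e ≫ e = e) (φ : LHom W A B)
    (ψ : LHom W B A) (hφψ : φ ≫ ψ = lres k₁ e) (hψφ : ψ ≫ φ = 𝟙 _) :
    ∃ (c : K) (ε : LHom U c c) (p₁ : LHom U₁ c A) (i₁ : LHom U₁ A c) (p₂ : LHom U₂ c B)
      (i₂ : LHom U₂ B c), ε ≫ ε = ε ∧ i₁ ≫ p₁ = e ∧ p₁ ≫ i₁ = lres h₁ ε ∧ i₂ ≫ p₂ = 𝟙 _ ∧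
        p₂ ≫ i₂ = lres h₂ ε ∧ lres k₁ p₁ ≫ φ = lres k₂ p₂ := by
  have hφ : lres k₁ e ≫ φ = φ := by rw [← hφψ, Category.assoc, hψφ, Category.comp_id]
  have hψ : ψ ≫ lres k₁ e = ψ := by rw [← hφψ, reassoc_of% hψφ]
  have heW : lres k₁ e ≫ lres k₁ e = lres k₁ e := by rw [← lres_comp, he]
  have b₁ (V : CompactOpens (Spc K)) :
      lmap V (biprod.inl : A ⟶ A ⊞ B) ≫ lmap V biprod.fst = 𝟙 _ := by
    rw [← lmap_comp, biprod.inl_fst, lmap_id]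
  have b₂ (V : CompactOpens (Spc K)) :
      lmap V (biprod.inr : B ⟶ A ⊞ B) ≫ lmap V biprod.snd = 𝟙 _ := by
    rw [← lmap_comp, biprod.inr_snd, lmap_id]
  have b₃ (V : CompactOpens (Spc K)) :
      lmap V (biprod.inl : A ⟶ A ⊞ B) ≫ lmap V biprod.snd = 0 := by
    rw [← lmap_comp, biprod.inl_snd, lmap_zero]
  have b₄ (V : CompactOpens (Spc K)) :
      lmap V (biprod.inr : B ⟶ A ⊞ B) ≫ lmap V biprod.fst = 0 := by
    rw [← lmap_comp, biprod.inr_fst, lmap_zero]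
  have b₅ (V : CompactOpens (Spc K)) :
      lmap V (biprod.fst : A ⊞ B ⟶ A) ≫ lmap V biprod.inl +
        lmap V (biprod.snd : A ⊞ B ⟶ B) ≫ lmap V biprod.inr = 𝟙 _ := by
    rw [← lmap_comp, ← lmap_comp, ← lmap_add, biprod.total, lmap_id]
  -- As `e` need not split, `A ⊞ B` is glued with itself, along the involution that exchanges the
  -- image of `e` with `B` and fixes the image of `1 - e`.
  obtain ⟨τ, hτ⟩ : ∃ τ : LHom W (A ⊞ B) (A ⊞ B),
      τ = lmap W biprod.fst ≫ (𝟙 _ - lres k₁ e) ≫ lmap W biprod.inl +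
        lmap W biprod.fst ≫ φ ≫ lmap W biprod.inr +
        lmap W biprod.snd ≫ ψ ≫ lmap W biprod.inl := ⟨_, rfl⟩
  have τ₁ : lmap W biprod.inl ≫ τ = (𝟙 _ - lres k₁ e) ≫ lmap W biprod.inl +
      φ ≫ lmap W biprod.inr := by
    simp only [hτ, Preadditive.comp_add, reassoc_of% (b₁ W), reassoc_of% (b₃ W), zero_comp,
      add_zero]
  have τ₂ : lmap W biprod.inr ≫ τ = ψ ≫ lmap W biprod.inl := by
    simp only [hτ, Preadditive.comp_add, reassoc_of% (b₂ W), reassoc_of% (b₄ W), zero_comp,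
      zero_add]
  have hτ' : τ ≫ lmap W biprod.snd = lmap W biprod.fst ≫ φ := by
    simp only [hτ, Preadditive.add_comp, Category.assoc, b₂ W, b₃ W, comp_zero, add_zero,
      zero_add, Category.comp_id]
  have hττ : τ ≫ τ = 𝟙 _ := by
    conv_lhs => enter [1]; rw [hτ]
    simp only [Preadditive.add_comp, Category.assoc, τ₁, τ₂, Preadditive.comp_add,
      Preadditive.sub_comp, Preadditive.comp_sub, Category.id_comp, reassoc_of% hφψ,
      reassoc_of% hψφ, reassoc_of% hφ, reassoc_of% hψ, reassoc_of% heW]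
    rw [← b₅ W]
    abel
  have : IsIso τ := ⟨τ, hττ, hττ⟩
  obtain ⟨c, k, m, n, hk, hmn, hkm⟩ := exists_glued_object h₁ h₂ hU k₁ k₂ hW τ
  have hmnW : lres k₂ m ≫ lres k₂ n = 𝟙 _ := by rw [← lres_comp, hmn, lres_id]
  have hk' : lres k₁ k ≫ lres k₁ (inv k) = 𝟙 _ := by rw [← lres_comp, IsIso.hom_inv_id, lres_id]
  have hkn : lres k₁ k ≫ lres k₂ n = τ := by
    rw [← hkm, Category.assoc, hmnW, Category.comp_id]
  have hn : lres k₂ n = lres k₁ (inv k) ≫ τ := by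
    rw [← cancel_epi (lres k₁ k), hkn, reassoc_of% hk']
  have hinl : lres k₁ e ≫ lmap W biprod.inl ≫ lres k₁ k =
      φ ≫ lmap W biprod.inr ≫ lres k₂ m := by
    rw [← hkm, reassoc_of% τ₁]
    simp only [Preadditive.add_comp, Preadditive.comp_add, Preadditive.sub_comp,
      Preadditive.comp_sub, Category.assoc, Category.id_comp, reassoc_of% hφ, reassoc_of% heW]
    abel
  -- The idempotent cuts out the image of `e` over `U₁` and `B` over `U₂`; the two agree over `W`
  -- because `τ` exchanges these summands.
  obtain ⟨ε, hε, hε₁, hε₂⟩ := exists_idempotent_lift h₁ h₂ hU k₁ k₂ hW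
    (inv k ≫ lmap U₁ biprod.fst ≫ e ≫ lmap U₁ biprod.inl ≫ k)
    (n ≫ lmap U₂ biprod.snd ≫ lmap U₂ biprod.inr ≫ m)
    (by simp only [Category.assoc, IsIso.hom_inv_id_assoc, reassoc_of% (b₁ U₁), reassoc_of% he])
    (by simp only [Category.assoc, reassoc_of% hmn, reassoc_of% (b₂ U₂)])
    (by
      simp only [lres_comp, lres_lmap]
      rw [hinl, hn, Category.assoc, reassoc_of% hτ'])
  refine ⟨c, ε, inv k ≫ lmap U₁ biprod.fst ≫ e, e ≫ lmap U₁ biprod.inl ≫ k,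
    n ≫ lmap U₂ biprod.snd, lmap U₂ biprod.inr ≫ m, hε, ?_, ?_, ?_, ?_, ?_⟩
  · simp only [Category.assoc, IsIso.hom_inv_id_assoc, reassoc_of% (b₁ U₁), he]
  · simp only [Category.assoc, reassoc_of% he, hε₁]
  · simp only [Category.assoc, reassoc_of% hmn, b₂ U₂]
  · simp only [Category.assoc, hε₂]
  · simp only [lres_comp, lres_lmap, Category.assoc, hn, hτ', hφ]

end ObjectGluing

end TTCat

namespace TTCat

/-! ### Morphisms between objects that are locally the unit -/

section Vanishing

variable {K : Type u} [Category.{v} K] [Preadditive K] [HasZeroObject K] [HasShift K ℤ]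
  [∀ n : ℤ, (shiftFunctor K n).Additive] [Pretriangulated K] [MonoidalCategory K]

/-- The endomorphism `e` of `a` in `L(U)` factors through the unit. -/
def FactorsThroughUnit (U : CompactOpens (Spc K)) {a : K} (e : LHom U a a) : Prop :=
  ∃ (f : LHom U a (𝟙_ K)) (g : LHom U (𝟙_ K) a), f ≫ g = e

lemma FactorsThroughUnit.lres {U V : CompactOpens (Spc K)} (h : U ≤ V) {a : K} {e : LHom V a a}
    (he : FactorsThroughUnit V e) : FactorsThroughUnit U (lres h e) := by
  obtain ⟨f, g, rfl⟩ := he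
  exact ⟨TTCat.lres h f, TTCat.lres h g, (lres_comp _ _ _).symm⟩

lemma factorsThroughUnit_id (U : CompactOpens (Spc K)) :
    FactorsThroughUnit U (𝟙 ((locW U).Q.obj (𝟙_ K))) := ⟨𝟙 _, 𝟙 _, Category.id_comp _⟩

variable (K) in
/-- The groups of morphisms from `T 𝟙` to `𝟙` in the localizations `L(U)` vanish. -/
def ShiftUnitVanishing [IsTriangulated K] : Prop :=
  ∀ (U : CompactOpens (Spc K)) (f : LHom U ((𝟙_ K)⟦(1 : ℤ)⟧) (𝟙_ K)), f = 0

variable [IsTriangulated K]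

lemma shiftUnitVanishing_of_subsingleton
    (h : ∀ U : CompactOpens (Spc K), Subsingleton (Mor U ((𝟙_ K)⟦(1 : ℤ)⟧) (𝟙_ K))) :
    ShiftUnitVanishing K := fun U f =>
  congrArg Idempotents.Karoubi.Hom.f ((h U).elim ((Idempotents.toKaroubi (LU U)).map f)
    ((Idempotents.toKaroubi (LU U)).map 0))

variable [SymmetricCategory K] [TensorTriangulated K]

/-- The composite factors through a morphism `T 𝟙 ⊗ 𝟙 ⟶ 𝟙`. This supplies the hypothesis `hvan` of
`comp_eq_zero_of_locally`. -/
lemma ShiftUnitVanishing.comp_eq_zero (hv : ShiftUnitVanishing K) {U : CompactOpens (Spc K)}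
    {a b : K} {e : LHom U a a} {e' : LHom U b b} (he : FactorsThroughUnit U e)
    (he' : FactorsThroughUnit U e') (h : LHom U ((𝟙_ K)⟦(1 : ℤ)⟧ ⊗ a) b) :
    lwhisker _ e ≫ h ≫ e' = 0 := by
  obtain ⟨f, g, rfl⟩ := he
  obtain ⟨f', g', rfl⟩ := he'
  have : lmap U (ρ_ ((𝟙_ K)⟦(1 : ℤ)⟧)).inv ≫ lwhisker _ g ≫ h ≫ f' = 0 := hv _ _
  have h₀ : lwhisker _ g ≫ h ≫ f' = 0 := by
    rwa [← cancel_epi (lmap U (ρ_ ((𝟙_ K)⟦(1 : ℤ)⟧)).inv), comp_zero]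
  rw [lwhisker_comp, Category.assoc, reassoc_of% h₀, zero_comp, comp_zero]

variable [MonoidalClosed K] [StronglyClosed K]

section Family

variable {ι : Type*} {U : ι → CompactOpens (Spc K)}

/-- Induction on the cover, splitting off one member. The overlap lies in that member, where both
idempotents factor through the unit, so the Mayer–Vietoris boundary vanishes. -/
lemma comp_eq_zero_of_forall (hv : ShiftUnitVanishing K) (s : Finset ι) :
    ∀ {V : CompactOpens (Spc K)} (hle : ∀ i ∈ s, U i ≤ V) (_ : ∀ x ∈ V, ∃ i ∈ s, x ∈ U i)
      {a b : K} {e : LHom V a a} {f : LHom V a b} {e' : LHom V b b} (_ : e ≫ e = e)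
      (_ : e' ≫ e' = e') (_ : ∀ i hi, FactorsThroughUnit (U i) (lres (hle i hi) e))
      (_ : ∀ i hi, FactorsThroughUnit (U i) (lres (hle i hi) e'))
      (_ : ∀ i hi, lres (hle i hi) f = 0), e ≫ f ≫ e' = 0 := by
  classical
  induction s using Finset.induction_on with
  | empty =>
    intro V _ hV a b e f e' _ _ _ _ _
    have hz : IsZero ((locW V).Q.obj a) := isZero_Q_obj fun x _ hx => by
      obtain ⟨i, hi, _⟩ := hV x hx
      simp at hi
    exact hz.eq_of_src _ _
  | insert i₀ s hi₀ ih =>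
    intro V hle hV a b e f e' he he' hue hue' hf
    have hs : ∀ i ∈ s, U i ≤ s.sup U := fun i hi => Finset.le_sup hi
    have h₁ : s.sup U ≤ V := Finset.sup_le fun i hi => hle i (Finset.mem_insert_of_mem hi)
    have h₂ : U i₀ ≤ V := hle i₀ (Finset.mem_insert_self _ _)
    have hz : lres h₁ (e ≫ f ≫ e') = 0 := by
      rw [lres_comp, lres_comp]
      refine ih hs (fun x hx => ?_) ?_ ?_ ?_ ?_ ?_
      · have : x ∈ ((s.sup U : CompactOpens (Spc K)) : Set (Spc K)) := hx
        simpa [CompactOpens.coe_finsetSup] using this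
      · rw [← lres_comp, he]
      · rw [← lres_comp, he']
      · intro i hi
        rw [lres_lres]
        exact hue i (Finset.mem_insert_of_mem hi)
      · intro i hi
        rw [lres_lres]
        exact hue' i (Finset.mem_insert_of_mem hi)
      · intro i hi
        rw [lres_lres]
        exact hf i (Finset.mem_insert_of_mem hi)
    have hz₂ : lres h₂ (e ≫ f ≫ e') = 0 := by
      rw [lres_comp, lres_comp, hf i₀ (Finset.mem_insert_self _ _), zero_comp, comp_zero]
    have := comp_eq_zero_of_locally h₁ h₂ (fun x hx => by
        obtain ⟨i, hi, hxi⟩ := hV x hx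
        rcases Finset.mem_insert.1 hi with rfl | hi
        · exact Or.inr hxi
        · exact Or.inl (hs i hi hxi))
      (inf_le_left : s.sup U ⊓ U i₀ ≤ _) inf_le_right (by rw [CompactOpens.coe_inf])
      e (e ≫ f ≫ e') e' hz hz₂ fun h => by
        have k := (inf_le_right : s.sup U ⊓ U i₀ ≤ _)
        have hue₀ := (hue i₀ (Finset.mem_insert_self _ _)).lres k
        have hue₀' := (hue' i₀ (Finset.mem_insert_self _ _)).lres k
        rw [lres_lres] at hue₀ hue₀'
        exact hv.comp_eq_zero hue₀ hue₀' h
    simpa [reassoc_of% he, he'] using this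

/-- Induction on the cover: the morphism glued from `s` must be matched with the one over `U i₀`.
They agree only on pieces of the overlap, which suffices by `comp_eq_zero_of_forall`. -/
lemma exists_glue_family (hv : ShiftUnitVanishing K) (s : Finset ι) :
    ∀ {V : CompactOpens (Spc K)} (hle : ∀ i ∈ s, U i ≤ V) (_ : ∀ x ∈ V, ∃ i ∈ s, x ∈ U i)
      {a b : K} {e : LHom V a a} {e' : LHom V b b} (_ : e ≫ e = e)
      (_ : e' ≫ e' = e') (_ : ∀ i hi, FactorsThroughUnit (U i) (lres (hle i hi) e))
      (_ : ∀ i hi, FactorsThroughUnit (U i) (lres (hle i hi) e'))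
      (f : ∀ i, i ∈ s → LHom (U i) a b)
      (_ : ∀ i hi, lres (hle i hi) e ≫ f i hi ≫ lres (hle i hi) e' = f i hi)
      (_ : ∀ i hi j hj (W : CompactOpens (Spc K)) (h : W ≤ U i) (h' : W ≤ U j),
        lres h (f i hi) = lres h' (f j hj)),
      ∃ g : LHom V a b, e ≫ g ≫ e' = g ∧ ∀ i hi, lres (hle i hi) g = f i hi := by
  classical
  induction s using Finset.induction_on with
  | empty =>
    intro V _ hV a b e e' _ _ _ _ f _ _
    exact ⟨0, by simp, fun i hi => by simp at hi⟩
  | insert i₀ s hi₀ ih =>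
    intro V hle hV a b e e' he he' hue hue' f hf hfc
    have hs : ∀ i ∈ s, U i ≤ s.sup U := fun i hi => Finset.le_sup hi
    have hcov : ∀ x ∈ s.sup U, ∃ i ∈ s, x ∈ U i := fun x hx => by
      have : x ∈ ((s.sup U : CompactOpens (Spc K)) : Set (Spc K)) := hx
      simpa [CompactOpens.coe_finsetSup] using this
    have h₁ : s.sup U ≤ V := Finset.sup_le fun i hi => hle i (Finset.mem_insert_of_mem hi)
    have h₀ : i₀ ∈ insert i₀ s := Finset.mem_insert_self _ _
    have h₂ : U i₀ ≤ V := hle i₀ h₀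
    obtain ⟨g, hg, hgi⟩ := ih hs hcov (e := lres h₁ e) (e' := lres h₁ e')
      (by rw [← lres_comp, he]) (by rw [← lres_comp, he'])
      (fun i hi => by rw [lres_lres]; exact hue i (Finset.mem_insert_of_mem hi))
      (fun i hi => by rw [lres_lres]; exact hue' i (Finset.mem_insert_of_mem hi))
      (fun i hi => f i (Finset.mem_insert_of_mem hi))
      (fun i hi => by rw [lres_lres, lres_lres]; exact hf i (Finset.mem_insert_of_mem hi))
      (fun i hi j hj => hfc i _ j _)
    let W := s.sup U ⊓ U i₀
    have k₁ : W ≤ s.sup U := inf_le_left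
    have k₂ : W ≤ U i₀ := inf_le_right
    have hWV : W ≤ V := k₁.trans h₁
    have hag : lres k₁ g = lres k₂ (f i₀ h₀) := by
      rw [← sub_eq_zero]
      have e₁ : lres hWV e ≫ lres k₁ g ≫ lres hWV e' = lres k₁ g := by
        simpa using congrArg (lres k₁) hg
      have e₂ : lres hWV e ≫ lres k₂ (f i₀ h₀) ≫ lres hWV e' = lres k₂ (f i₀ h₀) := by
        simpa using congrArg (lres k₂) (hf i₀ h₀)
      have := comp_eq_zero_of_forall (U := fun i => U i ⊓ W) hv s (V := W)
        (fun i _ => inf_le_right) (fun x hx => by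
          obtain ⟨i, hi, hxi⟩ := hcov x (k₁ hx)
          exact ⟨i, hi, ⟨hxi, hx⟩⟩) (e := lres hWV e) (e' := lres hWV e')
        (f := lres k₁ g - lres k₂ (f i₀ h₀))
        (by rw [← lres_comp, he]) (by rw [← lres_comp, he'])
        (fun i hi => by
          have := (hue i (Finset.mem_insert_of_mem hi)).lres (inf_le_left : U i ⊓ W ≤ U i)
          rw [lres_lres] at this ⊢
          exact this)
        (fun i hi => by
          have := (hue' i (Finset.mem_insert_of_mem hi)).lres (inf_le_left : U i ⊓ W ≤ U i)
          rw [lres_lres] at this ⊢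
          exact this)
        (fun i hi => by
          rw [lres_sub, sub_eq_zero, lres_lres, lres_lres,
            ← hfc i (Finset.mem_insert_of_mem hi) i₀ h₀ (U i ⊓ W) inf_le_left, ← hgi i hi,
            lres_lres])
      rwa [Preadditive.sub_comp, Preadditive.comp_sub, e₁, e₂] at this
    obtain ⟨g', hg'₁, hg'₂⟩ := exists_glue h₁ h₂ (fun x hx => by
        obtain ⟨i, hi, hxi⟩ := hV x hx
        rcases Finset.mem_insert.1 hi with rfl | hi
        · exact Or.inr hxi
        · exact Or.inl (hs i hi hxi)) k₁ k₂ (by rw [CompactOpens.coe_inf]) g (f i₀ h₀) hag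
    -- The glued `g'` need not respect the idempotents; compressing by them leaves its local values
    -- unchanged.
    refine ⟨e ≫ g' ≫ e', by simp [reassoc_of% he, he'], fun i hi => ?_⟩
    rcases Finset.mem_insert.1 hi with rfl | hi'
    · rw [lres_comp, lres_comp, hg'₂, hf]
    · have : lres h₁ (e ≫ g' ≫ e') = g := by rw [lres_comp, lres_comp, hg'₁, hg]
      rw [← hgi i hi', ← this, lres_lres]

end Family

end Vanishing

end TTCat

namespace TTCat

/-! ### Gluing copies of the unit along a cocycle -/

section UnitGluing

variable {K : Type u} [Category.{v} K] [Preadditive K] [HasZeroObject K] [HasShift K ℤ]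
  [∀ n : ℤ, (shiftFunctor K n).Additive] [Pretriangulated K] [MonoidalCategory K]

/-- A `1`-cocycle of automorphisms of `𝟙` in the localizations `L(W)`. -/
structure UnitCocycle {ι : Type*} (U : ι → CompactOpens (Spc K)) where
  /-- the automorphism over `W ⊆ U j ∩ U i` -/
  mor (j i : ι) (W : CompactOpens (Spc K)) (hj : W ≤ U j) (hi : W ≤ U i) :
    LHom W (𝟙_ K) (𝟙_ K)
  lres_mor (j i : ι) {W W' : CompactOpens (Spc K)} (h : W' ≤ W) (hj : W ≤ U j) (hi : W ≤ U i) :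
    lres h (mor j i W hj hi) = mor j i W' (h.trans hj) (h.trans hi)
  mor_self (i : ι) (W : CompactOpens (Spc K)) (hi : W ≤ U i) : mor i i W hi hi = 𝟙 _
  mor_comp (i j k : ι) (W : CompactOpens (Spc K)) (hi : W ≤ U i) (hj : W ≤ U j) (hk : W ≤ U k) :
    mor j i W hj hi ≫ mor k j W hk hj = mor k i W hk hi

attribute [simp] UnitCocycle.lres_mor UnitCocycle.mor_self UnitCocycle.mor_comp

variable {ι : Type*} {U : ι → CompactOpens (Spc K)}

@[simp]
lemma UnitCocycle.mor_comp_assoc (σ : UnitCocycle U) (i j k : ι) (W : CompactOpens (Spc K))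
    (hi : W ≤ U i) (hj : W ≤ U j) (hk : W ≤ U k) {a : K} (f : LHom W (𝟙_ K) a) :
    σ.mor j i W hj hi ≫ σ.mor k j W hk hj ≫ f = σ.mor k i W hk hi ≫ f := by
  rw [← Category.assoc, σ.mor_comp]

/-- Over `V`, the image of the idempotent `e` is a gluing of copies of `𝟙` along `σ` for the
members of the family with index in `s`. -/
structure PartialGluing (σ : UnitCocycle U) (s : Finset ι) (V : CompactOpens (Spc K))
    (hle : ∀ i ∈ s, U i ≤ V) where
  /-- the object -/
  obj : K
  /-- the idempotent -/
  idem : LHom V obj obj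
  /-- the projection to the unit -/
  hom (i : ι) (hi : i ∈ s) : LHom (U i) obj (𝟙_ K)
  /-- the inclusion of the unit -/
  inv (i : ι) (hi : i ∈ s) : LHom (U i) (𝟙_ K) obj
  idem_comp_idem : idem ≫ idem = idem
  inv_comp_hom (i : ι) (hi : i ∈ s) : inv i hi ≫ hom i hi = 𝟙 _
  hom_comp_inv (i : ι) (hi : i ∈ s) : hom i hi ≫ inv i hi = lres (hle i hi) idem
  hom_comp_mor (i : ι) (hi : i ∈ s) (j : ι) (hj : j ∈ s) (W : CompactOpens (Spc K)) (h : W ≤ U i)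
    (h' : W ≤ U j) : lres h (hom i hi) ≫ σ.mor j i W h' h = lres h' (hom j hj)

attribute [simp] PartialGluing.inv_comp_hom

namespace PartialGluing

variable {σ : UnitCocycle U} {s : Finset ι} {V : CompactOpens (Spc K)} {hle : ∀ i ∈ s, U i ≤ V}
  (P : PartialGluing σ s V hle)

lemma mor_comp_inv (i : ι) (hi : i ∈ s) (j : ι) (hj : j ∈ s) (W : CompactOpens (Spc K))
    (h : W ≤ U i) (h' : W ≤ U j) :
    σ.mor j i W h' h ≫ lres h' (P.inv j hj) = lres h (P.inv i hi) := by
  have h₁ : lres h (P.inv i hi) ≫ lres h (P.hom i hi) = 𝟙 _ := by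
    rw [← lres_comp, P.inv_comp_hom, lres_id]
  have h₂ : lres h' (P.hom j hj) ≫ lres h' (P.inv j hj) = lres (h.trans (hle i hi)) P.idem := by
    rw [← lres_comp, P.hom_comp_inv, lres_lres]
  calc _ = lres h (P.inv i hi) ≫ lres h (P.hom i hi) ≫ σ.mor j i W h' h ≫
      lres h' (P.inv j hj) := by rw [reassoc_of% h₁]
    _ = lres h (P.inv i hi) ≫ lres (h.trans (hle i hi)) P.idem := by
      rw [← h₂, ← P.hom_comp_mor i hi j hj W h h', Category.assoc]
    _ = _ := by
      rw [← lres_lres h (hle i hi), ← P.hom_comp_inv i hi, ← lres_comp, reassoc_of% P.inv_comp_hom i hi]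

lemma factorsThroughUnit (i : ι) (hi : i ∈ s) :
    FactorsThroughUnit (U i) (lres (hle i hi) P.idem) :=
  ⟨_, _, P.hom_comp_inv i hi⟩

end PartialGluing

variable [IsTriangulated K] [SymmetricCategory K] [TensorTriangulated K]
  [MonoidalClosed K] [StronglyClosed K]

/-- Over `W ⊆ V`, the image of the idempotent of a partial gluing is isomorphic to `𝟙` if `W` is
contained in a member of the family. -/
lemma PartialGluing.exists_iso_unit (hv : ShiftUnitVanishing K) {σ : UnitCocycle U} {s : Finset ι}
    {V : CompactOpens (Spc K)} {hle : ∀ i ∈ s, U i ≤ V} (P : PartialGluing σ s V hle)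
    (hV : ∀ x ∈ V, ∃ i ∈ s, x ∈ U i) {W : CompactOpens (Spc K)} (k : W ≤ V) (i₀ : ι)
    (k₀ : W ≤ U i₀) :
    ∃ (φ : LHom W P.obj (𝟙_ K)) (ψ : LHom W (𝟙_ K) P.obj), φ ≫ ψ = lres k P.idem ∧ ψ ≫ φ = 𝟙 _ ∧
      ∀ i hi (W' : CompactOpens (Spc K)) (h : W' ≤ W) (h' : W' ≤ U i),
        lres h φ = lres h' (P.hom i hi) ≫ σ.mor i₀ i W' (h.trans k₀) h' := by
  have hcov : ∀ x ∈ W, ∃ i ∈ s, x ∈ U i ⊓ W := fun x hx => by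
    obtain ⟨i, hi, hxi⟩ := hV x (k hx)
    exact ⟨i, hi, ⟨hxi, hx⟩⟩
  have he : lres k P.idem ≫ lres k P.idem = lres k P.idem := by
    rw [← lres_comp, P.idem_comp_idem]
  have hu : ∀ i hi, FactorsThroughUnit (U i ⊓ W) (lres (inf_le_right : U i ⊓ W ≤ W)
      (lres k P.idem)) := fun i hi => by
    have := (P.factorsThroughUnit i hi).lres (inf_le_left : U i ⊓ W ≤ U i)
    rw [lres_lres] at this ⊢
    exact this
  have hu₀ : ∀ i ∈ s, FactorsThroughUnit (U i ⊓ W) (lres (inf_le_right : U i ⊓ W ≤ W)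
      (𝟙 ((locW W).Q.obj (𝟙_ K)))) := fun i _ => by
    rw [lres_id]
    exact factorsThroughUnit_id _
  have hei : ∀ i hi (W' : CompactOpens (Spc K)) (h : W' ≤ W) (h' : W' ≤ U i),
      lres (h.trans k) P.idem = lres h' (P.hom i hi) ≫ lres h' (P.inv i hi) := fun i hi W' h h' => by
    rw [← lres_comp, P.hom_comp_inv, lres_lres]
  have hge : ∀ i hi (W' : CompactOpens (Spc K)) (h : W' ≤ U i),
      lres h (P.inv i hi) ≫ lres h (P.hom i hi) = 𝟙 _ := fun i hi W' h => by
    rw [← lres_comp, P.inv_comp_hom, lres_id]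
  -- Over `U i ⊓ W` the `i`-th projection is followed by the transition to the index `i₀`; the
  -- cocycle condition makes these agree, and `ψ` is the inverse construction.
  obtain ⟨φ, hφ, hφi⟩ := exists_glue_family (U := fun i => U i ⊓ W) hv s (V := W)
    (fun i _ => inf_le_right) hcov (e := lres k P.idem) (e' := 𝟙 _) he (Category.id_comp _) hu hu₀
    (fun i hi => lres inf_le_left (P.hom i hi) ≫ σ.mor i₀ i _ (inf_le_right.trans k₀) inf_le_left)
    (fun i hi => by
      rw [lres_lres, hei i hi _ inf_le_right inf_le_left, lres_id]
      simp [reassoc_of% hge i hi])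
    (fun i hi j hj W' h h' => by
      simp only [lres_comp, lres_lres, UnitCocycle.lres_mor]
      rw [← P.hom_comp_mor i hi j hj W' (h.trans inf_le_left) (h'.trans inf_le_left),
        Category.assoc, σ.mor_comp])
  obtain ⟨ψ, hψ, hψi⟩ := exists_glue_family (U := fun i => U i ⊓ W) hv s (V := W)
    (fun i _ => inf_le_right) hcov (e := 𝟙 _) (e' := lres k P.idem) (Category.id_comp _) he hu₀ hu
    (fun i hi => σ.mor i i₀ _ inf_le_left (inf_le_right.trans k₀) ≫ lres inf_le_left (P.inv i hi))
    (fun i hi => by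
      rw [lres_lres, hei i hi _ inf_le_right inf_le_left, lres_id]
      simp [reassoc_of% hge i hi])
    (fun i hi j hj W' h h' => by
      simp only [lres_comp, lres_lres, UnitCocycle.lres_mor]
      rw [← P.mor_comp_inv i hi j hj W' (h.trans inf_le_left) (h'.trans inf_le_left),
        σ.mor_comp_assoc])
  rw [Category.comp_id] at hφ
  rw [Category.id_comp] at hψ
  refine ⟨φ, ψ, ?_, ?_, fun i hi W' h h' => ?_⟩
  · rw [← sub_eq_zero]
    have := comp_eq_zero_of_forall (U := fun i => U i ⊓ W) hv s (V := W)
      (fun i _ => inf_le_right) hcov (f := φ ≫ ψ - lres k P.idem) he he hu hu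
      (fun i hi => by
        rw [lres_sub, sub_eq_zero, lres_comp, hφi i hi, hψi i hi, lres_lres,
          hei i hi _ inf_le_right inf_le_left, Category.assoc, σ.mor_comp_assoc, σ.mor_self,
          Category.id_comp])
    rw [Preadditive.sub_comp, Preadditive.comp_sub, Category.assoc, hψ, he, he] at this
    rwa [reassoc_of% hφ] at this
  · rw [← sub_eq_zero]
    have := comp_eq_zero_of_forall (U := fun i => U i ⊓ W) hv s (V := W)
      (fun i _ => inf_le_right) hcov (f := ψ ≫ φ - 𝟙 _) (Category.id_comp _)
      (Category.id_comp _) hu₀ hu₀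
      (fun i hi => by
        rw [lres_sub, sub_eq_zero, lres_comp, hφi i hi, hψi i hi, Category.assoc,
          reassoc_of% hge i hi, σ.mor_comp, σ.mor_self, lres_id])
    rwa [Category.id_comp, Category.comp_id] at this
  · have := congrArg (lres (le_inf h' h)) (hφi i hi)
    rw [lres_lres] at this
    rw [this]
    simp

open Classical in
/-- Finitely many copies of `𝟙` can be glued along a cocycle. -/
theorem nonempty_partialGluing (hv : ShiftUnitVanishing K) (σ : UnitCocycle U) (s : Finset ι) :
    ∀ (V : CompactOpens (Spc K)) (hle : ∀ i ∈ s, U i ≤ V) (_ : ∀ x ∈ V, ∃ i ∈ s, x ∈ U i),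
      Nonempty (PartialGluing σ s V hle) := by
  induction s using Finset.induction_on with
  | empty =>
    intro V _ _
    exact ⟨⟨𝟙_ K, 𝟙 _, fun i hi => by simp at hi, fun i hi => by simp at hi, Category.id_comp _,
      fun i hi => by simp at hi, fun i hi => by simp at hi, fun i hi => by simp at hi⟩⟩
  | insert i₀ s hi₀ ih =>
    intro V hle hV
    have hs : ∀ i ∈ s, U i ≤ s.sup U := fun i hi => Finset.le_sup hi
    have hcov : ∀ x ∈ s.sup U, ∃ i ∈ s, x ∈ U i := fun x hx => by
      have : x ∈ ((s.sup U : CompactOpens (Spc K)) : Set (Spc K)) := hx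
      simpa [CompactOpens.coe_finsetSup] using this
    have h₁ : s.sup U ≤ V := Finset.sup_le fun i hi => hle i (Finset.mem_insert_of_mem hi)
    have h₂ : U i₀ ≤ V := hle i₀ (Finset.mem_insert_self _ _)
    obtain ⟨P⟩ := ih (s.sup U) hs hcov
    -- On the overlap with `U i₀` the gluing obtained so far is identified with `𝟙` in the `i₀`-th
    -- chart, and the new copy of `𝟙` is attached along this isomorphism.
    obtain ⟨φ, ψ, hφψ, hψφ, hφ⟩ := P.exists_iso_unit hv hcov
      (inf_le_left : s.sup U ⊓ U i₀ ≤ _) i₀ inf_le_right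
    obtain ⟨c, ε, p₁, q₁, p₂, q₂, hε, hqp₁, hpq₁, hqp₂, hpq₂, hp⟩ :=
      exists_glued_idempotent h₁ h₂ (fun x hx => by
        obtain ⟨i, hi, hxi⟩ := hV x hx
        rcases Finset.mem_insert.1 hi with rfl | hi
        · exact Or.inr hxi
        · exact Or.inl (hs i hi hxi)) (inf_le_left : s.sup U ⊓ U i₀ ≤ _) inf_le_right
        (by rw [CompactOpens.coe_inf]) P.idem P.idem_comp_idem φ ψ hφψ hψφ
    have hmem : ∀ i ∈ insert i₀ s, i ≠ i₀ → i ∈ s := fun i hi h =>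
      (Finset.mem_insert.1 hi).resolve_left h
    have hpφ : ∀ i (hi : i ∈ s) (W' : CompactOpens (Spc K)) (h : W' ≤ U i) (h' : W' ≤ U i₀),
        lres (h.trans (hs i hi)) p₁ ≫ lres h (P.hom i hi) ≫ σ.mor i₀ i W' h' h = lres h' p₂ :=
      fun i hi W' h h' => by
        have := congrArg (lres (le_inf (h.trans (hs i hi)) h')) hp
        rwa [lres_comp, lres_lres, lres_lres, hφ i hi W' _ h] at this
    refine ⟨⟨c, ε, fun i hi => if h : i = i₀ then lres (U := U i) (by rw [h]) p₂ else
        lres (hs i (hmem i hi h)) p₁ ≫ P.hom i (hmem i hi h),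
      fun i hi => if h : i = i₀ then lres (U := U i) (by rw [h]) q₂ else
        P.inv i (hmem i hi h) ≫ lres (hs i (hmem i hi h)) q₁, hε, ?_, ?_, ?_⟩⟩
    · intro i hi
      by_cases h : i = i₀
      · subst h
        simpa using hqp₂
      · simp only [h, ↓reduceDIte, Category.assoc]
        rw [← reassoc_of% lres_comp (hs i (hmem i hi h)) q₁ p₁, hqp₁,
          ← P.hom_comp_inv i (hmem i hi h), Category.assoc, P.inv_comp_hom, Category.comp_id,
          P.inv_comp_hom]
    · intro i hi
      by_cases h : i = i₀
      · subst h
        simpa using hpq₂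
      · simp only [h, ↓reduceDIte, Category.assoc]
        rw [reassoc_of% P.hom_comp_inv i (hmem i hi h), ← hqp₁, ← lres_comp, ← lres_comp,
          Category.assoc, hpq₁, reassoc_of% hpq₁, ← lres_comp, hε, lres_lres]
    · intro i hi j hj W h h'
      by_cases hi₁ : i = i₀
      · by_cases hj₁ : j = i₀
        · subst hi₁
          subst hj₁
          simp
        · subst hi₁
          have := hpφ j (hmem j hj hj₁) W h' h
          simp [hj₁, ← this]
      · by_cases hj₁ : j = i₀
        · subst hj₁
          have := hpφ i (hmem i hi hi₁) W h h'
          simp [hi₁, ← this]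
        · have := P.hom_comp_mor i (hmem i hi hi₁) j (hmem j hj hj₁) W h h'
          simp [hi₁, hj₁, this]

lemma isZero_of_supportedOn_top {z : K}
    (hz : supportedOn (((⊤ : CompactOpens (Spc K)) : Set (Spc K))ᶜ) z) : IsZero z :=
  isZero_of_supp_eq_empty (Set.eq_empty_of_forall_notMem fun x hx => hz hx (Set.mem_univ x))

lemma isIso_of_locW_top {a b : K} {t : a ⟶ b} (ht : locW ⊤ t) : IsIso t := by
  obtain ⟨z, p, q, hT, hz⟩ := ht
  exact (Pretriangulated.Triangle.isZero₃_iff_isIso₁ _ hT).1 (isZero_of_supportedOn_top hz)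

/-- An object with empty support is zero, so over the whole spectrum only isomorphisms are inverted.
-/
lemma lmap_top_bijective (a b : K) :
    Function.Bijective (lmap (⊤ : CompactOpens (Spc K)) : (a ⟶ b) → _) := by
  constructor
  · intro f g hfg
    obtain ⟨z, hz, p, q, h⟩ := exists_factor_of_lmap_eq_zero (U := ⊤) (f - g) (by
      rw [← sub_eq_zero] at hfg
      rw [← hfg]
      exact (locW (⊤ : CompactOpens (Spc K))).Q.map_sub)
    rw [← sub_eq_zero, h, (isZero_of_supportedOn_top hz).eq_of_tgt p 0, zero_comp]
  · intro f
    obtain ⟨a', t, ht, g, h⟩ := exists_fraction f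
    have := isIso_of_locW_top ht
    refine ⟨inv t ≫ g, ?_⟩
    rw [← cancel_epi (lmap ⊤ t), h, ← lmap_comp, IsIso.hom_inv_id_assoc]

/-- Copies of `𝟙` can be glued to an object of `K` along a cocycle for a finite cover. -/
theorem UnitCocycle.exists_gluing [IsIdempotentComplete K] (hv : ShiftUnitVanishing K) [Finite ι]
    (hU : ∀ x : Spc K, ∃ i, x ∈ U i) (σ : UnitCocycle U) :
    ∃ (a : K) (f : ∀ i, LHom (U i) a (𝟙_ K)), (∀ i, IsIso (f i)) ∧
      ∀ (i j : ι) (W : CompactOpens (Spc K)) (h : W ≤ U i) (h' : W ≤ U j),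
        lres h (f i) ≫ σ.mor j i W h' h = lres h' (f j) := by
  have := Fintype.ofFinite ι
  obtain ⟨P⟩ := nonempty_partialGluing hv σ Finset.univ ⊤ (fun _ _ => le_top) fun x _ => by
    simpa using hU x
  -- The global idempotent comes from `K`, where idempotents split; this is the only splitting
  -- needed.
  obtain ⟨e, he⟩ := (lmap_top_bijective P.obj P.obj).2 P.idem
  obtain ⟨a, p, q, hpq, hqp⟩ := IsIdempotentComplete.idempotents_split P.obj e <|
    (lmap_top_bijective P.obj P.obj).1 (by rw [lmap_comp, he, P.idem_comp_idem])
  have hei : ∀ i, lmap (U i) e = P.hom i (Finset.mem_univ i) ≫ P.inv i (Finset.mem_univ i) :=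
    fun i => by rw [P.hom_comp_inv, ← he, lres_lmap]
  refine ⟨a, fun i => lmap (U i) p ≫ P.hom i (Finset.mem_univ i), fun i =>
    ⟨P.inv i (Finset.mem_univ i) ≫ lmap (U i) q, ?_, ?_⟩, fun i j W h h' => ?_⟩
  · rw [Category.assoc, ← reassoc_of% hei i, ← lmap_comp, ← lmap_comp, ← hqp,
      Category.assoc, hpq, Category.comp_id, hpq, lmap_id]
  · rw [Category.assoc, ← lmap_comp_assoc, hqp, hei, Category.assoc, P.inv_comp_hom,
      Category.comp_id, P.inv_comp_hom]
  · rw [lres_comp, lres_lmap, Category.assoc, P.hom_comp_mor i _ j (Finset.mem_univ j) W h h',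
      lres_comp, lres_lmap]

/-- Morphisms between objects which are locally isomorphic to `𝟙` can be glued uniquely. -/
theorem existsUnique_glue (hv : ShiftUnitVanishing K) [Finite ι]
    {V : CompactOpens (Spc K)} (hle : ∀ i, U i ≤ V) (hV : ∀ x ∈ V, ∃ i, x ∈ U i) {a b : K}
    (f : ∀ i, LHom (U i) a (𝟙_ K)) (g : ∀ i, LHom (U i) b (𝟙_ K)) [∀ i, IsIso (f i)]
    [∀ i, IsIso (g i)] (k : ∀ i, LHom (U i) a b)
    (hk : ∀ (i j : ι) (W : CompactOpens (Spc K)) (h : W ≤ U i) (h' : W ≤ U j),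
      lres h (k i) = lres h' (k j)) :
    ∃! l : LHom V a b, ∀ i, lres (hle i) l = k i := by
  have := Fintype.ofFinite ι
  have hcov : ∀ x ∈ V, ∃ i ∈ Finset.univ, x ∈ U i := fun x hx => by simpa using hV x hx
  have hf : ∀ i, FactorsThroughUnit (U i) (lres (hle i) (𝟙 ((locW V).Q.obj a))) := fun i =>
    ⟨f i, inv (f i), by simp⟩
  have hg : ∀ i, FactorsThroughUnit (U i) (lres (hle i) (𝟙 ((locW V).Q.obj b))) := fun i =>
    ⟨g i, inv (g i), by simp⟩
  obtain ⟨l, -, hl⟩ := exists_glue_family hv Finset.univ (fun i _ => hle i) hcov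
    (Category.comp_id _) (Category.comp_id _) (fun i _ => hf i) (fun i _ => hg i)
    (fun i _ => k i) (fun i _ => by simp) (fun i _ j _ W h h' => hk i j W h h')
  refine ⟨l, fun i => hl i (Finset.mem_univ i), fun l' hl' => ?_⟩
  have := comp_eq_zero_of_forall hv Finset.univ (fun i _ => hle i) hcov (f := l' - l)
    (Category.comp_id _) (Category.comp_id _) (fun i _ => hf i) (fun i _ => hg i)
    (fun i hi => by rw [lres_sub, hl i hi, hl' i, sub_self])
  rwa [Category.comp_id, Category.id_comp, sub_eq_zero] at this

end UnitGluing

end TTCat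

namespace TTCat

/-! ### The sheaf of units -/

section GmSheaf

variable {K : Type u} [Category.{v} K] [Preadditive K] [HasZeroObject K] [HasShift K ℤ]
  [∀ n : ℤ, (shiftFunctor K n).Additive] [Pretriangulated K] [MonoidalCategory K]

/-- The automorphism of `𝟙` in `L(U)` underlying an element of `𝔾ₘ(K(U))`. -/
def Gm.mor {U : CompactOpens (Spc K)} (x : Gm U) : LHom U (𝟙_ K) (𝟙_ K) := x.hom.f

lemma Gm.mor_injective {U : CompactOpens (Spc K)} {x y : Gm U} (h : x.mor = y.mor) : x = y :=
  Gm.ext (Idempotents.Karoubi.hom_ext _ _ h)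

/-- A morphism of `L(U)` as a morphism of `K(U)`. -/
noncomputable def toMor {U : CompactOpens (Spc K)} {a b : K} (f : LHom U a b) : Mor U a b :=
  (Idempotents.toKaroubi (LU U)).map f

/-- The element of `𝔾ₘ(K(U))` given by an automorphism of `𝟙` in `L(U)`. -/
noncomputable def Gm.ofIso {U : CompactOpens (Spc K)} (f : LHom U (𝟙_ K) (𝟙_ K)) [IsIso f] :
    Gm U :=
  Units.mk (α := End ((ρ U).obj (𝟙_ K))) (toMor f) (toMor (inv f))
    (by
      change toMor (inv f) ≫ toMor f = 𝟙 _
      refine Idempotents.Karoubi.hom_ext _ _ ?_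
      exact IsIso.inv_hom_id f)
    (by
      change toMor f ≫ toMor (inv f) = 𝟙 _
      refine Idempotents.Karoubi.hom_ext _ _ ?_
      exact IsIso.hom_inv_id f)

@[simp]
lemma Gm.mor_ofIso {U : CompactOpens (Spc K)} (f : LHom U (𝟙_ K) (𝟙_ K)) [IsIso f] :
    (Gm.ofIso f).mor = f := rfl

variable [IsTriangulated K] [SymmetricCategory K] [TensorTriangulated K]

lemma Gm.mor_mul {U : CompactOpens (Spc K)} (x y : Gm U) : (x * y).mor = x.mor ≫ y.mor := by
  rw [mul_comm]
  rfl

@[simp]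
lemma Gm.mor_one (U : CompactOpens (Spc K)) : (1 : Gm U).mor = 𝟙 _ := rfl

@[simp]
lemma Gm.mor_res {U V : CompactOpens (Spc K)} (h : U ≤ V) (x : Gm V) :
    (resGm h x).mor = lres h x.mor :=
  resMor_f h x.hom

@[simp]
lemma resGm_res {U V W : CompactOpens (Spc K)} (h : U ≤ V) (h' : V ≤ W) (x : Gm W) :
    resGm h (resGm h' x) = resGm (h.trans h') x :=
  Gm.mor_injective (by simp)

instance {U : CompactOpens (Spc K)} (x : Gm U) : IsIso x.mor :=
  ⟨x⁻¹.mor, by rw [← Gm.mor_mul, mul_inv_cancel, Gm.mor_one],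
    by rw [← Gm.mor_mul, inv_mul_cancel, Gm.mor_one]⟩

variable [MonoidalClosed K] [StronglyClosed K]

/-- The groups `𝔾ₘ(K(U))` satisfy the sheaf condition for finite covers. -/
lemma existsUnique_glue_gm (hv : ShiftUnitVanishing K) {ι : Type*} [Finite ι]
    {U : ι → CompactOpens (Spc K)} {V : CompactOpens (Spc K)} (hle : ∀ i, U i ≤ V)
    (hV : ∀ x ∈ V, ∃ i, x ∈ U i) (x : ∀ i, Gm (U i))
    (hx : ∀ (i j : ι) (W : CompactOpens (Spc K)) (h : W ≤ U i) (h' : W ≤ U j),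
      resGm h (x i) = resGm h' (x j)) :
    ∃! y : Gm V, ∀ i, resGm (hle i) y = x i := by
  -- The family and its inverses are glued separately; uniqueness for the constant family `1` shows
  -- that the results are mutually inverse.
  have hglue (x : ∀ i, Gm (U i)) (hx : ∀ (i j : ι) (W : CompactOpens (Spc K)) (h : W ≤ U i)
      (h' : W ≤ U j), resGm h (x i) = resGm h' (x j)) :=
    existsUnique_glue hv hle hV (a := 𝟙_ K) (b := 𝟙_ K) (fun _ => 𝟙 _) (fun _ => 𝟙 _)
      (fun i => (x i).mor) fun i j W h h' => by
        rw [← Gm.mor_res, ← Gm.mor_res, hx i j W h h']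
  obtain ⟨f, hf, hf'⟩ := hglue x hx
  obtain ⟨g, hg, -⟩ := hglue (fun i => (x i)⁻¹) fun i j W h h' => by
    rw [map_inv, map_inv, hx i j W h h']
  obtain ⟨_, -, h₁⟩ := hglue (fun _ => 1) fun _ _ _ _ _ => by simp
  have hfg : f ≫ g = 𝟙 _ := (h₁ _ fun i => by
    rw [lres_comp, hf, hg, ← Gm.mor_mul, mul_inv_cancel]).trans (h₁ _ fun i => by simp).symm
  have hgf : g ≫ f = 𝟙 _ := (h₁ _ fun i => by
    rw [lres_comp, hf, hg, ← Gm.mor_mul, inv_mul_cancel]).trans (h₁ _ fun i => by simp).symm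
  have : IsIso f := ⟨g, hfg, hgf⟩
  exact ⟨Gm.ofIso f, fun i => Gm.mor_injective (by simp [hf]), fun y hy =>
    Gm.mor_injective (hf' _ fun i => by rw [← Gm.mor_res, hy])⟩

instance : (compactOpensToOpens K).Full where
  map_surjective f := ⟨homOfLE (leOfHom f), Subsingleton.elim _ _⟩

instance : (compactOpensToOpens K).Faithful where
  map_injective _ := Subsingleton.elim _ _

instance : (compactOpensToOpens K).IsCoverDense
    (Opens.grothendieckTopology (TopCat.of (Spc K))) := by
  rw [TopCat.Opens.coverDense_iff_isBasis, Opens.isBasis_iff_nbhd]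
  intro U x hx
  obtain ⟨V, ⟨hVo, hVc⟩, hxV, hVU⟩ :=
    (PrespectralSpace.isTopologicalBasis (X := Spc K)).exists_subset_of_mem_open hx U.2
  exact ⟨⟨V, hVo⟩, ⟨⟨⟨V, hVc⟩, hVo⟩, rfl⟩, hxV, hVU⟩

variable (K) in
/-- The Grothendieck topology on the quasi-compact open subsets of the spectrum. -/
abbrev compactOpensTopology : GrothendieckTopology (CompactOpens (Spc K)) :=
  (compactOpensToOpens K).inducedTopology (Opens.grothendieckTopology (TopCat.of (Spc K)))

lemma exists_mem_of_mem_compactOpensTopology {V : CompactOpens (Spc K)} {S : Sieve V}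
    (hS : S ∈ compactOpensTopology K V) (x : Spc K) (hx : x ∈ V) :
    ∃ (U : CompactOpens (Spc K)) (h : U ≤ V), S (homOfLE h) ∧ x ∈ U := by
  obtain ⟨W, f, ⟨U, g, h, hg, rfl⟩, hxW⟩ :=
    (Functor.mem_inducedTopology_iff_of_isCoverDense _ _ S).1 hS x hx
  exact ⟨U, leOfHom g, hg, leOfHom h hxW⟩

/-- Quasi-compactness reduces an arbitrary covering sieve to a finite cover; the values on the other
members of the sieve are then forced by separatedness. -/
theorem isSheaf_gmPresheaf (hv : ShiftUnitVanishing K) :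
    Presheaf.IsSheaf (compactOpensTopology K) (gmPresheaf K) := by
  refine Presheaf.isSheaf_of_isSheaf_comp _ _ (forget CommGrpCat.{max u v}) ?_
  rw [isSheaf_iff_isSheaf_of_type]
  intro V S hS x hx
  let ι₀ := {U : CompactOpens (Spc K) // ∃ h : U ≤ V, S (homOfLE h)}
  obtain ⟨t, ht⟩ := V.isCompact.elim_finite_subcover (fun U : ι₀ => (U.1 : Set (Spc K)))
    (fun U => U.1.isOpen) fun y hy => by
      obtain ⟨U, h, hU, hyU⟩ := exists_mem_of_mem_compactOpensTopology hS y hy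
      exact Set.mem_iUnion.2 ⟨⟨U, h, hU⟩, hyU⟩
  have hcov : ∀ y ∈ V, ∃ U : t, y ∈ U.1.1 := fun y hy => by
    have := ht hy
    simp only [Set.mem_iUnion] at this
    obtain ⟨U, hU, hy⟩ := this
    exact ⟨⟨U, hU⟩, hy⟩
  have hres {U₁ U₂ W : CompactOpens (Spc K)} (h₁ : U₁ ≤ V) (h₂ : U₂ ≤ V) (hU₁ : S (homOfLE h₁))
      (hU₂ : S (homOfLE h₂)) (k₁ : W ≤ U₁) (k₂ : W ≤ U₂) :
      resGm k₁ (x _ hU₁ : Gm U₁) = resGm k₂ (x _ hU₂ : Gm U₂) :=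
    hx (homOfLE k₁) (homOfLE k₂) hU₁ hU₂ (Subsingleton.elim _ _)
  obtain ⟨y, hy, hy'⟩ := existsUnique_glue_gm hv (U := fun U : t => U.1.1) (fun U => U.1.2.1)
    hcov (fun U => (x _ U.1.2.2 : Gm U.1.1)) fun U₁ U₂ W k₁ k₂ => hres _ _ _ _ k₁ k₂
  refine ⟨y, fun W f hf => ?_, fun z hz => hy' z fun U => hz _ U.1.2.2⟩
  have hW : W ≤ V := leOfHom f
  change resGm hW y = (x (homOfLE hW) hf : Gm W)
  refine (existsUnique_glue_gm hv (U := fun U : t => U.1.1 ⊓ W) (V := W) (fun _ => inf_le_right)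
    (fun y hy => ?_) (fun U => resGm (inf_le_right.trans hW) y) fun U₁ U₂ W' k₁ k₂ => by
      simp).unique (fun U => by simp) fun U => ?_
  · obtain ⟨U, hU⟩ := hcov y (hW hy)
    exact ⟨U, hU, hy⟩
  · rw [hres hW U.1.2.1 hf U.1.2.2 inf_le_right inf_le_left, ← hy U, resGm_res]

/-- The functor from sheaves on the spectrum to sheaves on the quasi-compact open subsets. -/
noncomputable abbrev restrictToCompactOpens :
    TopCat.Sheaf CommGrpCat.{max u v} (TopCat.of (Spc K)) ⥤
      Sheaf (compactOpensTopology K) CommGrpCat.{max u v} :=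
  (compactOpensToOpens K).sheafPushforwardContinuous _ _ _

/-- The comparison lemma: the quasi-compact open sets form a basis, hence a dense subsite. Essential
surjectivity gives the sheaf `𝔾ₘ`, full faithfulness its uniqueness. -/
instance : (restrictToCompactOpens (K := K)).IsEquivalence := by
  have : HasLimitsOfSize.{u, u} CommGrpCat.{max u v} := hasLimitsOfSizeShrink.{u, u, v, v} _
  have (X : (Opens (TopCat.of (Spc K)))ᵒᵖ) : HasLimitsOfShape
      (StructuredArrow X (compactOpensToOpens K).op) CommGrpCat.{max u v} := inferInstance
  have : (compactOpensToOpens K).IsDenseSubsite (compactOpensTopology K)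
    (Opens.grothendieckTopology (TopCat.of (Spc K))) := inferInstance
  exact ((compactOpensToOpens K).sheafAdjunctionCocontinuous CommGrpCat.{max u v}
    (compactOpensTopology K) (Opens.grothendieckTopology
      (TopCat.of (Spc K)))).toEquivalence.isEquivalence_functor

theorem exists_gmSheaf (hv : ShiftUnitVanishing K) :
    ∃ F : TopCat.Sheaf CommGrpCat.{max u v} (TopCat.of (Spc K)),
      Nonempty ((compactOpensToOpens K).op ⋙ F.obj ≅ gmPresheaf K) := by
  let G : Sheaf (compactOpensTopology K) CommGrpCat.{max u v} := ⟨gmPresheaf K, isSheaf_gmPresheaf hv⟩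
  exact ⟨restrictToCompactOpens.objPreimage G,
    ⟨(sheafToPresheaf _ _).mapIso (restrictToCompactOpens.objObjPreimageIso G)⟩⟩

theorem existsUnique_gmSheaf_iso {F F' : TopCat.Sheaf CommGrpCat.{max u v} (TopCat.of (Spc K))}
    (φ : (compactOpensToOpens K).op ⋙ F.obj ≅ gmPresheaf K)
    (φ' : (compactOpensToOpens K).op ⋙ F'.obj ≅ gmPresheaf K) :
    ∃! e : F ≅ F',
      Functor.whiskerLeft (compactOpensToOpens K).op e.hom.hom ≫ φ'.hom = φ.hom := by
  let ψ : restrictToCompactOpens.obj F ≅ restrictToCompactOpens.obj F' :=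
    (fullyFaithfulSheafToPresheaf _ _).preimageIso (φ ≪≫ φ'.symm)
  have hψ : ψ.hom.hom = φ.hom ≫ φ'.inv := rfl
  have key (e : F ≅ F') : Functor.whiskerLeft (compactOpensToOpens K).op e.hom.hom =
    (restrictToCompactOpens.mapIso e).hom.hom := rfl
  refine ⟨restrictToCompactOpens.preimageIso ψ, ?_, fun e he => ?_⟩
  · beta_reduce
    rw [key]
    simp [hψ]
  · apply restrictToCompactOpens.mapIso_injective
    ext : 2
    rw [← key, Functor.mapIso_hom, Functor.preimageIso_hom, Functor.map_preimage, hψ, ← he]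
    simp
    rfl

end GmSheaf

end TTCat

namespace TTCat

/-! ### Operations on gluings and their uniqueness -/

section Gluings

variable {K : Type u} [Category.{v} K] [Preadditive K] [HasZeroObject K] [HasShift K ℤ]
  [∀ n : ℤ, (shiftFunctor K n).Additive] [Pretriangulated K] [MonoidalCategory K]
  {ι : Type*} {U : ι → CompactOpens (Spc K)}

/-- The isomorphisms `f i` make the object `a` of `K` a gluing of copies of `𝟙` along `σ`. -/
structure UnitCocycle.GluesBy (σ : UnitCocycle U) (a : K) (f : ∀ i, LHom (U i) a (𝟙_ K)) :
    Prop where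
  isIso (i : ι) : IsIso (f i)
  comp_mor (i j : ι) (W : CompactOpens (Spc K)) (h : W ≤ U i) (h' : W ≤ U j) :
    lres h (f i) ≫ σ.mor j i W h' h = lres h' (f j)

/-- The object `a` of `K` is a gluing of copies of `𝟙` along `σ`. -/
def UnitCocycle.Glues (σ : UnitCocycle U) (a : K) : Prop := ∃ f, σ.GluesBy a f

namespace UnitCocycle

variable {σ : UnitCocycle U} {a b : K}

lemma Glues.of_iso (h : σ.Glues a) (e : a ≅ b) : σ.Glues b := by
  obtain ⟨f, hf⟩ := h
  have := hf.isIso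
  exact ⟨fun i => lmap (U i) e.inv ≫ f i, fun i => inferInstance, fun i j W h h' => by
    rw [lres_comp, lres_comp, lres_lmap, lres_lmap, Category.assoc, hf.comp_mor]⟩

/-- Pullback of cocycles to a refinement. -/
def comap (σ : UnitCocycle U) {κ : Type*} {V : κ → CompactOpens (Spc K)} (r : κ → ι)
    (hr : ∀ k, V k ≤ U (r k)) : UnitCocycle V where
  mor j i W hj hi := σ.mor (r j) (r i) W (hj.trans (hr j)) (hi.trans (hr i))
  lres_mor _ _ _ _ _ _ _ := σ.lres_mor _ _ _ _ _
  mor_self _ _ _ := σ.mor_self _ _ _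
  mor_comp _ _ _ _ _ _ _ := σ.mor_comp _ _ _ _ _ _ _

lemma Glues.comap (h : σ.Glues a) {κ : Type*} {V : κ → CompactOpens (Spc K)} (r : κ → ι)
    (hr : ∀ k, V k ≤ U (r k)) : (σ.comap r hr).Glues a := by
  obtain ⟨f, hf⟩ := h
  refine ⟨fun k => lres (hr k) (f (r k)), fun k => ?_, fun i j W h h' => ?_⟩
  · have := hf.isIso (r k)
    infer_instance
  · rw [lres_lres, lres_lres]
    exact hf.comp_mor _ _ _ _ _

lemma glues_unit (hσ : ∀ i j W h h', σ.mor j i W h' h = 𝟙 _) : σ.Glues (𝟙_ K) :=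
  ⟨fun i => 𝟙 _, fun i => inferInstance, fun i j W h h' => by simp [hσ]⟩

lemma Glues.of_coboundary {τ : UnitCocycle U} (h : σ.Glues a)
    (c : ∀ i, LHom (U i) (𝟙_ K) (𝟙_ K)) [∀ i, IsIso (c i)]
    (hc : ∀ i j W (h : W ≤ U i) (h' : W ≤ U j),
      lres h (c i) ≫ τ.mor j i W h' h = σ.mor j i W h' h ≫ lres h' (c j)) : τ.Glues a := by
  obtain ⟨f, hf⟩ := h
  have := hf.isIso
  exact ⟨fun i => f i ≫ c i, fun i => inferInstance, fun i j W h h' => by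
    rw [lres_comp, Category.assoc, hc, ← Category.assoc, hf.comp_mor, lres_comp]⟩

end UnitCocycle

variable [IsTriangulated K] [SymmetricCategory K] [TensorTriangulated K]

/-- Both sides are `f ⊗ t` up to unitors; the coincidence of the left and right unitors on `𝟙`
enters here. It is what makes a tensor product of gluings a gluing along the product cocycle. -/
lemma comp_unit_endomorphism {W : CompactOpens (Spc K)} {a : K} (f : LHom W a (𝟙_ K))
    (t : LHom W (𝟙_ K) (𝟙_ K)) :
    lmap W (ρ_ a).hom ≫ f ≫ t = lwhisker a t ≫ lmap W (ρ_ a).hom ≫ f := by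
  obtain ⟨a', p, hp, q, hq⟩ := exists_fraction f
  obtain ⟨w, s, hs, g, hg⟩ := exists_fraction t
  have := isIso_lmap ((locW W).whiskerLeft_mem a s hs)
  have := isIso_lmap ((locW W).whiskerRight_mem p hp w)
  have h (r : w ⟶ 𝟙_ K) : lmap W (p ▷ w) ≫ lmap W (a ◁ r) ≫ lmap W (ρ_ a).hom ≫ f =
      lmap W (q ▷ w) ≫ lmap W (λ_ w).hom ≫ lmap W r := by
    have h₁ : p ▷ w ≫ a ◁ r ≫ (ρ_ a).hom = (a' ◁ r ≫ (ρ_ a').hom) ≫ p := by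
      rw [← whisker_exchange_assoc, rightUnitor_naturality, Category.assoc]
    have h₂ : (a' ◁ r ≫ (ρ_ a').hom) ≫ q = q ▷ w ≫ (λ_ w).hom ≫ r := by
      rw [Category.assoc, ← rightUnitor_naturality, whisker_exchange_assoc, ← unitors_equal,
        leftUnitor_naturality]
    rw [← lmap_comp_assoc, ← lmap_comp_assoc, Category.assoc, h₁, lmap_comp_assoc, hq, ← lmap_comp,
      h₂, lmap_comp, lmap_comp]
  rw [← cancel_epi (lmap W (a ◁ s)), ← cancel_epi (lmap W (p ▷ w))]
  have h₃ := congrArg (lwhisker a) hg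
  rw [lwhisker_comp, lwhisker_lmap, lwhisker_lmap] at h₃
  rw [reassoc_of% h₃, h, ← hg, reassoc_of% h s]

instance {W : CompactOpens (Spc K)} (c : K) {a b : K} (f : LHom W a b) [IsIso f] :
    IsIso (lwhisker c f) :=
  inferInstanceAs (IsIso ((tensorL W c).map f))

lemma UnitCocycle.Glues.tensor {σ τ π : UnitCocycle U} {a b : K} (hσ : σ.Glues a) (hτ : τ.Glues b)
    (hπ : ∀ i j W h h', π.mor j i W h' h = σ.mor j i W h' h ≫ τ.mor j i W h' h) :
    π.Glues (a ⊗ b) := by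
  obtain ⟨f, hf⟩ := hσ
  obtain ⟨g, hg⟩ := hτ
  have := hf.isIso
  have := hg.isIso
  refine ⟨fun i => lwhisker a (g i) ≫ lmap (U i) (ρ_ a).hom ≫ f i, fun i => inferInstance,
    fun i j W h h' => ?_⟩
  simp only [lres_comp, lres_lwhisker, lres_lmap, Category.assoc, hπ]
  rw [reassoc_of% hf.comp_mor i j W h h', comp_unit_endomorphism, ← Category.assoc, ← lwhisker_comp,
    hg.comp_mor]

variable [MonoidalClosed K] [StronglyClosed K]

lemma existsUnique_hom (hv : ShiftUnitVanishing K) [Finite ι] (hU : ∀ x : Spc K, ∃ i, x ∈ U i)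
    {a b : K} (f : ∀ i, LHom (U i) a (𝟙_ K)) (g : ∀ i, LHom (U i) b (𝟙_ K)) [∀ i, IsIso (f i)]
    [∀ i, IsIso (g i)] (k : ∀ i, LHom (U i) a b)
    (hk : ∀ (i j : ι) (W : CompactOpens (Spc K)) (h : W ≤ U i) (h' : W ≤ U j),
      lres h (k i) = lres h' (k j)) :
    ∃! l : a ⟶ b, ∀ i, lmap (U i) l = k i := by
  obtain ⟨l, hl, hl'⟩ := existsUnique_glue hv (V := ⊤) (fun _ => le_top) (fun x _ => hU x) f g k hk
  obtain ⟨m, rfl⟩ := (lmap_top_bijective a b).2 l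
  simp only [lres_lmap] at hl
  exact ⟨m, hl, fun m' hm' => (lmap_top_bijective a b).1 (hl' _ fun i => by
    rw [lres_lmap, hm'])⟩

/-- Gluings of copies of `𝟙` along a cocycle are unique up to unique isomorphism. -/
theorem UnitCocycle.GluesBy.existsUnique_iso (hv : ShiftUnitVanishing K) [Finite ι]
    (hU : ∀ x : Spc K, ∃ i, x ∈ U i) {σ : UnitCocycle U} {a b : K}
    {f : ∀ i, LHom (U i) a (𝟙_ K)} {g : ∀ i, LHom (U i) b (𝟙_ K)} (hf : σ.GluesBy a f)
    (hg : σ.GluesBy b g) : ∃! e : a ≅ b, ∀ i, lmap (U i) e.hom ≫ g i = f i := by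
  have key {a b : K} {f : ∀ i, LHom (U i) a (𝟙_ K)} {g : ∀ i, LHom (U i) b (𝟙_ K)}
      (hf : σ.GluesBy a f) (hg : σ.GluesBy b g) :
      ∃! l : a ⟶ b, ∀ i, lmap (U i) l ≫ g i = f i := by
    have := hf.isIso
    have := hg.isIso
    have := existsUnique_hom hv hU f g (fun i => f i ≫ inv (g i)) fun i j W h h' => by
      have h₁ := hf.comp_mor i j W h h'
      have h₂ := hg.comp_mor i j W h h'
      rw [← cancel_mono (lres h' (g j)), ← lres_comp h', Category.assoc, IsIso.inv_hom_id,
        Category.comp_id, ← h₂, ← h₁, ← Category.assoc, ← lres_comp, Category.assoc,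
        IsIso.inv_hom_id, Category.comp_id]
    simpa only [IsIso.eq_comp_inv] using this
  obtain ⟨l, hl, hl'⟩ := key hf hg
  obtain ⟨m, hm, -⟩ := key hg hf
  obtain ⟨_, -, h₁⟩ := key hf hf
  obtain ⟨_, -, h₂⟩ := key hg hg
  refine ⟨⟨l, m, (h₁ _ fun i => ?_).trans (h₁ _ fun i => ?_).symm,
    (h₂ _ fun i => ?_).trans (h₂ _ fun i => ?_).symm⟩, hl, fun e he => Iso.ext (hl' _ he)⟩
  · rw [lmap_comp, Category.assoc, hm, hl]
  · rw [lmap_id, Category.id_comp]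
  · rw [lmap_comp, Category.assoc, hl, hm]
  · rw [lmap_id, Category.id_comp]

end Gluings

end TTCat

namespace TTCat

/-! ### From Čech cocycles to unit cocycles -/

section Cech

variable {K : Type u} [Category.{v} K] [Preadditive K] [HasZeroObject K] [HasShift K ℤ]
  [∀ n : ℤ, (shiftFunctor K n).Additive] [Pretriangulated K] [MonoidalCategory K]
  [IsTriangulated K] [SymmetricCategory K] [TensorTriangulated K]
  {F : TopCat.Presheaf CommGrpCat.{max u v} (TopCat.of (Spc K))}
  (φ : (compactOpensToOpens K).op ⋙ F ≅ gmPresheaf K)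

/-- A section of `F` over a quasi-compact open subset, as an element of `𝔾ₘ(K(W))`. -/
noncomputable def gmOfSection (W : CompactOpens (Spc K)) : F.obj (op W.toOpens) →* Gm W :=
  (φ.hom.app (op W)).hom

/-- The restriction of a section of `F` to a quasi-compact open subset, as an element
of `𝔾ₘ(K(W))`. -/
noncomputable def toGm (W : CompactOpens (Spc K)) {V : Opens (TopCat.of (Spc K))}
    (h : W.toOpens ≤ V) : F.obj (op V) →* Gm W :=
  (gmOfSection φ W).comp (Cech.res F h)

lemma toGm_res {W : CompactOpens (Spc K)} {V V' : Opens (TopCat.of (Spc K))}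
    (h : W.toOpens ≤ V) (h' : V ≤ V') (x : F.obj (op V')) :
    toGm φ W h (Cech.res F h' x) = toGm φ W (h.trans h') x :=
  congrArg (gmOfSection φ W) (Cech.res_res F h h' x)

lemma toOpens_le {W W' : CompactOpens (Spc K)} (h : W ≤ W') : W.toOpens ≤ W'.toOpens := h

lemma toOpens_le_inf {W U V : CompactOpens (Spc K)} (h : W ≤ U) (h' : W ≤ V) :
    W.toOpens ≤ U.toOpens ⊓ V.toOpens := le_inf (toOpens_le h) (toOpens_le h')

lemma resGm_toGm {W W' : CompactOpens (Spc K)} {V : Opens (TopCat.of (Spc K))} (k : W' ≤ W)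
    (h : W.toOpens ≤ V) (x : F.obj (op V)) :
    resGm k (toGm φ W h x) = toGm φ W' ((toOpens_le k).trans h) x :=
  (ConcreteCategory.congr_hom (φ.hom.naturality (homOfLE k).op) (Cech.res F h x)).symm.trans
    (toGm_res φ (toOpens_le k) h x)

lemma toGm_bijective (W : CompactOpens (Spc K)) :
    Function.Bijective (toGm φ W (le_refl W.toOpens)) := by
  have h : ⇑(toGm φ W (le_refl W.toOpens)) = gmOfSection φ W := by
    ext x
    exact congrArg (gmOfSection φ W) (Cech.res_self F _ x)
  rw [h]
  exact ConcreteCategory.bijective_of_isIso (φ.hom.app (op W))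

/-- The automorphisms of `𝟙` given by a `1`-cocycle of `F`. -/
noncomputable def unitCocycle {ι : Type*} (U : ι → CompactOpens (Spc K))
    (σ : Cech.cocycles F fun i => (U i).toOpens) : UnitCocycle U where
  mor j i W hj hi := (toGm φ W (toOpens_le_inf hj hi) (σ.1 j i)).mor
  lres_mor j i W W' h hj hi := by rw [← Gm.mor_res, resGm_toGm]
  mor_comp i j k W hi hj hk := by
    have := congrArg (toGm φ W le_rfl) (Cech.cocycle_res F _ σ.2 (W := W.toOpens) k j i hk hj hi)
    -- The factors in the Čech condition and in the composition appear in opposite orders, which is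
    -- harmless in a commutative group.
    rw [map_mul, toGm_res, toGm_res, toGm_res, mul_comm] at this
    rw [← Gm.mor_mul, this]
  mor_self i W hi := by
    have := congrArg (toGm φ W le_rfl) (Cech.cocycle_res F _ σ.2 (W := W.toOpens) i i i hi hi hi)
    rw [map_mul, toGm_res, mul_eq_left] at this
    rw [this, Gm.mor_one]

variable {φ}

lemma UnitCocycle.Glues.refine {ι κ : Type*} {U : ι → CompactOpens (Spc K)}
    {σ : Cech.cocycles F fun i => (U i).toOpens} {a : K} (h : (unitCocycle φ U σ).Glues a)
    {V : κ → CompactOpens (Spc K)} (r : κ → ι) (hr : ∀ k, (V k).toOpens ≤ (U (r k)).toOpens) :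
    (unitCocycle φ V (Cech.refineCocycle F r hr σ)).Glues a := by
  have h₁ := h.comap r hr
  have h₂ : (unitCocycle φ U σ).comap r hr = unitCocycle φ V (Cech.refineCocycle F r hr σ) := by
    unfold UnitCocycle.comap unitCocycle
    congr 1
    ext j i W hj hi
    exact congrArg Gm.mor (toGm_res φ (toOpens_le_inf hj hi) (inf_le_inf (hr j) (hr i)) _).symm
  rwa [h₂] at h₁

lemma toGm_coboundary {ι : Type*} {U : ι → CompactOpens (Spc K)}
    {σ : Cech.Cochain₁ F fun i => (U i).toOpens} {c : Cech.Cochain₀ F fun i => (U i).toOpens}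
    (h : Cech.coboundary F _ c = σ) (i j : ι) (W : CompactOpens (Spc K)) (hi : W ≤ U i)
    (hj : W ≤ U j) : toGm φ W (toOpens_le hi) (c i) =
      toGm φ W (toOpens_le_inf hi hj) (σ i j) * toGm φ W (toOpens_le hj) (c j) := by
  subst h
  rw [← div_eq_iff_eq_mul]
  refine Eq.trans ?_ (map_div (toGm φ W (toOpens_le_inf hi hj))
    (Cech.res F inf_le_left (c i)) (Cech.res F inf_le_right (c j))).symm
  rw [toGm_res, toGm_res]

lemma UnitCocycle.Glues.of_mk_eq {ι : Type*} {U : ι → CompactOpens (Spc K)}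
    {σ τ : Cech.cocycles F fun i => (U i).toOpens} {a : K} (h : (unitCocycle φ U σ).Glues a)
    (hστ : (QuotientGroup.mk σ : Cech.H1 F fun i => (U i).toOpens) = QuotientGroup.mk τ) :
    (unitCocycle φ U τ).Glues a := by
  -- The cochain `c` has coboundary `τ / σ`; multiplying the local isomorphisms by it turns a gluing
  -- along `σ` into one along `τ`.
  obtain ⟨c, hc⟩ := QuotientGroup.eq_iff_div_mem.1 hστ.symm
  refine h.of_coboundary (fun i => (toGm φ (U i) le_rfl (c i)).mor) fun i j W h h' => ?_
  rw [← Gm.mor_res, ← Gm.mor_res, resGm_toGm, resGm_toGm]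
  change _ ≫ (toGm φ W _ _).mor = (toGm φ W _ _).mor ≫ _
  rw [← Gm.mor_mul, ← Gm.mor_mul, toGm_coboundary hc j i W h' h]
  have : toGm φ W (toOpens_le_inf h' h) (τ.1 j i / σ.1 j i) = _ := map_div _ _ _
  refine congrArg Gm.mor ?_
  refine Eq.trans ?_ (congrArg (fun x => _ * (x * _)) this.symm)
  rw [← mul_assoc, mul_div_cancel, mul_comm]

/-- The local isomorphisms `𝟙 ≅ 𝟙` are themselves units, and the gluing condition says that their
coboundary is `σ`. -/
lemma mk_eq_one_of_glues_unit {ι : Type*} {U : ι → CompactOpens (Spc K)}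
    {σ : Cech.cocycles F fun i => (U i).toOpens} (h : (unitCocycle φ U σ).Glues (𝟙_ K)) :
    (QuotientGroup.mk σ : Cech.H1 F fun i => (U i).toOpens) = 1 := by
  obtain ⟨f, hf⟩ := h
  have := hf.isIso
  choose c hc using fun i => (toGm_bijective φ (U i)).2 (Gm.ofIso (f i))
  refine (QuotientGroup.eq_one_iff σ).2 ⟨c, ?_⟩
  ext j i
  refine (toGm_bijective φ (U j ⊓ U i)).1 ?_
  have h₁ := hf.comp_mor i j (U j ⊓ U i) inf_le_right inf_le_left
  have h₂ := toGm_coboundary (φ := φ) (c := c) rfl j i (U j ⊓ U i) inf_le_left inf_le_right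
  rw [← resGm_toGm φ inf_le_left le_rfl, ← resGm_toGm φ inf_le_right le_rfl, hc, hc,
    ← div_eq_iff_eq_mul] at h₂
  refine h₂.symm.trans (div_eq_iff_eq_mul.2 (Gm.mor_injective ?_))
  rw [mul_comm, Gm.mor_mul, Gm.mor_res, Gm.mor_res]
  exact h₁.symm

variable (K) in
/-- A finite cover of the spectrum by quasi-compact open subsets. -/
structure FiniteCover where
  /-- the index type -/
  ι : Type u
  finite : Finite ι
  /-- the members of the cover -/
  U : ι → CompactOpens (Spc K)
  isOpenCover : IsOpenCover (X := TopCat.of (Spc K)) fun i => (U i).toOpens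

attribute [instance] FiniteCover.finite

/-- The underlying open cover. -/
def FiniteCover.toOpenCover (𝒱 : FiniteCover K) : Cech.OpenCover (TopCat.of (Spc K)) :=
  ⟨𝒱.ι, fun i => (𝒱.U i).toOpens, 𝒱.isOpenCover⟩

variable [MonoidalClosed K] [StronglyClosed K]

lemma exists_finiteCover_le (𝒰 : Cech.OpenCover (TopCat.of (Spc K))) :
    ∃ 𝒱 : FiniteCover K, 𝒰 ≤ 𝒱.toOpenCover := by
  have h (x : Spc K) : ∃ (V : CompactOpens (Spc K)) (i : 𝒰.ι), V.toOpens ≤ 𝒰.U i ∧ x ∈ V := by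
    obtain ⟨i, hi⟩ := 𝒰.isOpenCover.exists_mem x
    obtain ⟨V, ⟨hVo, hVc⟩, hxV, hVU⟩ :=
      (PrespectralSpace.isTopologicalBasis (X := Spc K)).exists_subset_of_mem_open hi (𝒰.U i).2
    exact ⟨⟨⟨V, hVc⟩, hVo⟩, i, hVU, hxV⟩
  choose V i hV hxV using h
  obtain ⟨t, ht⟩ := isCompact_univ.elim_finite_subcover (fun x => (V x : Set (Spc K)))
    (fun x => (V x).isOpen) fun x _ => Set.mem_iUnion.2 ⟨x, hxV x⟩
  refine ⟨⟨t, inferInstance, fun x => V x, ?_⟩, fun (x : t) => ⟨i x, hV x⟩⟩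
  rw [IsOpenCover, eq_top_iff]
  intro x _
  have := ht (Set.mem_univ x)
  simp only [Set.mem_iUnion] at this
  obtain ⟨y, hy, hx⟩ := this
  exact Opens.mem_iSup.2 ⟨⟨y, hy⟩, hx⟩

lemma exists_cechClass_eq (𝒰 : Cech.OpenCover (TopCat.of (Spc K))) (x : Cech.H1 F 𝒰.U)
    (𝒱 : FiniteCover K) (h : 𝒰 ≤ 𝒱.toOpenCover) : ∃ σ : Cech.cocycles F 𝒱.toOpenCover.U,
      (⟦⟨𝒰, x⟩⟧ : Cech.CechH1 F) = Cech.cechClass F 𝒱.toOpenCover σ := by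
  obtain ⟨σ, hσ⟩ := QuotientGroup.mk_surjective (Cech.transition F _ _ h x)
  exact ⟨σ, by rw [Cech.cechClass, hσ]; exact (DirectLimit.mk_apply (f := Cech.transition F) _ _ _ h).symm⟩

end Cech

end TTCat

namespace TTCat

/-! ### The homomorphism to the Picard group -/

section Picard

variable {K : Type u} [Category.{v} K] [Preadditive K] [HasZeroObject K] [HasShift K ℤ]
  [∀ n : ℤ, (shiftFunctor K n).Additive] [Pretriangulated K] [MonoidalCategory K]
  [IsTriangulated K] [SymmetricCategory K] [TensorTriangulated K]
  [MonoidalClosed K] [StronglyClosed K]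
  {F : TopCat.Presheaf CommGrpCat.{max u v} (TopCat.of (Spc K))}
  {φ : (compactOpensToOpens K).op ⋙ F ≅ gmPresheaf K}

lemma FiniteCover.exists_mem (𝒱 : FiniteCover K) (x : Spc K) : ∃ i, x ∈ 𝒱.U i :=
  𝒱.isOpenCover.exists_mem x

/-- Well-definedness of `α`: the cocycles become cohomologous on a common refinement, which can be
taken finite and quasi-compact, and gluings there are unique up to isomorphism. -/
lemma nonempty_iso_of_cechClass_eq (hv : ShiftUnitVanishing K) {𝒱 𝒲 : FiniteCover K}
    {σ : Cech.cocycles F 𝒱.toOpenCover.U} {τ : Cech.cocycles F 𝒲.toOpenCover.U} {a b : K}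
    (hσ : (unitCocycle φ 𝒱.U σ).Glues a) (hτ : (unitCocycle φ 𝒲.U τ).Glues b)
    (h : Cech.cechClass F 𝒱.toOpenCover σ = Cech.cechClass F 𝒲.toOpenCover τ) :
    Nonempty (a ≅ b) := by
  obtain ⟨𝒰, h₁, h₂, e⟩ := Quotient.exact h
  obtain ⟨𝒰', h'⟩ := exists_finiteCover_le 𝒰
  have e' := congrArg (Cech.transition F _ _ h') e
  rw [DirectedSystem.map_map' (Cech.transition F · · ·),
    DirectedSystem.map_map' (Cech.transition F · · ·)] at e'
  obtain ⟨f, hf⟩ := (hσ.refine (V := 𝒰'.U) (fun j => ((h₁.trans h') j).choose)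
    (fun j => ((h₁.trans h') j).choose_spec)).of_mk_eq e'
  obtain ⟨g, hg⟩ := hτ.refine (V := 𝒰'.U) (fun j => ((h₂.trans h') j).choose)
    (fun j => ((h₂.trans h') j).choose_spec)
  exact (hf.existsUnique_iso hv 𝒰'.exists_mem hg).exists.nonempty

lemma exists_finiteCover_cechClass (x y : Cech.CechH1 F) :
    ∃ (𝒱 : FiniteCover K) (σ τ : Cech.cocycles F 𝒱.toOpenCover.U),
      x = Cech.cechClass F 𝒱.toOpenCover σ ∧ y = Cech.cechClass F 𝒱.toOpenCover τ := by
  obtain ⟨𝒰, x, y, rfl, rfl⟩ := DirectLimit.exists_eq_mk₂ (f := Cech.transition F) x y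
  obtain ⟨𝒱, h⟩ := exists_finiteCover_le 𝒰
  obtain ⟨σ, hσ⟩ := exists_cechClass_eq 𝒰 x 𝒱 h
  obtain ⟨τ, hτ⟩ := exists_cechClass_eq 𝒰 y 𝒱 h
  exact ⟨𝒱, σ, τ, hσ, hτ⟩

lemma cechClass_mul (𝒰 : Cech.OpenCover (TopCat.of (Spc K))) (σ τ : Cech.cocycles F 𝒰.U) :
    Cech.cechClass F 𝒰 (σ * τ) = Cech.cechClass F 𝒰 σ * Cech.cechClass F 𝒰 τ :=
  (DirectLimit.mul_def (G := fun 𝒰 : Cech.OpenCover (TopCat.of (Spc K)) => Cech.H1 F 𝒰.U)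
    (f := Cech.transition F) 𝒰 (QuotientGroup.mk σ) (QuotientGroup.mk τ)).symm

lemma cechClass_one (𝒰 : Cech.OpenCover (TopCat.of (Spc K))) :
    Cech.cechClass F 𝒰 1 = 1 :=
  (DirectLimit.one_def (f := Cech.transition F) 𝒰).symm

variable [IsIdempotentComplete K]

lemma exists_glues (φ : (compactOpensToOpens K).op ⋙ F ≅ gmPresheaf K)
    (hv : ShiftUnitVanishing K) (𝒱 : FiniteCover K) (σ : Cech.cocycles F 𝒱.toOpenCover.U) :
    ∃ a, (unitCocycle φ 𝒱.U σ).Glues a := by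
  obtain ⟨a, f, hf, h⟩ := (unitCocycle φ 𝒱.U σ).exists_gluing hv 𝒱.exists_mem
  exact ⟨a, f, hf, h⟩

/-- The isomorphism classes of the gluings of copies of `𝟙` define an injective homomorphism
from the first Čech cohomology group to the Picard group. -/
theorem exists_cechH1_to_pic (φ : (compactOpensToOpens K).op ⋙ F ≅ gmPresheaf K)
    (hv : ShiftUnitVanishing K) :
    ∃ α : Cech.CechH1 F →* Pic K, Function.Injective α ∧
      ∀ (𝒱 : FiniteCover K) (σ : Cech.cocycles F 𝒱.toOpenCover.U) (a : K),
        (unitCocycle φ 𝒱.U σ).Glues a →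
          (α (Cech.cechClass F 𝒱.toOpenCover σ) : Skeleton K) = toSkeleton a := by
  have h (x : Cech.CechH1 F) : ∃ (a : K) (𝒱 : FiniteCover K)
      (σ : Cech.cocycles F 𝒱.toOpenCover.U), x = Cech.cechClass F 𝒱.toOpenCover σ ∧
        (unitCocycle φ 𝒱.U σ).Glues a := by
    obtain ⟨𝒱, σ, -, h, -⟩ := exists_finiteCover_cechClass x x
    obtain ⟨a, ha⟩ := exists_glues φ hv 𝒱 σ
    exact ⟨a, 𝒱, σ, h, ha⟩
  choose a 𝒱 σ hσ ha using h
  have spec (𝒲 : FiniteCover K) (τ : Cech.cocycles F 𝒲.toOpenCover.U) (b : K)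
      (hb : (unitCocycle φ 𝒲.U τ).Glues b) :
      toSkeleton (a (Cech.cechClass F 𝒲.toOpenCover τ)) = toSkeleton b :=
    toSkeleton_eq_toSkeleton_iff.2 (nonempty_iso_of_cechClass_eq hv (ha _) hb (hσ _).symm)
  have unit (𝒲 : FiniteCover K) : (unitCocycle φ 𝒲.U (1 : Cech.cocycles F
      𝒲.toOpenCover.U)).Glues (𝟙_ K) :=
    UnitCocycle.glues_unit fun i j W h h' => by
      change (toGm φ W (toOpens_le_inf h' h) 1).mor = _
      rw [map_one, Gm.mor_one]
  let α₀ : Cech.CechH1 F →* Skeleton K :=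
    { toFun := fun x => toSkeleton (a x)
      map_one' := by
        obtain ⟨𝒲, -⟩ := exists_finiteCover_cechClass (1 : Cech.CechH1 F) 1
        rw [← cechClass_one 𝒲.toOpenCover, spec 𝒲 1 _ (unit 𝒲), Skeleton.one_eq]
      map_mul' := fun x y => by
        obtain ⟨𝒲, τ, π, rfl, rfl⟩ := exists_finiteCover_cechClass x y
        obtain ⟨b, hb⟩ := exists_glues φ hv 𝒲 τ
        obtain ⟨c, hc⟩ := exists_glues φ hv 𝒲 π
        have hbc : (unitCocycle φ 𝒲.U (τ * π)).Glues (b ⊗ c) :=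
          hb.tensor hc fun i j W h h' => by
            rw [show (unitCocycle φ 𝒲.U (τ * π)).mor j i W h' h =
              (toGm φ W (toOpens_le_inf h' h) (τ.1 j i) *
                toGm φ W (toOpens_le_inf h' h) (π.1 j i)).mor from
              congrArg Gm.mor (map_mul _ _ _), Gm.mor_mul]
            rfl
        rw [← cechClass_mul, spec _ _ _ hbc, spec _ _ _ hb, spec _ _ _ hc,
          Skeleton.toSkeleton_tensorObj] }
  -- Invertibility of the gluings is automatic, since a monoid homomorphism from a group takes
  -- values in units.
  refine ⟨α₀.toHomUnits, ?_, fun 𝒲 τ b hb => spec 𝒲 τ b hb⟩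
  rw [injective_iff_map_eq_one]
  intro x hx
  obtain ⟨𝒲, τ, -, rfl, -⟩ := exists_finiteCover_cechClass x x
  obtain ⟨b, hb⟩ := exists_glues φ hv 𝒲 τ
  have hx' : toSkeleton b = toSkeleton (𝟙_ K) :=
    (spec 𝒲 τ b hb).symm.trans (congrArg Units.val hx)
  obtain ⟨e⟩ := toSkeleton_eq_toSkeleton_iff.1 hx'
  have h₁ := mk_eq_one_of_glues_unit (hb.of_iso e)
  rw [← cechClass_one 𝒲.toOpenCover]
  exact congrArg (fun z => (⟦⟨𝒲.toOpenCover, z⟩⟧ : Cech.CechH1 F)) h₁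

section UnitGluing

variable {ι : Type*} {U : ι → CompactOpens (Spc K)}
  {σ : Cech.cocycles F fun i => (U i).toOpens}

/-- Together with the next two lemmas, this translates between gluings in `K(U)`, as in the theorem,
and gluings in `L(U)`, as in the proof. -/
lemma UnitGluing.gluesBy (G : UnitGluing U (transitionMor φ U σ.1)) :
    (unitCocycle φ U σ).GluesBy G.obj fun i => (G.iso i).hom.f where
  isIso i := ⟨(G.iso i).inv.f, congrArg Idempotents.Karoubi.Hom.f (G.iso i).hom_inv_id,
    congrArg Idempotents.Karoubi.Hom.f (G.iso i).inv_hom_id⟩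
  comp_mor i j W h h' := by
    have := congrArg Idempotents.Karoubi.Hom.f (G.comp_iso j i W h' h)
    rw [Idempotents.Karoubi.comp_f, resMor_f, resMor_f] at this
    exact this

lemma UnitCocycle.GluesBy.exists_unitGluing {a : K} {f : ∀ i, LHom (U i) a (𝟙_ K)}
    (h : (unitCocycle φ U σ).GluesBy a f) :
    ∃ G : UnitGluing U (transitionMor φ U σ.1), G.obj = a := by
  have := h.isIso
  refine ⟨⟨a, fun i => (Idempotents.toKaroubi _).mapIso (asIso (f i)),
    fun j i W hj hi => Idempotents.Karoubi.hom_ext _ _ ?_⟩, rfl⟩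
  rw [Idempotents.Karoubi.comp_f, resMor_f, resMor_f]
  exact h.comp_mor i j W hi hj

lemma UnitGluing.isGluingIso_iff (G G' : UnitGluing U (transitionMor φ U σ.1))
    (e : G.obj ≅ G'.obj) : G.IsGluingIso G' e ↔
      ∀ i, lmap (U i) e.hom ≫ (G'.iso i).hom.f = (G.iso i).hom.f :=
  forall_congr' fun _ => ⟨fun h => congrArg Idempotents.Karoubi.Hom.f h,
    fun h => Idempotents.Karoubi.hom_ext _ _ h⟩

end UnitGluing

end Picard

end TTCat

theorem mainTheorem6 (K : Type u) [Category.{v} K] [Preadditive K] [HasZeroObject K]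
    [HasShift K ℤ] [∀ n : ℤ, (shiftFunctor K n).Additive] [Pretriangulated K] [IsTriangulated K]
    [MonoidalCategory K] [SymmetricCategory K] [TTCat.TensorTriangulated K]
    [MonoidalClosed K] [TTCat.StronglyClosed K] [IsIdempotentComplete K]
    (hvan : ∀ U : CompactOpens (TTCat.Spc K),
      Subsingleton (TTCat.Mor U ((𝟙_ K)⟦(1 : ℤ)⟧) (𝟙_ K))) :
    ∃ (F : TopCat.Sheaf CommGrpCat.{max u v} (TopCat.of (TTCat.Spc K)))
      (φ : (TTCat.compactOpensToOpens K).op ⋙ F.obj ≅ TTCat.gmPresheaf K),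
      (∀ (F' : TopCat.Sheaf CommGrpCat.{max u v} (TopCat.of (TTCat.Spc K)))
        (φ' : (TTCat.compactOpensToOpens K).op ⋙ F'.obj ≅ TTCat.gmPresheaf K),
        ∃! e : F ≅ F',
          Functor.whiskerLeft (TTCat.compactOpensToOpens K).op e.hom.hom ≫ φ'.hom = φ.hom) ∧
      ∃ α : Cech.CechH1 F.obj →* TTCat.Pic K,
        Function.Injective α ∧
        ∀ (ι : Type u) [Finite ι] (U : ι → CompactOpens (TTCat.Spc K))
          (hU : IsOpenCover (X := TopCat.of (TTCat.Spc K)) fun i => (U i).toOpens)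
          (σ : Cech.cocycles F.obj fun i => (U i).toOpens),
          (∃ G : TTCat.UnitGluing U (TTCat.transitionMor φ U σ.1),
            (α (Cech.cechClass F.obj ⟨ι, _, hU⟩ σ) : Skeleton K) = toSkeleton G.obj) ∧
          ∀ G G' : TTCat.UnitGluing U (TTCat.transitionMor φ U σ.1),
            ∃! e : G.obj ≅ G'.obj, G.IsGluingIso G' e := by
  have hv := TTCat.shiftUnitVanishing_of_subsingleton hvan
  obtain ⟨F, ⟨φ⟩⟩ := TTCat.exists_gmSheaf (K := K) hv
  obtain ⟨α, hα, h⟩ := TTCat.exists_cechH1_to_pic φ hv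
  refine ⟨F, φ, fun F' φ' => TTCat.existsUnique_gmSheaf_iso φ φ', α, hα,
    fun ι _ U hU σ => ⟨?_, fun G G' => ?_⟩⟩
  · obtain ⟨a, f, hf⟩ := TTCat.exists_glues φ hv ⟨ι, inferInstance, U, hU⟩ σ
    obtain ⟨G, rfl⟩ := hf.exists_unitGluing
    exact ⟨G, h ⟨ι, inferInstance, U, hU⟩ σ _ ⟨f, hf⟩⟩
  · simp only [TTCat.UnitGluing.isGluingIso_iff]
    exact G.gluesBy.existsUnique_iso hv (fun x => hU.exists_mem x) G'.gluesBy
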